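/- Conventions. $\mathbf 0^{(n)}$ is the $n$-th Turing jump of $\emptyset$; a set is $\Sigma^0_{k+1}$ if it is c.e. in $\mathbf 0^{(k)}$, and complete $\Sigma^0_{k+1}$ if moreover every $\Sigma^0_{k+1}$ set is many-one reducible to it. Languages are relational and computable. An $X$-computable copy of a countable structure $\mathcal M$ is an isomorphic structure with universe $\mathbb N$ (or $\{0,\dots,s-1\}$ if $\mathcal M$ has $s<\infty$ elements) whose relations are uniformly computable from $X$; an index for it is an index of the $X$-computable function deciding its atomic diagram. In $\mathcal L_{\omega_1\omega}$ a formula is $\Sigma_0$ and $\Pi_0$ if it is finitary and quantifier-free; a $\Sigma_{k+1}$ formula is a countable disjunction $\bigvee_i\exists\bar x_i\,\psi_i$ with all $\psi_i$ being $\Pi_k$, and a $\Pi_{k+1}$ formula is a countable conjunction $\bigwedge_i\forall\bar x_i\,\psi_i$ with all $\psi_i$ being $\Sigma_k$. Such a formula is $X$-computable if, hereditarily, its disjunctions and conjunctions are over sets that are c.e. in $X$, with $X$-computable indices for the members. A Scott sentence of a countable structure $\mathcal M$ is a sentence whose countable models are exactly the structures isomorphic to $\mathcal M$. Setting. Fix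 $n\ge 0$, a complete $\Sigma^0_{2n+1}$ set $S\subseteq\mathbb N$, a computable relational language $\mathcal L$ without nullary symbols, computable $\mathcal L$-structures $\mathcal A,\mathcal B$ with universe $\mathbb N$ that have $\Pi_{n+2}$ Scott sentences, a uniformly computable sequence $(\mathcal C_i)_{i\in\mathbb N}$ of $\mathcal L$-structures with universe $\mathbb N$ such that $\mathcal C_i\cong\mathcal A$ if $i\in S$ and $\mathcal C_i\cong\mathcal B$ if $i\notin S$, and a $\mathbf 0^{(n)}$-computable $\Sigma_{n+1}$ sentence $\varphi$ with $\mathcal A\models\varphi$ and $\mathcal B\not\models\varphi$. For a graph (simple and undirected) $\mathcal G$, the unfriendly $n$-th jump inversion $\mathcal G^{(-n)}$ is the following structure in the language $\mathcal L\cup\{U,E,F\}$, with $U$ unary and $E,F$ ternary. Its universe consists of the vertices of $\mathcal G$ together with pairwise disjoint infinite sets $C_{u,v}=C_{v,u}$ and $D_{u,v}=D_{v,u}$, one of each for every unordered pair of distinct vertices $u,v$. $U$ holds exactly of the vertices; $E(u,v,x)$ holds iff $u\neq v$ are vertices and $x\in C_{u,v}$; $F(u,v,x)$ holds iff $u\ne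 v$ are vertices and $x\in D_{u,v}$. The relations of $\mathcal L$ hold only of tuples inside a single $C_{u,v}$ or a single $D_{u,v}$, and as $\mathcal L$-structures $(C_{u,v},D_{u,v})\cong(\mathcal A,\mathcal B)$ if $u,v$ are adjacent in $\mathcal G$, and $(C_{u,v},D_{u,v})\cong(\mathcal B,\mathcal A)$ otherwise. Theorem. (1) If a countable graph $\mathcal G$ has a $\mathbf 0^{(2n)}$-computable copy, then $\mathcal G^{(-n)}$ has a computable copy. (2) If, for a countable graph $\mathcal G$, the structure $\mathcal G^{(-n)}$ has a $\mathbf 0^{(n)}$-computable copy, then $\mathcal G$ has a $\mathbf 0^{(2n)}$-computable copy. Moreover, (1) and (2) are uniform: for every cardinality $s\in\{0,1,2,\dots\}\cup\{\aleph_0\}$ there is a computable function that maps every index of a copy as in the hypothesis, for any graph $\mathcal G$ with $s$ vertices, to an index of a copy as in the conclusion. (3) For every $\ell\ge0$ and every $\Sigma_\ell$ sentence $\psi$ in the language of graphs there is a $\Sigma_{n+\ell}$ sentence $\psi^*$ such that for all graphs $\mathcal G$: $\mathcal G\models\psi$ if and only if $\mathcal G^{(-n)}\models\psi^*$. (4)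 If $\ell\ge2$ and a countable graph $\mathcal G$ has a $\Pi_\ell$ Scott sentence, then $\mathcal G^{(-n)}$ has a $\Pi_{n+\ell}$ Scott sentence. (5) If $\ell\ge3$ and a countable graph $\mathcal G$ has a $\Sigma_\ell$ Scott sentence, then $\mathcal G^{(-n)}$ has a $\Sigma_{n+\ell}$ Scott sentence. -/

import Mathlib

namespace UJI

open FirstOrder

/-! ## Oracle computations, jumps, and the arithmetical hierarchy -/

/-- Programs for partial functions computable with an oracle: the usual schemes of the
partial recursive functions, together with a call to the oracle. -/
inductive OracleCode : Type
  | zero : OracleCode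
  | succ : OracleCode
  | left : OracleCode
  | right : OracleCode
  | oracle : OracleCode
  | pair : OracleCode → OracleCode → OracleCode
  | comp : OracleCode → OracleCode → OracleCode
  | prec : OracleCode → OracleCode → OracleCode
  | rfind : OracleCode → OracleCode

open Classical in
/-- The characteristic function of a set of natural numbers, as an oracle. -/
noncomputable def chi (X : Set ℕ) : ℕ → ℕ := fun x => if x ∈ X then 1 else 0

namespace OracleCode

/-- The partial function computed by a program with oracle `X`. -/
noncomputable def eval (X : Set ℕ) : OracleCode → ℕ →. ℕ
  | zero => fun _ => Part.some 0
  | succ => fun n => Part.some (n + 1)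
  | left => fun n => Part.some (Nat.unpair n).1
  | right => fun n => Part.some (Nat.unpair n).2
  | oracle => fun n => Part.some (chi X n)
  | pair f g => fun n => Nat.pair <$> eval X f n <*> eval X g n
  | comp f g => fun n => eval X g n >>= eval X f
  | prec f g => fun p =>
      (Nat.unpair p).2.rec (eval X f (Nat.unpair p).1) fun y IH => do
        let i ← IH
        eval X g (Nat.pair (Nat.unpair p).1 (Nat.pair y i))
  | rfind f => fun a =>
      Nat.rfind fun n => (fun m => decide (m = 0)) <$> eval X f (Nat.pair a n)

/-- The Gödel number of a program. -/
def encode : OracleCode → ℕ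
  | zero => 0
  | succ => 1
  | left => 2
  | right => 3
  | oracle => 4
  | pair f g => 4 * Nat.pair (encode f) (encode g) + 5
  | comp f g => 4 * Nat.pair (encode f) (encode g) + 6
  | prec f g => 4 * Nat.pair (encode f) (encode g) + 7
  | rfind f => 4 * encode f + 8

/-- The program with a given Gödel number. -/
def ofNat : ℕ → OracleCode
  | 0 => zero
  | 1 => succ
  | 2 => left
  | 3 => right
  | 4 => oracle
  | n + 5 =>
    have h : n / 4 < n + 5 := by omega
    have _h1 : (n / 4).unpair.1 < n + 5 := lt_of_le_of_lt (Nat.unpair_left_le _) h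
    have _h2 : (n / 4).unpair.2 < n + 5 := lt_of_le_of_lt (Nat.unpair_right_le _) h
    match n % 4 with
    | 0 => pair (ofNat (n / 4).unpair.1) (ofNat (n / 4).unpair.2)
    | 1 => comp (ofNat (n / 4).unpair.1) (ofNat (n / 4).unpair.2)
    | 2 => prec (ofNat (n / 4).unpair.1) (ofNat (n / 4).unpair.2)
    | _ => rfind (ofNat (n / 4))

theorem ofNat_encode (c : OracleCode) : ofNat (encode c) = c := by
  induction c with
  | zero | succ | left | right | oracle => simp [encode, ofNat]
  | pair f g hf hg =>
    rw [encode, ofNat]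
    have h1 : (4 * Nat.pair f.encode g.encode) % 4 = 0 := by omega
    have h2 : (4 * Nat.pair f.encode g.encode) / 4 = Nat.pair f.encode g.encode := by omega
    simp [h2, hf, hg]
  | comp f g hf hg =>
    change ofNat ((4 * Nat.pair f.encode g.encode + 1) + 5) = _
    rw [ofNat]
    have h1 : (4 * Nat.pair f.encode g.encode + 1) % 4 = 1 := by omega
    have h2 : (4 * Nat.pair f.encode g.encode + 1) / 4 = Nat.pair f.encode g.encode := by omega
    simp [h1, h2, hf, hg]
  | prec f g hf hg =>
    change ofNat ((4 * Nat.pair f.encode g.encode + 2) + 5) = _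
    rw [ofNat]
    have h1 : (4 * Nat.pair f.encode g.encode + 2) % 4 = 2 := by omega
    have h2 : (4 * Nat.pair f.encode g.encode + 2) / 4 = Nat.pair f.encode g.encode := by omega
    simp [h1, h2, hf, hg]
  | rfind f hf =>
    change ofNat ((4 * f.encode + 3) + 5) = _
    rw [ofNat]
    have h1 : (4 * f.encode + 3) % 4 = 3 := by omega
    have h2 : (4 * f.encode + 3) / 4 = f.encode := by omega
    simp [h1, h2, hf]

end OracleCode

/-- `Phi X e` is the `e`-th partial `X`-computable function. -/
noncomputable def Phi (X : Set ℕ) (e : ℕ) : ℕ →. ℕ := (OracleCode.ofNat e).eval X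

/-- The functions `Phi X e` are exactly the partial functions recursive in `X`. -/
theorem exists_Phi_eq_iff (X : Set ℕ) (f : ℕ →. ℕ) :
    (∃ e, Phi X e = f) ↔ Nat.RecursiveIn {(chi X : ℕ →. ℕ)} f := by
  constructor
  · rintro ⟨e, rfl⟩
    unfold Phi
    induction OracleCode.ofNat e with
    | zero => exact .zero
    | succ => exact .succ
    | left => exact .left
    | right => exact .right
    | oracle => exact .oracle _ rfl
    | pair f g hf hg => exact .pair hf hg
    | comp f g hf hg => exact .comp hf hg
    | prec f g hf hg => exact .prec hf hg
    | rfind f hf => exact .rfind hf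
  · intro h
    suffices H : ∃ c : OracleCode, c.eval X = f by
      obtain ⟨c, hc⟩ := H
      exact ⟨c.encode, by rw [Phi, OracleCode.ofNat_encode, hc]⟩
    induction h with
    | zero => exact ⟨.zero, rfl⟩
    | succ => exact ⟨.succ, rfl⟩
    | left => exact ⟨.left, rfl⟩
    | right => exact ⟨.right, rfl⟩
    | oracle g hg => exact ⟨.oracle, by rw [Set.mem_singleton_iff.1 hg]; rfl⟩
    | pair _ _ hf hg =>
      obtain ⟨c, rfl⟩ := hf
      obtain ⟨d, rfl⟩ := hg
      exact ⟨.pair c d, rfl⟩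
    | comp _ _ hf hg =>
      obtain ⟨c, rfl⟩ := hf
      obtain ⟨d, rfl⟩ := hg
      exact ⟨.comp c d, rfl⟩
    | prec _ _ hf hg =>
      obtain ⟨c, rfl⟩ := hf
      obtain ⟨d, rfl⟩ := hg
      exact ⟨.prec c d, rfl⟩
    | rfind _ hf =>
      obtain ⟨c, rfl⟩ := hf
      exact ⟨.rfind c, rfl⟩

/-- The Turing jump of `X`. -/
def jump (X : Set ℕ) : Set ℕ := {e | (Phi X e e).Dom}

/-- The `n`-th Turing jump of the empty set. -/
def zeroJump : ℕ → Set ℕ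
  | 0 => ∅
  | n + 1 => jump (zeroJump n)

/-- `W` is computably enumerable relative to `X`. -/
def CEIn (X W : Set ℕ) : Prop := ∃ e, ∀ x, x ∈ W ↔ (Phi X e x).Dom

/-- `W` is `Σ⁰_{k+1}`: computably enumerable relative to the `k`-th jump of the empty set. -/
def IsSigmaSucc (k : ℕ) (W : Set ℕ) : Prop := CEIn (zeroJump k) W

/-- `S` is a complete `Σ⁰_{k+1}` set (with respect to many-one reducibility). -/
def IsCompleteSigmaSucc (k : ℕ) (S : Set ℕ) : Prop :=
  IsSigmaSucc k S ∧
    ∀ W : Set ℕ, IsSigmaSucc k W → ManyOneReducible (fun x => x ∈ W) (fun x => x ∈ S)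

/-! ## Computable structures

Languages are relational, and the set of all relation symbols carries a Gödel numbering. -/

section Structures

variable {L : FirstOrder.Language.{0, 0}}

/-- Two structures, given explicitly, are isomorphic. -/
def Isomorphic {M N : Type} (S : L.Structure M) (T : L.Structure N) : Prop :=
  Nonempty (@FirstOrder.Language.Equiv L M N S T)

variable [Encodable (Σ k, L.Relations k)]

variable (L) in
/-- The Gödel numbering makes the language computable: one can decide which numbers are
relation symbols, and compute their arities. -/
def IsComputableLanguage : Prop :=
  Computable fun c : ℕ => (Encodable.decode₂ (Σ k, L.Relations k) c).map Sigma.fst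

/-- The Gödel number of the atomic statement `R (t 0, ..., t (k-1))` about natural numbers. -/
def atomCode {k : ℕ} (R : L.Relations k) (t : Fin k → ℕ) : ℕ :=
  Nat.pair (Encodable.encode (⟨k, R⟩ : Σ k, L.Relations k)) (Encodable.encode (List.ofFn t))

open Classical in
/-- The truth value of an atomic statement in a structure. -/
noncomputable def atomValue {M : Type} (S : L.Structure M) {k : ℕ} (R : L.Relations k)
    (v : Fin k → M) : ℕ :=
  if S.RelMap R v then 1 else 0

/-- With oracle `X`, the program `e` decides the atomic diagram of the structure `S`, whose
elements are named by natural numbers via `ν`. -/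
def DecidesDiagram (X : Set ℕ) (e : ℕ) {M : Type} (S : L.Structure M) (ν : M → ℕ) : Prop :=
  ∀ (k : ℕ) (R : L.Relations k) (v : Fin k → M),
    Phi X e (atomCode R (ν ∘ v)) = Part.some (atomValue S R v)

/-- The structure `S` with universe `ℕ` is computable. -/
def IsComputableStructure (S : L.Structure ℕ) : Prop :=
  ∃ e, DecidesDiagram ∅ e S id

/-- The structures `C i` with universe `ℕ` are computable uniformly in `i`. -/
def IsComputableSequence (C : ℕ → L.Structure ℕ) : Prop :=
  ∃ e, ∀ (i k : ℕ) (R : L.Relations k) (v : Fin k → ℕ),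
    Phi ∅ e (Nat.pair i (atomCode R v)) = Part.some (atomValue (C i) R v)

/-- `e` is an index of an `X`-computable copy of `S`. The universe of the copy is `ℕ` if `S` is
infinite, and `{0, ..., s - 1}` if `S` has `s` elements; `ν` is the isomorphism onto the copy. -/
def IsCopyIndex (X : Set ℕ) (e : ℕ) {M : Type} (S : L.Structure M) : Prop :=
  ∃ ν : M → ℕ, Function.Injective ν ∧ IsLowerSet (Set.range ν) ∧ DecidesDiagram X e S ν

end Structures

/-! ## Infinitary formulas -/

/-- Finitary quantifier-free formulas, in a relational language, with `m` free variables. -/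
inductive QF (L : FirstOrder.Language.{0, 0}) (m : ℕ) : Type
  | falsum : QF L m
  | eq (i j : Fin m) : QF L m
  | rel {k : ℕ} (R : L.Relations k) (v : Fin k → Fin m) : QF L m
  | neg (θ : QF L m) : QF L m
  | and (θ η : QF L m) : QF L m
  | or (θ η : QF L m) : QF L m

namespace QF

variable {L : FirstOrder.Language.{0, 0}} {m : ℕ}

/-- Satisfaction of quantifier-free formulas. -/
def Realize {M : Type} (S : L.Structure M) : QF L m → (Fin m → M) → Prop
  | falsum, _ => False
  | eq i j, x => x i = x j
  | rel R v, x => S.RelMap R (x ∘ v)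
  | neg θ, x => ¬ Realize S θ x
  | and θ η, x => Realize S θ x ∧ Realize S η x
  | or θ η, x => Realize S θ x ∨ Realize S η x

/-- The Gödel number of a quantifier-free formula. -/
def code [Encodable (Σ k, L.Relations k)] : QF L m → ℕ
  | falsum => Nat.pair 0 0
  | eq i j => Nat.pair 1 (Nat.pair i j)
  | rel R v => Nat.pair 2 (atomCode R fun i => (v i : ℕ))
  | neg θ => Nat.pair 3 (code θ)
  | and θ η => Nat.pair 4 (Nat.pair (code θ) (code η))
  | or θ η => Nat.pair 5 (Nat.pair (code θ) (code η))

end QF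

/-- The two kinds of formulas, `Σ` and `Π`. -/
inductive Kind : Type
  | sigma : Kind
  | pi : Kind

/-- The opposite kind. -/
def Kind.dual : Kind → Kind
  | sigma => pi
  | pi => sigma

/-- `Fml L .sigma n m` and `Fml L .pi n m` are the `Σ_n` and the `Π_n` formulas of
`L_{ω₁ω}` with `m` free variables. At level `0` these are the finitary quantifier-free formulas.
At level `n + 1`, a `Σ` formula is a countable disjunction, over `i ∈ I`, of formulas
`∃ y₁ ... y_{k i}, ψ i`, where each `ψ i` is `Π_n`, and a `Π` formula is a countable
conjunction, over `i ∈ I`, of formulas `∀ y₁ ... y_{k i}, ψ i`, where each `ψ i` is `Σ_n`. -/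
inductive Fml (L : FirstOrder.Language.{0, 0}) : Kind → ℕ → ℕ → Type
  | qf {b : Kind} {m : ℕ} (θ : QF L m) : Fml L b 0 m
  | block {b : Kind} {n m : ℕ} (I : Set ℕ) (k : ℕ → ℕ)
      (ψ : ∀ i, Fml L b.dual n (m + k i)) : Fml L b (n + 1) m

namespace Fml

variable {L : FirstOrder.Language.{0, 0}}

/-- Satisfaction of infinitary formulas. -/
def Realize {M : Type} (S : L.Structure M) :
    {b : Kind} → {n m : ℕ} → Fml L b n m → (Fin m → M) → Prop
  | _, _, _, .qf θ, x => θ.Realize S x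
  | b, _, _, .block I k ψ, x =>
    match b with
    | .sigma => ∃ i ∈ I, ∃ y : Fin (k i) → M, Realize S (ψ i) (Fin.append x y)
    | .pi => ∀ i ∈ I, ∀ y : Fin (k i) → M, Realize S (ψ i) (Fin.append x y)

/-- A sentence holds in a structure. -/
def Holds {M : Type} (S : L.Structure M) {b : Kind} {n : ℕ} (φ : Fml L b n 0) : Prop :=
  φ.Realize S Fin.elim0

/-- `e` is an index of the formula as an `X`-computable infinitary formula: the countable
disjunctions and conjunctions are over sets that are c.e. in `X`, and indices of the members are
computed from `X`. -/
def IsIndex [Encodable (Σ k, L.Relations k)] (X : Set ℕ) :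
    {b : Kind} → {n m : ℕ} → Fml L b n m → ℕ → Prop
  | _, _, _, .qf θ, e => e = θ.code
  | _, _, _, .block I k ψ, e =>
    (∀ i, i ∈ I ↔ (Phi X e i).Dom) ∧
      ∀ i ∈ I, ∃ c, Phi X e i = Part.some (Nat.pair (k i) c) ∧ IsIndex X (ψ i) c

/-- The formula is an `X`-computable infinitary formula. -/
def IsComputableIn [Encodable (Σ k, L.Relations k)] (X : Set ℕ) {b : Kind} {n m : ℕ}
    (φ : Fml L b n m) : Prop :=
  ∃ e, φ.IsIndex X e

end Fml

/-- `φ` is a Scott sentence of `S`: its countable models are exactly the structures isomorphic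
to `S`. -/
def IsScottSentence {L : FirstOrder.Language.{0, 0}} {b : Kind} {n : ℕ} (φ : Fml L b n 0) {M : Type}
    (S : L.Structure M) : Prop :=
  ∀ (N : Type) [Countable N] (T : L.Structure N), φ.Holds T ↔ Isomorphic T S

/-- `S` has a `Σ_n` (for `b = .sigma`) or a `Π_n` (for `b = .pi`) Scott sentence. -/
def HasScottSentence {L : FirstOrder.Language.{0, 0}} (b : Kind) (n : ℕ) {M : Type}
    (S : L.Structure M) : Prop :=
  ∃ φ : Fml L b n 0, IsScottSentence φ S

/-! ## The jump inversion of a graph -/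

/-- The new relation symbols: `U` is unary, `E` and `F` are ternary. -/
inductive MarkRel : ℕ → Type
  | U : MarkRel 1
  | E : MarkRel 3
  | F : MarkRel 3

/-- The language consisting of `U`, `E` and `F`. -/
def markLang : FirstOrder.Language.{0, 0} := ⟨fun _ => Empty, MarkRel⟩

/-- The numbering `U ↦ 0`, `E ↦ 1`, `F ↦ 2`. -/
instance : Encodable (Σ k, markLang.Relations k) where
  encode
    | ⟨_, .U⟩ => 0
    | ⟨_, .E⟩ => 1
    | ⟨_, .F⟩ => 2
  decode
    | 0 => some ⟨1, MarkRel.U⟩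
    | 1 => some ⟨3, MarkRel.E⟩
    | 2 => some ⟨3, MarkRel.F⟩
    | _ => none
  encodek := by rintro ⟨_, _ | _ | _⟩ <;> rfl

/-- The numbering of the single relation symbol of the language of graphs. -/
instance : Encodable (Σ k, FirstOrder.Language.graph.Relations k) where
  encode _ := 0
  decode
    | 0 => some ⟨2, FirstOrder.Language.adj⟩
    | _ => none
  encodek := by rintro ⟨_, _ | _⟩; rfl

/-- The language `L ∪ {U, E, F}`. -/
abbrev invLang (L : FirstOrder.Language.{0, 0}) : FirstOrder.Language.{0, 0} := L.sum markLang

/-- A symbol of `L` with number `c` has number `2c` in `L ∪ {U, E, F}`, and a symbol of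
`{U, E, F}` with number `c` has number `2c + 1`. -/
instance (L : FirstOrder.Language.{0, 0}) [Encodable (Σ k, L.Relations k)] :
    Encodable (Σ k, (invLang L).Relations k) :=
  Encodable.ofEquiv ((Σ k, L.Relations k) ⊕ (Σ k, markLang.Relations k))
    (Equiv.sigmaSumDistrib L.Relations markLang.Relations)

/-- The universe of the jump inversion: the vertices, and, for every unordered pair `p = {u, v}`
of distinct vertices, two disjoint copies of `ℕ`, namely `C_p` (with `Bool` component `true`)
and `D_p` (with `Bool` component `false`). -/
abbrev InvUniverse (V : Type) : Type := V ⊕ ({p : Sym2 V // ¬ p.IsDiag} × Bool × ℕ)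

section Inversion

variable {L : FirstOrder.Language.{0, 0}} (A B : L.Structure ℕ) {V : Type} (G : SimpleGraph V)

open Classical in
/-- The structure placed on `C_p` (for `true`) and on `D_p` (for `false`): if `p` is an edge of
`G`, these are `A` and `B`, and if not, they are `B` and `A`. -/
@[reducible]
noncomputable def piece (p : Sym2 V) (c : Bool) : L.Structure ℕ :=
  if (p ∈ G.edgeSet ↔ c = true) then A else B

/-- The interpretation of `U`, `E` and `F` in the jump inversion. -/
def markHolds : {k : ℕ} → MarkRel k → (Fin k → InvUniverse V) → Prop
  | _, .U, x => ∃ u : V, x 0 = Sum.inl u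
  | _, .E, x => ∃ (u v : V) (h : ¬ (s(u, v)).IsDiag) (a : ℕ),
      x 0 = Sum.inl u ∧ x 1 = Sum.inl v ∧ x 2 = Sum.inr (⟨s(u, v), h⟩, true, a)
  | _, .F, x => ∃ (u v : V) (h : ¬ (s(u, v)).IsDiag) (a : ℕ),
      x 0 = Sum.inl u ∧ x 1 = Sum.inl v ∧ x 2 = Sum.inr (⟨s(u, v), h⟩, false, a)

/-- The jump inversion of the graph `G`, built from `A` and `B`. The relations of `L` hold only
of tuples inside one `C_p` or inside one `D_p`. -/
@[reducible]
noncomputable def jumpInversion [L.IsRelational] : (invLang L).Structure (InvUniverse V) where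
  funMap f _ := f.elim (fun g => isEmptyElim g) (fun g => Empty.elim g)
  RelMap {k} R x :=
    match R with
    | Sum.inl R => ∃ (p : {p : Sym2 V // ¬ p.IsDiag}) (c : Bool) (a : Fin k → ℕ),
        (x = fun i => Sum.inr (p, c, a i)) ∧ (piece A B G p.1 c).RelMap R a
    | Sum.inr R => markHolds R x

end Inversion

end UJI

open UJI FirstOrder

namespace UJI

open FirstOrder Encodable Filter

/-! ## Finite approximations of an oracle, and unbounded search -/

/-! The two pieces on a pair of vertices form a two-sided code of adjacency: `φ` holds in exactly
one of them, in the `C`-piece for an edge and in the `D`-piece for a non-edge. So adjacency and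
non-adjacency are both positive statements about `φ`.

From a graph to its inversion: "program `e` with oracle `0^(2n)` answers `c` when asked whether `i`
and `j` are adjacent" is a `Σ⁰_{2n+1}` statement, for `c = 0` as much as for `c = 1`. Completeness
of `S` reduces it to membership in `S` by a computable `f` (`exists_reduction`). The structures `C
(f (e, i, j, 1))` and `C (f (e, i, j, 0))` therefore have the isomorphism types required of the two
pieces, and they are computed without any oracle (`exists_copy_of_graph`).

From the inversion to the graph: with the `n`-th jump of `0^(n)`, which is `0^(2n)`, search for the
one piece that satisfies `φ` (`exists_graph_of_copy`). This rests on the fact that truth of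
`X`-computable `Σ_{n+1}` sentences in `X`-computable structures is c.e. in the `n`-th jump of `X`;
the induction on the level spends one jump per level (`exists_truthIndex`,
`exists_recognizes_sigma`). Most programs arise as unbounded searches for a witness of a primitive
recursive relation that sees a finite part of the oracle (`exists_search_pred`); uniformity comes
from the parameter theorem `exists_smn`.

Sentences: the graph is interpreted in its inversion. The domain is `U`, and adjacency is `Σ_{n+1}`
through `φ` in the `E`-piece and `Π_{n+1}` through the failure of `φ` in the `F`-piece. Hence the
innermost quantifier block of a graph formula is absorbed by the definition of adjacency, and level
`ℓ ≥ 1` becomes level `n + ℓ` (`DefinableOn.fml`, `definable_holds_graphOf`).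

Scott sentences: being an inversion of some graph is axiomatized by `IsInversion`, at level
`Π_{n+2}` because of the Scott sentences of `A` and `B` (`definable_isInversion`). A model of the
axioms is determined by its graph (`IsInversion.isomorphic`). So the axioms together with the
translated Scott sentence of the graph are a Scott sentence of the inversion, and the bounds on `ℓ`
say that `Π_{n+2}` is contained in the target level. Formulas are handled through `Definable`
queries, that is, up to equivalence on a class of structures. -/

/-- The first `k` values of the characteristic function of `X`. -/
noncomputable def chiList (X : Set ℕ) (k : ℕ) : List ℕ := (List.range k).map (chi X)

/-- A total function computable in `X`. -/
def TotalIn (X : Set ℕ) (f : ℕ → ℕ) : Prop :=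
  Nat.RecursiveIn {(chi X : ℕ →. ℕ)} fun n => Part.some (f n)

namespace TotalIn

variable {X : Set ℕ} {f g : ℕ → ℕ}

theorem of_computable (hf : Computable f) : TotalIn X f :=
  Nat.Partrec.recursiveIn (Partrec.nat_iff.1 hf)

theorem chi : TotalIn X (chi X) := Nat.RecursiveIn.oracle _ rfl

theorem comp (hf : TotalIn X f) (hg : TotalIn X g) : TotalIn X fun n => f (g n) :=
  (Nat.RecursiveIn.comp hf hg).of_eq fun n => by simp

theorem pair (hf : TotalIn X f) (hg : TotalIn X g) : TotalIn X fun n => Nat.pair (f n) (g n) :=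
  (Nat.RecursiveIn.pair hf hg).of_eq fun n => by simp [Seq.seq]

theorem natRec (c : ℕ) (hf : TotalIn X f) :
    TotalIn X fun n => Nat.rec c (fun y i => f (Nat.pair y i)) n := by
  have h0 : TotalIn X fun _ => c := of_computable (Computable.const c)
  have h1 : TotalIn X fun z => f z.unpair.2 :=
    hf.comp (of_computable (Computable.snd.comp Computable.unpair))
  have h2 := Nat.RecursiveIn.prec h0 h1
  have h3 : TotalIn X fun n => Nat.pair 0 n :=
    pair (of_computable (Computable.const 0)) (of_computable Computable.id)
  refine (Nat.RecursiveIn.comp h2 h3).of_eq fun n => ?_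
  simp only [Part.bind_eq_bind, Part.bind_some, Nat.unpair_pair]
  induction n with
  | zero => rfl
  | succ n ih => simp [ih]

end TotalIn

theorem totalIn_chiList (X : Set ℕ) : TotalIn X fun k => encode (chiList X k) := by
  have h : Computable fun z : ℕ =>
      encode ((decode (α := List ℕ) z.unpair.2).getD [] ++ [z.unpair.1]) := by
    refine Computable.encode.comp (Computable.list_append.comp ?_ ?_)
    · exact Computable.option_getD
        (Computable.decode.comp (Computable.snd.comp Computable.unpair)) (Computable.const _)
    · exact Computable.list_cons.comp (Computable.fst.comp Computable.unpair) (Computable.const _)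
  have h1 := (TotalIn.of_computable (X := X) h).comp
    (((TotalIn.chi (X := X)).comp (.of_computable (Computable.fst.comp Computable.unpair))).pair
      (.of_computable (Computable.snd.comp Computable.unpair)))
  refine (TotalIn.natRec (encode ([] : List ℕ)) h1).of_eq fun n => ?_
  simp only [Part.some_inj, Nat.unpair_pair]
  induction n with
  | zero => rfl
  | succ n ih =>
    simp only [ih]
    simp [chiList, List.range_succ]

/-- Unbounded search relative to an oracle, of which finitely many values are used. -/
theorem recursiveIn_search (X : Set ℕ) {g : List ℕ × ℕ × ℕ → Option ℕ} (hg : Computable g) :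
    Nat.RecursiveIn {(chi X : ℕ →. ℕ)}
      fun x => Nat.rfindOpt fun N => g (chiList X N.unpair.1, N.unpair.2, x) := by
  have h0 : Computable fun z : ℕ => encode (g ((decode (α := List ℕ) z.unpair.1).getD [],
      z.unpair.2.unpair.2.unpair.2, z.unpair.2.unpair.1)) := by
    have hs := Computable.snd.comp Computable.unpair
    refine Computable.encode.comp (hg.comp (Computable.pair ?_ (Computable.pair ?_ ?_)))
    · exact Computable.option_getD (Computable.decode.comp (Computable.fst.comp Computable.unpair))
        (Computable.const _)
    · exact hs.comp (hs.comp hs)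
    · exact (Computable.fst.comp Computable.unpair).comp hs
  have hN : TotalIn X fun z => encode (chiList X z.unpair.2.unpair.1) :=
    (totalIn_chiList X).comp (.of_computable ((Computable.fst.comp Computable.unpair).comp
      (Computable.snd.comp Computable.unpair)))
  have hT : TotalIn X fun z =>
      encode (g (chiList X z.unpair.2.unpair.1, z.unpair.2.unpair.2, z.unpair.1)) := by
    have := (TotalIn.of_computable (X := X) h0).comp (hN.pair (.of_computable Computable.id))
    simpa using this
  -- `encode none = 0` and `encode (some v) = v + 1`: hence `1 - encode _` vanishes exactly at a
  -- success, and the predecessor recovers the value found.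
  have hsub : TotalIn X fun m => 1 - m := .of_computable
    (Primrec.nat_sub.comp (Primrec.const 1) Primrec.id).to_comp
  have hr := Nat.RecursiveIn.rfind (hsub.comp hT)
  have hv := Nat.RecursiveIn.comp ((TotalIn.of_computable Computable.pred).comp hT)
    (Nat.RecursiveIn.pair (TotalIn.of_computable (X := X) Computable.id) hr)
  refine hv.of_eq fun x => ?_
  have key : ∀ N, decide (1 - encode (g (chiList X (Nat.unpair N).1, (Nat.unpair N).2, x)) = 0)
      = (g (chiList X N.unpair.1, N.unpair.2, x)).isSome := fun N => by
    cases g (chiList X N.unpair.1, N.unpair.2, x) <;> simp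
  simp only [Part.map_eq_map, Part.map_some, Nat.unpair_pair, key, Part.bind_eq_bind, Seq.seq,
    Part.bind_some, id, Part.bind_map, Nat.rfindOpt]
  ext y
  simp only [Part.mem_bind_iff, Part.mem_ofOption]
  refine exists_congr fun N => and_congr_right fun h => ?_
  have := Nat.rfind_spec h
  cases hgN : g (chiList X N.unpair.1, N.unpair.2, x) with
  | none => simp [hgN] at this
  | some v => simp [eq_comm]

/-- Which witness the search finds is left open. Soundness and termination are all that is used
below, since any two successful witnesses will lead to equally good outputs. -/
theorem exists_search (X : Set ℕ) {g : List ℕ × ℕ × ℕ → Option ℕ} (hg : Computable g) :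
    ∃ e, ∀ x, (∀ y ∈ Phi X e x, ∃ k w, g (chiList X k, w, x) = some y) ∧
      ((∃ k w y, g (chiList X k, w, x) = some y) → (Phi X e x).Dom) := by
  obtain ⟨e, he⟩ := (exists_Phi_eq_iff X _).2 (recursiveIn_search X hg)
  refine ⟨e, fun x => ⟨fun y hy => ?_, ?_⟩⟩
  · rw [he] at hy
    obtain ⟨N, hN⟩ := Nat.rfindOpt_spec hy
    exact ⟨_, _, hN⟩
  · rintro ⟨k, w, y, h⟩
    rw [he, Nat.rfindOpt_dom]
    exact ⟨Nat.pair k w, y, by simpa using h⟩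

/-! ## The universal program with an oracle -/

open Nat.Partrec in
-- Beyond the end of the list the program diverges instead of returning a default value. This is why
-- replacing an oracle by an initial segment never produces a wrong answer.
theorem exists_lookupCode : ∃ c : Code, ∀ (σ : List ℕ) (n : ℕ),
    c.eval (Nat.pair (encode σ) n) = Part.ofOption σ[n]? := by
  have h : Computable fun z : ℕ => ((decode (α := List ℕ) z.unpair.1).getD [])[z.unpair.2]? :=
    Computable.list_getElem?.comp (Computable.option_getD
      (Computable.decode.comp (Computable.fst.comp Computable.unpair)) (Computable.const _))
      (Computable.snd.comp Computable.unpair)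
  obtain ⟨c, hc⟩ := Code.exists_code.1 (Partrec.nat_iff.1 h.ofOption)
  exact ⟨c, fun σ n => by simp [hc]⟩

/-- A program that looks up an entry of a list. -/
noncomputable def lookupCode : Nat.Partrec.Code := exists_lookupCode.choose

/-- Replaces the oracle by its initial segment `σ`. -/
noncomputable def OracleCode.subst (σ : List ℕ) : OracleCode → Nat.Partrec.Code
  | zero => .zero
  | succ => .succ
  | left => .left
  | right => .right
  | oracle => lookupCode.curry (Encodable.encode σ)
  | pair f g => .pair (subst σ f) (subst σ g)
  | comp f g => .comp (subst σ f) (subst σ g)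
  | prec f g => .prec (subst σ f) (subst σ g)
  | rfind f => .comp (.rfind' (subst σ f)) (.pair .id .zero)

section Eval

open Nat.Partrec

/-- `rfind'` takes the starting point of its search as the second component of its argument;
starting at `0` gives the usual minimization. -/
theorem eval_rfind_subst (f : Code) (a : ℕ) :
    (Code.comp (.rfind' f) (.pair .id .zero)).eval a =
      Nat.rfind fun n => (fun m => decide (m = 0)) <$> f.eval (Nat.pair a n) := by
  simp [Code.eval, Seq.seq, pure, PFun.pure, Part.map_id']

theorem mem_chiList {X : Set ℕ} {k n y : ℕ} :
    y ∈ Part.ofOption (chiList X k)[n]? ↔ n < k ∧ y = chi X n := by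
  simp only [chiList, Part.mem_ofOption, Option.mem_def, List.getElem?_map]
  by_cases h : n < k
  · simp [h, eq_comm]
  · simp [h]

theorem eval_lookupCode (X : Set ℕ) (k n y : ℕ) :
    y ∈ (lookupCode.curry (encode (chiList X k))).eval n ↔ n < k ∧ y = chi X n := by
  rw [Code.eval_curry, lookupCode, exists_lookupCode.choose_spec, mem_chiList]

theorem mem_pair_seq {F G : Part ℕ} {y : ℕ} :
    y ∈ (Nat.pair <$> F <*> G : Part ℕ) ↔ ∃ a ∈ F, ∃ b ∈ G, Nat.pair a b = y := by
  simp [Seq.seq]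

theorem mem_bind_pfun {F : Part ℕ} {G : ℕ →. ℕ} {y : ℕ} :
    y ∈ (F >>= G : Part ℕ) ↔ ∃ a ∈ F, y ∈ G a := Part.mem_bind_iff

theorem mem_rfind_zero {F : ℕ → Part ℕ} {y : ℕ} :
    y ∈ (Nat.rfind fun n => (fun m => decide (m = 0)) <$> F n) ↔
      0 ∈ F y ∧ ∀ m < y, ∃ b ∈ F m, b ≠ 0 := by
  refine Nat.mem_rfind.trans ?_
  simp

/-- A halting computation has asked only questions inside the initial segment, and these were
answered correctly. -/
theorem eval_subst_sound (X : Set ℕ) (k : ℕ) (c : OracleCode) :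
    ∀ x y, y ∈ (c.subst (chiList X k)).eval x → y ∈ c.eval X x := by
  induction c with
  | zero => exact fun x y h => h
  | succ => exact fun x y h => h
  | left => exact fun x y h => h
  | right => exact fun x y h => h
  | oracle =>
    intro x y h
    rw [OracleCode.subst, eval_lookupCode] at h
    simp [OracleCode.eval, h.2]
  | pair f g hf hg =>
    intro x y h
    obtain ⟨a, ha, b, hb, rfl⟩ := mem_pair_seq.1 h
    exact mem_pair_seq.2 ⟨a, hf _ _ ha, b, hg _ _ hb, rfl⟩
  | comp f g hf hg =>
    intro x y h
    obtain ⟨a, ha, hy⟩ := mem_bind_pfun.1 h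
    exact mem_bind_pfun.2 ⟨a, hg _ _ ha, hf _ _ hy⟩
  | prec f g hf hg =>
    intro x y h
    simp only [OracleCode.subst, Code.eval, Nat.unpaired, OracleCode.eval] at h ⊢
    generalize x.unpair.2 = n at h ⊢
    induction n generalizing y with
    | zero => exact hf _ _ h
    | succ n ih =>
      obtain ⟨i, hi, hy⟩ := Part.mem_bind_iff.1 h
      exact Part.mem_bind_iff.2 ⟨i, ih _ hi, hg _ _ hy⟩
  | rfind f hf =>
    intro x y h
    rw [OracleCode.subst, eval_rfind_subst, mem_rfind_zero] at h
    refine mem_rfind_zero.2 ⟨hf _ _ h.1, fun m hm => ?_⟩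
    obtain ⟨b, hb, hb'⟩ := h.2 m hm
    exact ⟨b, hf _ _ hb, hb'⟩

/-- The use principle: a halting computation asks finitely many questions. Stating it for all large
`k` lets the bounds of several subcomputations be combined without maxima. -/
theorem eval_subst_complete (X : Set ℕ) (c : OracleCode) :
    ∀ x y, y ∈ c.eval X x → ∀ᶠ k in atTop, y ∈ (c.subst (chiList X k)).eval x := by
  induction c with
  | zero => exact fun x y h => .of_forall fun _ => h
  | succ => exact fun x y h => .of_forall fun _ => h
  | left => exact fun x y h => .of_forall fun _ => h
  | right => exact fun x y h => .of_forall fun _ => h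
  | oracle =>
    intro x y h
    filter_upwards [eventually_gt_atTop x] with k hk
    rw [OracleCode.subst, eval_lookupCode]
    exact ⟨hk, by simpa [OracleCode.eval] using h⟩
  | pair f g hf hg =>
    intro x y h
    obtain ⟨a, ha, b, hb, rfl⟩ := mem_pair_seq.1 h
    filter_upwards [hf _ _ ha, hg _ _ hb] with k h1 h2
    exact mem_pair_seq.2 ⟨a, h1, b, h2, rfl⟩
  | comp f g hf hg =>
    intro x y h
    obtain ⟨a, ha, hy⟩ := mem_bind_pfun.1 h
    filter_upwards [hg _ _ ha, hf _ _ hy] with k h1 h2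
    exact mem_bind_pfun.2 ⟨a, h1, h2⟩
  | prec f g hf hg =>
    intro x y h
    simp only [OracleCode.subst, Code.eval, Nat.unpaired, OracleCode.eval] at h ⊢
    generalize x.unpair.2 = n at h ⊢
    induction n generalizing y with
    | zero => exact hf _ _ h
    | succ n ih =>
      obtain ⟨i, hi, hy⟩ := Part.mem_bind_iff.1 h
      filter_upwards [ih _ hi, hg _ _ hy] with k h1 h2
      exact Part.mem_bind_iff.2 ⟨i, h1, h2⟩
  | rfind f hf =>
    intro x y h
    simp only [OracleCode.subst, eval_rfind_subst]
    obtain ⟨h0, h⟩ := mem_rfind_zero.1 h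
    have h2 : ∀ᶠ k in atTop, ∀ m ∈ Finset.range y,
        ∃ b ∈ (f.subst (chiList X k)).eval (Nat.pair x m), b ≠ 0 := by
      rw [Filter.eventually_all_finset]
      intro m hm
      obtain ⟨b, hb, hb'⟩ := h m (Finset.mem_range.1 hm)
      filter_upwards [hf _ _ hb] with k hk using ⟨b, hk, hb'⟩
    filter_upwards [hf _ _ h0, h2] with k h1 h2
    exact mem_rfind_zero.2 ⟨h1, fun m hm => h2 _ (Finset.mem_range.2 hm)⟩

/-- One step of the course-of-values recursion that computes `(ofNat n).subst σ`. -/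
noncomputable def substStep (σ : List ℕ) (l : List Code) : Code :=
  if l.length < 5 then
    if l.length = 0 then .zero else if l.length = 1 then .succ else
    if l.length = 2 then .left else if l.length = 3 then .right else lookupCode.curry (encode σ)
  else
    if (l.length - 5) % 4 = 0 then
      .pair (l.getD ((l.length - 5) / 4).unpair.1 .zero)
        (l.getD ((l.length - 5) / 4).unpair.2 .zero)
    else if (l.length - 5) % 4 = 1 then
      .comp (l.getD ((l.length - 5) / 4).unpair.1 .zero)
        (l.getD ((l.length - 5) / 4).unpair.2 .zero)
    else if (l.length - 5) % 4 = 2 then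
      .prec (l.getD ((l.length - 5) / 4).unpair.1 .zero)
        (l.getD ((l.length - 5) / 4).unpair.2 .zero)
    else .comp (.rfind' (l.getD ((l.length - 5) / 4) .zero)) (.pair .id .zero)

theorem primrec_substStep : Primrec₂ substStep := by
  have hl : Primrec fun p : List ℕ × List Code => p.2.length := Primrec.list_length.comp Primrec.snd
  have hm := Primrec.nat_sub.comp hl (Primrec.const 5)
  have hq := Primrec.nat_div.comp hm (Primrec.const 4)
  have hr := Primrec.nat_mod.comp hm (Primrec.const 4)
  have h1 := (Primrec.list_getD Code.zero).comp (Primrec.snd (α := List ℕ))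
    (Primrec.fst.comp (Primrec.unpair.comp hq))
  have h2 := (Primrec.list_getD Code.zero).comp (Primrec.snd (α := List ℕ))
    (Primrec.snd.comp (Primrec.unpair.comp hq))
  have h3 := (Primrec.list_getD Code.zero).comp (Primrec.snd (α := List ℕ)) hq
  refine Primrec.ite (Primrec.nat_lt.comp hl (Primrec.const 5)) ?_ ?_
  · refine Primrec.ite (Primrec.eq.comp hl (Primrec.const 0)) (Primrec.const _) ?_
    refine Primrec.ite (Primrec.eq.comp hl (Primrec.const 1)) (Primrec.const _) ?_
    refine Primrec.ite (Primrec.eq.comp hl (Primrec.const 2)) (Primrec.const _) ?_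
    refine Primrec.ite (Primrec.eq.comp hl (Primrec.const 3)) (Primrec.const _) ?_
    exact Code.primrec₂_curry.comp (Primrec.const _) (Primrec.encode.comp Primrec.fst)
  · refine Primrec.ite (Primrec.eq.comp hr (Primrec.const 0)) (Code.primrec₂_pair.comp h1 h2) ?_
    refine Primrec.ite (Primrec.eq.comp hr (Primrec.const 1)) (Code.primrec₂_comp.comp h1 h2) ?_
    refine Primrec.ite (Primrec.eq.comp hr (Primrec.const 2)) (Code.primrec₂_prec.comp h1 h2) ?_
    exact Code.primrec₂_comp.comp (Code.primrec_rfind'.comp h3) (Primrec.const _)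

theorem substStep_eq (σ : List ℕ) (n : ℕ) :
    substStep σ ((List.range n).map fun i => (OracleCode.ofNat i).subst σ) =
      (OracleCode.ofNat n).subst σ := by
  have hget : ∀ i < n, ((List.range n).map fun i => (OracleCode.ofNat i).subst σ).getD i .zero =
      (OracleCode.ofNat i).subst σ := fun i hi => by simp [List.getD, hi]
  unfold substStep
  simp only [List.length_map, List.length_range]
  match n with
  | 0 => simp [OracleCode.ofNat, OracleCode.subst]
  | 1 => simp [OracleCode.ofNat, OracleCode.subst]
  | 2 => simp [OracleCode.ofNat, OracleCode.subst]
  | 3 => simp [OracleCode.ofNat, OracleCode.subst]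
  | 4 => simp [OracleCode.ofNat, OracleCode.subst]
  | m + 5 =>
    have h : m / 4 < m + 5 := by omega
    rw [Nat.add_sub_cancel, if_neg (by omega),
      hget _ (lt_of_le_of_lt (Nat.unpair_left_le _) h),
      hget _ (lt_of_le_of_lt (Nat.unpair_right_le _) h), hget _ h, OracleCode.ofNat]
    have h4 : m % 4 < 4 := Nat.mod_lt _ (by omega)
    generalize m % 4 = r at h4
    match r with
    | 0 => simp [OracleCode.subst]
    | 1 => simp [OracleCode.subst]
    | 2 => simp [OracleCode.subst]
    | 3 => simp [OracleCode.subst]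

/-- Substitution is primitive recursive in the segment and the Gödel number jointly, so relative
computations reduce to the bounded evaluation of ordinary codes. -/
theorem primrec_subst_ofNat :
    Primrec₂ fun (σ : List ℕ) (n : ℕ) => (OracleCode.ofNat n).subst σ :=
  Primrec.nat_strong_rec _ (g := fun σ l => some (substStep σ l))
    (Primrec.option_some.comp primrec_substStep) fun σ n => by rw [substStep_eq]

/-- The `e`-th program run for `w` steps on `x`, with the initial segment `σ` of an oracle. -/
noncomputable def evalApprox (σ : List ℕ) (w e x : ℕ) : Option ℕ :=
  Code.evaln w ((OracleCode.ofNat e).subst σ) x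

theorem primrec_evalApprox {α : Type*} [Primcodable α] {s : α → List ℕ} {w e x : α → ℕ}
    (hs : Primrec s) (hw : Primrec w) (he : Primrec e) (hx : Primrec x) :
    Primrec fun a => evalApprox (s a) (w a) (e a) (x a) :=
  Code.primrec_evaln.comp ((hw.pair (primrec_subst_ofNat.comp hs he)).pair hx)

theorem evalApprox_sound {X : Set ℕ} {k w e x y : ℕ}
    (h : evalApprox (chiList X k) w e x = some y) : y ∈ Phi X e x :=
  eval_subst_sound X k _ _ _ (Code.evaln_sound h)

/-- The number of steps may depend on the initial segment, because the segment is built into the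
program that is run; hence the order of the two limits. -/
theorem evalApprox_complete {X : Set ℕ} {e x y : ℕ} (h : y ∈ Phi X e x) :
    ∀ᶠ k in atTop, ∀ᶠ w in atTop, evalApprox (chiList X k) w e x = some y := by
  filter_upwards [eval_subst_complete X _ _ _ h] with k hk
  obtain ⟨w, hw⟩ := Code.evaln_complete.1 hk
  filter_upwards [eventually_ge_atTop w] with w' hw'
  exact Code.evaln_mono hw' hw

attribute [irreducible] evalApprox

end Eval

/-! ## Parameters, and the jump -/

/-- The universal function relative to `X` is recursive in `X`. -/
theorem exists_universal (X : Set ℕ) : ∃ d, ∀ e x, Phi X d (Nat.pair e x) = Phi X e x := by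
  have hg : Primrec fun p : List ℕ × ℕ × ℕ =>
      evalApprox p.1 p.2.1 p.2.2.unpair.1 p.2.2.unpair.2 :=
    primrec_evalApprox Primrec.fst (Primrec.fst.comp Primrec.snd)
      (Primrec.fst.comp (Primrec.unpair.comp (Primrec.snd.comp Primrec.snd)))
      (Primrec.snd.comp (Primrec.unpair.comp (Primrec.snd.comp Primrec.snd)))
  obtain ⟨d, hd⟩ := exists_search X hg.to_comp
  refine ⟨d, fun e x => ?_⟩
  obtain ⟨h1, h2⟩ := hd (Nat.pair e x)
  simp only [Nat.unpair_pair] at h1 h2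
  have sound : ∀ y ∈ Phi X d (Nat.pair e x), y ∈ Phi X e x := fun y hy => by
    obtain ⟨k, w, h⟩ := h1 y hy
    exact evalApprox_sound h
  refine Part.ext fun y => ⟨sound y, fun hy => ?_⟩
  obtain ⟨k, hk⟩ := (evalApprox_complete hy).exists
  obtain ⟨w, hw⟩ := hk.exists
  have hdom := h2 ⟨k, w, y, hw⟩
  have := sound _ (Part.get_mem hdom)
  rw [Part.mem_unique hy this]
  exact Part.get_mem hdom

/-- Gödel numbers of programs for the constant functions. -/
def constIndex : ℕ → ℕ
  | 0 => OracleCode.zero.encode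
  | n + 1 => 4 * Nat.pair 1 (constIndex n) + 6

theorem computable_constIndex : Computable constIndex := by
  have : Primrec₂ fun (_ : ℕ) (i : ℕ) => 4 * Nat.pair 1 i + 6 :=
    Primrec.nat_add.comp (Primrec.nat_mul.comp (Primrec.const 4)
      (Primrec₂.natPair.comp (Primrec.const 1) Primrec.snd)) (Primrec.const 6)
  refine (Primrec.nat_rec₁ (OracleCode.zero.encode) this).to_comp.of_eq fun n => ?_
  induction n with
  | zero => rfl
  | succ n ih => simp only [ih, constIndex]

theorem exists_constIndex (n : ℕ) : ∃ c : OracleCode, c.encode = constIndex n ∧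
    ∀ X x, c.eval X x = Part.some n := by
  induction n with
  | zero => exact ⟨.zero, rfl, fun _ _ => rfl⟩
  | succ n ih =>
    obtain ⟨c, hc, h⟩ := ih
    exact ⟨.comp .succ c, by rw [OracleCode.encode, hc]; rfl, fun X x => by
      simp [OracleCode.eval, h]⟩

/-- The parameter theorem. -/
theorem exists_smn (e : ℕ) :
    ∃ h : ℕ → ℕ, Computable h ∧ ∀ X a x, Phi X (h a) x = Phi X e (Nat.pair a x) := by
  -- The Gödel number of `e` composed with the pairing of the constant `a` and the identity; `pair
  -- left right` serves as a program for the identity. The oracle plays no role.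
  refine ⟨fun a => 4 * Nat.pair (OracleCode.ofNat e).encode
    (4 * Nat.pair (constIndex a) (OracleCode.pair .left .right).encode + 5) + 6, ?_, ?_⟩
  · have hp : ∀ {f g : ℕ → ℕ}, Computable f → Computable g → ∀ j,
        Computable fun a => 4 * Nat.pair (f a) (g a) + j := fun hf hg j =>
      Primrec.nat_add.to_comp.comp (Primrec.nat_mul.to_comp.comp (Computable.const 4)
        (Primrec₂.natPair.to_comp.comp hf hg)) (Computable.const j)
    exact hp (Computable.const _) (hp computable_constIndex (Computable.const _) 5) 6
  · intro X a x
    obtain ⟨c, hc, h⟩ := exists_constIndex a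
    have : 4 * Nat.pair (OracleCode.ofNat e).encode
        (4 * Nat.pair (constIndex a) (OracleCode.pair .left .right).encode + 5) + 6 =
        (OracleCode.comp (.ofNat e) (.pair c (.pair .left .right))).encode := by
      simp [OracleCode.encode, hc]
    simp only [this]
    rw [Phi, OracleCode.ofNat_encode, Phi]
    refine Part.ext fun y => ?_
    simp only [OracleCode.eval, mem_bind_pfun, mem_pair_seq, h, Part.mem_some_iff]
    simp

/-- Index of a composition with a total function computable in the oracle. -/
theorem exists_comp {X : Set ℕ} {f : ℕ → ℕ} (hf : TotalIn X f) (e : ℕ) :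
    ∃ d, ∀ x, Phi X d x = Phi X e (f x) := by
  obtain ⟨d, hd⟩ := (exists_Phi_eq_iff X _).2
    (Nat.RecursiveIn.comp ((exists_Phi_eq_iff X _).1 ⟨e, rfl⟩) hf)
  exact ⟨d, fun x => by rw [hd]; exact Part.bind_some _ _⟩

open Classical in
/-- The jump of `X` decides whether a program with oracle `X` halts. -/
theorem exists_decides_dom (X : Set ℕ) (e : ℕ) :
    ∃ d, ∀ x, Phi (jump X) d x = Part.some (if (Phi X e x).Dom then 1 else 0) := by
  -- `e'` looks only at its first component, so the program `h x` ignores its input. It halts at its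
  -- own number, and so `h x` lies in the jump, exactly when `e` halts at `x`.
  obtain ⟨e', he'⟩ := exists_comp (X := X)
    (.of_computable (Computable.fst.comp Computable.unpair)) e
  obtain ⟨h, hc, hh⟩ := exists_smn e'
  obtain ⟨d, hd⟩ := (exists_Phi_eq_iff (jump X) _).2
    ((TotalIn.chi (X := jump X)).comp (.of_computable hc))
  refine ⟨d, fun x => ?_⟩
  rw [hd]
  have : h x ∈ jump X ↔ (Phi X e x).Dom := by
    rw [jump, Set.mem_ofPred_eq, hh, he', Nat.unpair_pair]
  simp only [chi, this]

/-- `X` is c.e. in itself, by waiting for an initial segment that shows the value `1` at `x`; the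
jump decides whether this wait ends. -/
theorem totalIn_jump (X : Set ℕ) : TotalIn (jump X) (chi X) := by
  classical
  -- The default `0` beyond the end of the segment means "not seen yet".
  have hg : Primrec fun p : List ℕ × ℕ × ℕ => if p.1.getD p.2.2 0 = 1 then some 0 else none :=
    Primrec.ite (Primrec.eq.comp ((Primrec.list_getD 0).comp Primrec.fst
      (Primrec.snd.comp Primrec.snd)) (Primrec.const 1)) (Primrec.const _) (Primrec.const _)
  obtain ⟨e, he⟩ := exists_search X hg.to_comp
  obtain ⟨d, hd⟩ := exists_decides_dom X e
  have key : ∀ x, (Phi X e x).Dom ↔ x ∈ X := fun x => by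
    have hv : ∀ k, (chiList X k).getD x 0 = if x < k then chi X x else 0 := fun k => by
      by_cases h : x < k <;> simp [chiList, List.getD, h]
    replace he := he x
    simp only [hv] at he
    constructor
    · intro h
      obtain ⟨k, w, h⟩ := he.1 _ (Part.get_mem h)
      by_contra hx
      simp [chi, hx] at h
    · intro h
      exact he.2 ⟨x + 1, 0, 0, by simp [chi, h]⟩
  exact Nat.RecursiveIn.of_eq ((exists_Phi_eq_iff _ _).1 ⟨d, rfl⟩) fun x => by
    simp [hd, key, chi]

/-- Iterated jumps compute the universal function of the set they start from. -/
theorem exists_universal_jump (X : Set ℕ) (k : ℕ) :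
    ∃ d, ∀ e x, Phi (jump^[k] X) d (Nat.pair e x) = Phi X e x := by
  have h : TotalIn (jump^[k] X) (chi X) := by
    induction k with
    | zero => exact TotalIn.chi
    | succ k ih =>
      rw [Function.iterate_succ_apply']
      refine Nat.RecursiveIn.subst ih fun g hg => ?_
      rw [Set.mem_singleton_iff.1 hg]
      exact totalIn_jump _
  obtain ⟨d, hd⟩ := exists_universal X
  obtain ⟨d', hd'⟩ := (exists_Phi_eq_iff (jump^[k] X) (Phi X d)).2 <|
    Nat.RecursiveIn.subst ((exists_Phi_eq_iff X _).1 ⟨d, rfl⟩) fun g hg => by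
      rw [Set.mem_singleton_iff.1 hg]
      exact h
  exact ⟨d', fun e x => by rw [hd', hd]⟩

theorem zeroJump_add (n k : ℕ) : zeroJump (n + k) = jump^[k] (zeroJump n) := by
  induction k with
  | zero => rfl
  | succ k ih => rw [Function.iterate_succ_apply', ← ih]; rfl

/-! ## Searching for a witness -/

/-- Search for a witness `w` that satisfies a decidable relation, in which finitely many values
of the oracle may be used; the output is `v w`. -/
theorem exists_search_pred {α β : Type} [Primcodable α] [Primcodable β] (X : Set ℕ)
    {R : List ℕ × β × α → Prop} (hR : PrimrecPred R) {v : β → ℕ} (hv : Primrec v) :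
    ∃ e, ∀ a, (∀ y ∈ Phi X e (encode a), ∃ k w, R (chiList X k, w, a) ∧ v w = y) ∧
      ((∃ k w, R (chiList X k, w, a)) → (Phi X e (encode a)).Dom) := by
  classical
  have hw : Primrec fun p : (List ℕ × ℕ × ℕ) × α => (decode (α := β) p.1.2.1) :=
    Primrec.decode.comp (Primrec.fst.comp (Primrec.snd.comp Primrec.fst))
  have hg : Primrec fun p : List ℕ × ℕ × ℕ => (decode (α := α) p.2.2).bind fun a =>
      (decode (α := β) p.2.1).bind fun w => if R (p.1, w, a) then some (v w) else none := by
    refine Primrec.option_bind (Primrec.decode.comp (Primrec.snd.comp Primrec.snd))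
      (Primrec.option_bind hw ?_)
    refine Primrec.ite (hR.comp ?_) (Primrec.option_some.comp (hv.comp Primrec.snd))
      (Primrec.const _)
    exact (Primrec.fst.comp (Primrec.fst.comp Primrec.fst)).pair
      (Primrec.snd.pair (Primrec.snd.comp Primrec.fst))
  obtain ⟨e, he⟩ := exists_search X hg.to_comp
  refine ⟨e, fun a => ⟨fun y hy => ?_, ?_⟩⟩
  · obtain ⟨k, w, h⟩ := (he _).1 y hy
    simp only [encodek, Option.bind_some, Option.bind_eq_some_iff, Option.ite_none_right_eq_some,
      Option.some_inj] at h
    obtain ⟨w, -, h, h'⟩ := h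
    exact ⟨k, w, h, h'⟩
  · rintro ⟨k, w, h⟩
    exact (he _).2 ⟨k, encode w, v w, by simp [h]⟩

/-- With this, correctness of a program splits into two checks: every witness gives the right value,
and there is a witness. -/
theorem exists_search_total {α β : Type} [Primcodable α] [Primcodable β] (X : Set ℕ)
    {R : List ℕ × β × α → Prop} (hR : PrimrecPred R) {v : β → ℕ} (hv : Primrec v) :
    ∃ e, ∀ a y, (∀ k w, R (chiList X k, w, a) → v w = y) → (∃ k w, R (chiList X k, w, a)) →
      Phi X e (encode a) = Part.some y := by
  obtain ⟨e, he⟩ := exists_search_pred X hR hv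
  refine ⟨e, fun a y h1 h2 => ?_⟩
  have hd := (he a).2 h2
  obtain ⟨k, w, h, h'⟩ := (he a).1 _ (Part.get_mem hd)
  rw [Part.eq_some_iff, ← h1 k w h, h']
  exact Part.get_mem hd

/-! ## Satisfaction of computable infinitary formulas -/

/-- The value of the quantifier-free formula with number `c` at the list `p.2.2`, if the truth
values of its atoms are obtained by running the program `a`, applied to the parameter `p.2.1` and
the atom, for `p.1.2` steps with the initial segment `p.1.1` of the oracle.
The values at smaller numbers are listed in `tab`. -/
noncomputable def qfStep (a : ℕ) (p : (List ℕ × ℕ) × ℕ × List ℕ) (tab : List (Option Bool)) :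
    Option Bool :=
  if tab.length.unpair.1 = 0 then some false
  else if tab.length.unpair.1 = 1 then
    some (decide (p.2.2.getD tab.length.unpair.2.unpair.1 0 =
      p.2.2.getD tab.length.unpair.2.unpair.2 0))
  else if tab.length.unpair.1 = 2 then
    (evalApprox p.1.1 p.1.2 a (Nat.pair p.2.1 (Nat.pair tab.length.unpair.2.unpair.1
      (encode (((decode (α := List ℕ) tab.length.unpair.2.unpair.2).getD []).map
        fun i => p.2.2.getD i 0))))).map fun y => decide (y = 1)
  else if tab.length.unpair.1 = 3 then (tab.getD tab.length.unpair.2 none).map not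
  else if tab.length.unpair.1 = 4 then
    (tab.getD tab.length.unpair.2.unpair.1 none).bind fun b =>
      (tab.getD tab.length.unpair.2.unpair.2 none).map (b && ·)
  else
    (tab.getD tab.length.unpair.2.unpair.1 none).bind fun b =>
      (tab.getD tab.length.unpair.2.unpair.2 none).map (b || ·)

/-- Bounded evaluation of quantifier-free formulas, given by their Gödel numbers. -/
noncomputable def qfApprox (a : ℕ) (p : (List ℕ × ℕ) × ℕ × List ℕ) (c : ℕ) : Option Bool :=
  qfStep a p ((List.range c).attach.map fun i => qfApprox a p i.1)
termination_by c
decreasing_by exact List.mem_range.1 i.2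

theorem qfApprox_eq (a : ℕ) (p : (List ℕ × ℕ) × ℕ × List ℕ) (c : ℕ) :
    qfApprox a p c = qfStep a p ((List.range c).map (qfApprox a p)) := by
  rw [qfApprox]
  congr 1
  rw [List.attach_map_val (f := qfApprox a p)]

theorem primrec_qfStep (a : ℕ) : Primrec₂ (qfStep a) := by
  have hn : Primrec fun z : ((List ℕ × ℕ) × ℕ × List ℕ) × List (Option Bool) => z.2.length :=
    Primrec.list_length.comp Primrec.snd
  have ht := Primrec.fst.comp (Primrec.unpair.comp hn)
  have hr := Primrec.snd.comp (Primrec.unpair.comp hn)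
  have hr1 := Primrec.fst.comp (Primrec.unpair.comp hr)
  have hr2 := Primrec.snd.comp (Primrec.unpair.comp hr)
  have hl : Primrec fun z : ((List ℕ × ℕ) × ℕ × List ℕ) × List (Option Bool) => z.1.2.2 :=
    Primrec.snd.comp (Primrec.snd.comp Primrec.fst)
  have hq : Primrec fun z : ((List ℕ × ℕ) × ℕ × List ℕ) × List (Option Bool) => z.1.2.1 :=
    Primrec.fst.comp (Primrec.snd.comp Primrec.fst)
  have hs : Primrec fun z : ((List ℕ × ℕ) × ℕ × List ℕ) × List (Option Bool) => z.1.1 :=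
    Primrec.fst.comp Primrec.fst
  have htab : Primrec fun z : ((List ℕ × ℕ) × ℕ × List ℕ) × List (Option Bool) => z.2 :=
    Primrec.snd
  have hbin : ∀ op : Bool → Bool → Bool,
      Primrec fun z : ((List ℕ × ℕ) × ℕ × List ℕ) × List (Option Bool) =>
        (z.2.getD z.2.length.unpair.2.unpair.1 none).bind fun b =>
          (z.2.getD z.2.length.unpair.2.unpair.2 none).map (op b) := fun op => by
    refine Primrec.option_bind ((Primrec.list_getD none).comp htab hr1) ?_
    refine Primrec.option_map ((Primrec.list_getD none).comp (htab.comp Primrec.fst)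
      (hr2.comp Primrec.fst)) ?_
    exact (Primrec.dom_bool₂ op).comp (Primrec.snd.comp Primrec.fst) Primrec.snd
  refine Primrec.ite (Primrec.eq.comp ht (Primrec.const 0)) (Primrec.const _) ?_
  refine Primrec.ite (Primrec.eq.comp ht (Primrec.const 1)) ?_ ?_
  · exact Primrec.option_some.comp (Primrec.eq.decide.comp
      ((Primrec.list_getD 0).comp hl hr1) ((Primrec.list_getD 0).comp hl hr2))
  refine Primrec.ite (Primrec.eq.comp ht (Primrec.const 2)) ?_ ?_
  · refine Primrec.option_map (primrec_evalApprox (Primrec.fst.comp hs) (Primrec.snd.comp hs)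
      (Primrec.const a) (Primrec₂.natPair.comp hq (Primrec₂.natPair.comp hr1
        (Primrec.encode.comp (Primrec.list_map ?_ ?_))))) ?_
    · exact Primrec.option_getD.comp (Primrec.decode.comp hr2) (Primrec.const _)
    · exact (Primrec.list_getD 0).comp (hl.comp Primrec.fst) Primrec.snd
    · exact Primrec.eq.decide.comp Primrec.snd (Primrec.const 1)
  refine Primrec.ite (Primrec.eq.comp ht (Primrec.const 3)) ?_ ?_
  · exact Primrec.option_map ((Primrec.list_getD none).comp htab hr)
      (Primrec.not.comp Primrec.snd)
  exact Primrec.ite (Primrec.eq.comp ht (Primrec.const 4)) (hbin and) (hbin or)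

theorem primrec_qfApprox (a : ℕ) : Primrec₂ (qfApprox a) :=
  Primrec.nat_strong_rec _ (g := fun p l => some (qfStep a p l))
    (Primrec.option_some.comp (primrec_qfStep a)) fun p n => by rw [qfApprox_eq]

theorem qfApprox_pair (a : ℕ) (p : (List ℕ × ℕ) × ℕ × List ℕ) (t r : ℕ) :
    qfApprox a p (Nat.pair t r) =
      if t = 0 then some false
      else if t = 1 then some (decide (p.2.2.getD r.unpair.1 0 = p.2.2.getD r.unpair.2 0))
      else if t = 2 then
        (evalApprox p.1.1 p.1.2 a (Nat.pair p.2.1 (Nat.pair r.unpair.1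
          (encode (((decode (α := List ℕ) r.unpair.2).getD []).map
            fun i => p.2.2.getD i 0))))).map fun y => decide (y = 1)
      else if t = 3 then (qfApprox a p r).map not
      else if t = 4 then
        (qfApprox a p r.unpair.1).bind fun b => (qfApprox a p r.unpair.2).map (b && ·)
      else (qfApprox a p r.unpair.1).bind fun b => (qfApprox a p r.unpair.2).map (b || ·) := by
  have hget : ∀ i < Nat.pair t r,
      ((List.range (Nat.pair t r)).map (qfApprox a p)).getD i none = qfApprox a p i :=
    fun i hi => by simp [List.getD, hi]
  rw [qfApprox_eq]
  unfold qfStep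
  simp only [List.length_map, List.length_range, Nat.unpair_pair]
  -- Only the connectives, `t ≥ 3`, consult the table, and for them the codes of the subformulas are
  -- smaller than `Nat.pair t r`.
  rcases Nat.lt_or_ge t 3 with h | h
  · interval_cases t <;> simp
  · have hr : r < Nat.pair t r := by
      have := Nat.add_le_pair t r
      omega
    rw [hget r hr, hget _ ((Nat.unpair_left_le _).trans_lt hr),
      hget _ ((Nat.unpair_right_le _).trans_lt hr)]

section Satisfaction

variable {L : FirstOrder.Language.{0, 0}} [Encodable (Σ k, L.Relations k)]

/-- The structure `T`, whose elements are named by `μ`, is given by the programs `a` and `d` with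
oracle `X` and the parameter `q`: the program `a` decides the atomic diagram, and `d` recognizes
the names. -/
structure Presents (X : Set ℕ) (a d q : ℕ) {M : Type} (T : L.Structure M) (μ : M → ℕ) : Prop where
  injective : Function.Injective μ
  mem_range : ∀ y, 1 ∈ Phi X d (Nat.pair q y) ↔ y ∈ Set.range μ
  atom : ∀ (k : ℕ) (R : L.Relations k) (v : Fin k → M),
    Phi X a (Nat.pair q (atomCode R (μ ∘ v))) = Part.some (atomValue T R v)

variable {X : Set ℕ} {a d q : ℕ} {M : Type} {T : L.Structure M} {μ : M → ℕ}

theorem map_getD_ofFn {k m : ℕ} (v : Fin k → Fin m) (x : Fin m → ℕ) :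
    (List.ofFn fun i => (v i : ℕ)).map (fun i => (List.ofFn x).getD i 0) =
      List.ofFn (x ∘ v) := by
  rw [List.map_ofFn]
  congr 1
  funext i
  simp [List.getD]

theorem qfApprox_rel_arg {m k : ℕ} (R : L.Relations k) (v : Fin k → Fin m) (x : Fin m → M) :
    Nat.pair (atomCode R fun i => (v i : ℕ)).unpair.1
      (encode (((decode (α := List ℕ) (atomCode R fun i => (v i : ℕ)).unpair.2).getD []).map
        fun i => (List.ofFn (μ ∘ x)).getD i 0)) = atomCode R (μ ∘ (x ∘ v)) := by
  simp only [atomCode, Nat.unpair_pair, encodek, Option.getD_some, map_getD_ofFn]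
  rfl

theorem qfApprox_sound (h : Presents X a d q T μ) (k w : ℕ) {m : ℕ} (θ : QF L m) (x : Fin m → M) :
    ∀ b, qfApprox a ((chiList X k, w), q, List.ofFn (μ ∘ x)) θ.code = some b →
      (b = true ↔ θ.Realize T x) := by
  induction θ with
  | falsum => intro b hb; simp_all [QF.code, qfApprox_pair, QF.Realize]
  | eq i j =>
    intro b hb
    simp only [QF.code, qfApprox_pair] at hb
    simp [List.getD] at hb
    rw [← hb, QF.Realize, decide_eq_true_iff, h.injective.eq_iff]
  | rel R v =>
    intro b hb
    simp only [QF.code, qfApprox_pair, if_neg (show ¬ (2 : ℕ) = 0 by decide),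
      if_neg (show ¬ (2 : ℕ) = 1 by decide), if_true, Option.map_eq_some_iff,
      qfApprox_rel_arg] at hb
    obtain ⟨y, hy, rfl⟩ := hb
    have := evalApprox_sound hy
    rw [h.atom, Part.mem_some_iff] at this
    rw [this, QF.Realize, atomValue]
    split <;> simp_all
  | neg θ ih =>
    intro b hb
    simp only [QF.code, qfApprox_pair] at hb
    simp at hb
    obtain hb := ih _ hb
    cases b <;> simp_all [QF.Realize]
  | and θ η ih1 ih2 =>
    intro b hb
    simp only [QF.code, qfApprox_pair] at hb
    simp [Option.bind_eq_some_iff, -Bool.exists_bool] at hb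
    obtain ⟨b1, h1, b2, h2, rfl⟩ := hb
    simp [QF.Realize, ← ih1 _ h1, ← ih2 _ h2]
  | or θ η ih1 ih2 =>
    intro b hb
    simp only [QF.code, qfApprox_pair] at hb
    simp [Option.bind_eq_some_iff, -Bool.exists_bool] at hb
    obtain ⟨b1, h1, b2, h2, rfl⟩ := hb
    simp [QF.Realize, ← ih1 _ h1, ← ih2 _ h2]

theorem qfApprox_complete (h : Presents X a d q T μ) {m : ℕ} (θ : QF L m) (x : Fin m → M) :
    ∀ᶠ k in atTop, ∀ᶠ w in atTop,
      (qfApprox a ((chiList X k, w), q, List.ofFn (μ ∘ x)) θ.code).isSome := by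
  induction θ with
  | falsum => simp [QF.code, qfApprox_pair]
  | eq i j => simp [QF.code, qfApprox_pair]
  | rel R v =>
    have := h.atom _ R (x ∘ v)
    filter_upwards [evalApprox_complete (Part.eq_some_iff.1 this)] with k hk
    filter_upwards [hk] with w hw
    simp only [QF.code, qfApprox_pair, if_neg (show ¬ (2 : ℕ) = 0 by decide),
      if_neg (show ¬ (2 : ℕ) = 1 by decide), if_true, qfApprox_rel_arg, hw]
    rfl
  | neg θ ih =>
    filter_upwards [ih] with k hk
    filter_upwards [hk] with w hw
    simpa [QF.code, qfApprox_pair] using hw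
  | and θ η ih1 ih2 =>
    filter_upwards [ih1, ih2] with k hk1 hk2
    filter_upwards [hk1, hk2] with w hw1 hw2
    obtain ⟨b1, h1⟩ := Option.isSome_iff_exists.1 hw1
    obtain ⟨b2, h2⟩ := Option.isSome_iff_exists.1 hw2
    simp [QF.code, qfApprox_pair, h1, h2]
  | or θ η ih1 ih2 =>
    filter_upwards [ih1, ih2] with k hk1 hk2
    filter_upwards [hk1, hk2] with w hw1 hw2
    obtain ⟨b1, h1⟩ := Option.isSome_iff_exists.1 hw1
    obtain ⟨b2, h2⟩ := Option.isSome_iff_exists.1 hw2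
    simp [QF.code, qfApprox_pair, h1, h2]

end Satisfaction

section Satisfaction

variable {L : FirstOrder.Language.{0, 0}} [Encodable (Σ k, L.Relations k)]
variable {X : Set ℕ} {a d q : ℕ} {M : Type} {T : L.Structure M} {μ : M → ℕ}

open Classical in
/-- The program `t` computes the truth values of all `X`-computable `Σ_k` or `Π_k` formulas, in
all structures given by the programs `a` and `d`, from the `k`-th jump of `X`. -/
def TruthIndex (L : FirstOrder.Language.{0, 0}) [Encodable (Σ k, L.Relations k)]
    (X : Set ℕ) (a d k : ℕ) (b : Kind) (t : ℕ) : Prop :=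
  ∀ ⦃q : ℕ⦄ ⦃M : Type⦄ ⦃T : L.Structure M⦄ ⦃μ : M → ℕ⦄, Presents X a d q T μ →
    ∀ ⦃m : ℕ⦄ (ψ : Fml L b k m) (c : ℕ), ψ.IsIndex X c → ∀ x : Fin m → M,
      Phi (jump^[k] X) t (encode (q, c, List.ofFn (μ ∘ x))) =
        Part.some (if ψ.Realize T x then 1 else 0)

theorem exists_truthIndex_zero (X : Set ℕ) (a d : ℕ) (b : Kind) :
    ∃ t, TruthIndex L X a d 0 b t := by
  classical
  have hR : PrimrecPred fun p : List ℕ × (ℕ × Bool) × ℕ × ℕ × List ℕ =>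
      qfApprox a ((p.1, p.2.1.1), p.2.2.1, p.2.2.2.2) p.2.2.2.1 = some p.2.1.2 := by
    have hw : Primrec fun p : List ℕ × (ℕ × Bool) × ℕ × ℕ × List ℕ => p.2.1 :=
      Primrec.fst.comp Primrec.snd
    have hi : Primrec fun p : List ℕ × (ℕ × Bool) × ℕ × ℕ × List ℕ => p.2.2 :=
      Primrec.snd.comp Primrec.snd
    refine Primrec.eq.comp ((primrec_qfApprox a).comp (Primrec.pair (Primrec.fst.pair
      (Primrec.fst.comp hw)) (Primrec.pair (Primrec.fst.comp hi)
        (Primrec.snd.comp (Primrec.snd.comp hi)))) (Primrec.fst.comp (Primrec.snd.comp hi)))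
      (Primrec.option_some.comp (Primrec.snd.comp hw))
  obtain ⟨t, ht⟩ := exists_search_total X hR
    (v := fun w => w.2.toNat) ((Primrec.dom_bool Bool.toNat).comp Primrec.snd)
  refine ⟨t, fun q M T μ h m ψ c hc x => ?_⟩
  cases ψ with
  | qf θ =>
    rw [Fml.IsIndex] at hc
    subst hc
    refine ht _ _ (fun k w hw => ?_) ?_
    · have := qfApprox_sound h _ _ θ x _ hw
      rw [Fml.Realize, ← this]
      cases w.2 <;> simp
    · obtain ⟨k, hk⟩ := (qfApprox_complete h θ x).exists
      obtain ⟨w, hw⟩ := hk.exists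
      obtain ⟨v, hv⟩ := Option.isSome_iff_exists.1 hw
      exact ⟨k, (w, v), hv⟩

theorem ofFn_append {m r : ℕ} (μ : M → ℕ) (x : Fin m → M) (y : Fin r → M) :
    List.ofFn (μ ∘ Fin.append x y) = List.ofFn (μ ∘ x) ++ List.ofFn (μ ∘ y) := by
  rw [← List.ofFn_fin_append]
  congr 1
  funext i
  refine Fin.addCases (fun i => ?_) (fun i => ?_) i <;> simp

theorem ite_one_zero_eq_iff {P Q : Prop} [Decidable P] [Decidable Q] :
    (if P then 1 else 0) = (if Q then 1 else 0 : ℕ) ↔ (Q ↔ P) := by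
  by_cases hP : P <;> by_cases hQ : Q <;> simp [hP, hQ]

/-- Truth of a `Σ_{k+1}` formula, and falsity of a `Π_{k+1}` formula, can be recognized with
the `k`-th jump of the oracle. -/
theorem exists_recognizes {k t : ℕ} {b : Kind} (ht : TruthIndex L X a d k b.dual t) :
    ∃ r, ∀ ⦃q : ℕ⦄ ⦃M : Type⦄ ⦃T : L.Structure M⦄ ⦃μ : M → ℕ⦄, Presents X a d q T μ →
      ∀ ⦃m : ℕ⦄ (ψ : Fml L b (k + 1) m) (c : ℕ), ψ.IsIndex X c → ∀ x : Fin m → M,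
        ((Phi (jump^[k] X) r (encode (q, c, List.ofFn (μ ∘ x)))).Dom ↔
          (ψ.Realize T x ↔ b = .sigma)) := by
  classical
  obtain ⟨u, hu⟩ := exists_universal_jump X k
  -- A `Σ` formula is verified by a true instance of a member, a `Π` formula is refuted by a false
  -- one; `β` is the truth value to look for.
  set β : ℕ := if b = .sigma then 1 else 0 with hβ
  -- witnesses: a bound, the index `i`, the number of variables, the index of the member, a tuple
  have hR : PrimrecPred fun p : List ℕ × (ℕ × ℕ × ℕ × ℕ × List ℕ) × ℕ × ℕ × List ℕ =>
      (evalApprox p.1 p.2.1.1 u (Nat.pair p.2.2.2.1 p.2.1.2.1) =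
        some (Nat.pair p.2.1.2.2.1 p.2.1.2.2.2.1)) ∧
      (p.2.1.2.2.2.2.length = p.2.1.2.2.1) ∧
      (∀ y ∈ p.2.1.2.2.2.2, evalApprox p.1 p.2.1.1 u (Nat.pair d (Nat.pair p.2.2.1 y)) = some 1) ∧
      (evalApprox p.1 p.2.1.1 t (encode (p.2.2.1, p.2.1.2.2.2.1, p.2.2.2.2 ++ p.2.1.2.2.2.2)) =
        some β) := by
    have hw : Primrec fun p : List ℕ × (ℕ × ℕ × ℕ × ℕ × List ℕ) × ℕ × ℕ × List ℕ => p.2.1 :=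
      Primrec.fst.comp Primrec.snd
    have hi : Primrec fun p : List ℕ × (ℕ × ℕ × ℕ × ℕ × List ℕ) × ℕ × ℕ × List ℕ => p.2.2 :=
      Primrec.snd.comp Primrec.snd
    have hw1 := Primrec.fst.comp hw
    have hw2 := Primrec.fst.comp (Primrec.snd.comp hw)
    have hw3 := Primrec.fst.comp (Primrec.snd.comp (Primrec.snd.comp hw))
    have hw4 := Primrec.fst.comp (Primrec.snd.comp (Primrec.snd.comp (Primrec.snd.comp hw)))
    have hw5 := Primrec.snd.comp (Primrec.snd.comp (Primrec.snd.comp (Primrec.snd.comp hw)))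
    have hq := Primrec.fst.comp hi
    have hc := Primrec.fst.comp (Primrec.snd.comp hi)
    have hl := Primrec.snd.comp (Primrec.snd.comp hi)
    refine PrimrecPred.and ?_ (PrimrecPred.and ?_ (PrimrecPred.and ?_ ?_))
    · exact Primrec.eq.comp (primrec_evalApprox Primrec.fst hw1 (Primrec.const _)
        (Primrec₂.natPair.comp hc hw2)) (Primrec.option_some.comp (Primrec₂.natPair.comp hw3 hw4))
    · exact Primrec.eq.comp (Primrec.list_length.comp hw5) hw3
    · have : PrimrecRel fun (y : ℕ) (p : List ℕ × (ℕ × ℕ × ℕ × ℕ × List ℕ) × ℕ × ℕ × List ℕ) =>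
          evalApprox p.1 p.2.1.1 u (Nat.pair d (Nat.pair p.2.2.1 y)) = some 1 :=
        Primrec.eq.comp (primrec_evalApprox (Primrec.fst.comp Primrec.snd)
          (hw1.comp Primrec.snd) (Primrec.const _) (Primrec₂.natPair.comp (Primrec.const _)
            (Primrec₂.natPair.comp (hq.comp Primrec.snd) Primrec.fst))) (Primrec.const _)
      exact this.forall_mem_list.comp hw5 Primrec.id
    · exact Primrec.eq.comp (primrec_evalApprox Primrec.fst hw1 (Primrec.const _)
        (Primrec.encode.comp (hq.pair (hw4.pair (Primrec.list_append.comp hl hw5)))))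
        (Primrec.const _)
  obtain ⟨r, hr⟩ := exists_search_pred (jump^[k] X) hR (v := fun _ => 0) (Primrec.const 0)
  refine ⟨r, fun q M T μ h m ψ c hc x => ?_⟩
  have key : (Phi (jump^[k] X) r (encode (q, c, List.ofFn (μ ∘ x)))).Dom ↔
      ∃ (k' : ℕ) (w : _), _ := ⟨fun hd => by
        obtain ⟨k', w, h, -⟩ := (hr _).1 _ (Part.get_mem hd)
        exact ⟨k', w, h⟩, (hr _).2⟩
  rw [key]
  cases ψ with
  | block I n ψ =>
    rw [Fml.IsIndex] at hc
    obtain ⟨hI, hc⟩ := hc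
    have hreal : ((Fml.block I n ψ).Realize T x ↔ b = .sigma) ↔
        ∃ i ∈ I, ∃ y : Fin (n i) → M, ((ψ i).Realize T (Fin.append x y) ↔ b = .sigma) := by
      cases b with
      | sigma => simp [Fml.Realize]
      | pi => simp [Fml.Realize]
    rw [hreal]
    constructor
    · rintro ⟨k', ⟨w, i, ni, c', l⟩, h1, h2, h3, h4⟩
      dsimp only at h1 h2 h3 h4
      have h1 := evalApprox_sound h1
      rw [hu] at h1
      have hi : i ∈ I := (hI i).2 (Part.dom_iff_mem.2 ⟨_, h1⟩)
      obtain ⟨c'', hc1, hc2⟩ := hc i hi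
      rw [hc1, Part.mem_some_iff, Nat.pair_eq_pair] at h1
      obtain ⟨rfl, rfl⟩ := h1
      have hy : ∀ j : Fin (n i), ∃ z, μ z = l.get (j.cast h2.symm) := fun j => by
        have := evalApprox_sound (h3 _ (List.get_mem l (j.cast h2.symm)))
        rw [hu, h.mem_range] at this
        exact this
      choose y hy using hy
      have hl : l = List.ofFn (μ ∘ y) := by
        refine List.ext_get (by simp [h2]) fun j h _ => ?_
        simp [hy]
      refine ⟨i, hi, y, ?_⟩
      have h4 := evalApprox_sound h4
      rw [hl, ← ofFn_append, ht h (ψ i) _ hc2, Part.mem_some_iff, hβ] at h4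
      exact ite_one_zero_eq_iff.1 h4
    · rintro ⟨i, hi, y, hy⟩
      obtain ⟨c', hc1, hc2⟩ := hc i hi
      have e1 := evalApprox_complete (X := jump^[k] X) (e := u) (x := Nat.pair c i)
        (by rw [hu]; exact Part.eq_some_iff.1 hc1)
      have e2 : ∀ᶠ k' in atTop, ∀ᶠ w in atTop, ∀ z ∈ (List.ofFn (μ ∘ y)).toFinset,
          evalApprox (chiList (jump^[k] X) k') w u (Nat.pair d (Nat.pair q z)) = some 1 := by
        have : ∀ᶠ k' in atTop, ∀ z ∈ (List.ofFn (μ ∘ y)).toFinset, ∀ᶠ w in atTop,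
          evalApprox (chiList (jump^[k] X) k') w u (Nat.pair d (Nat.pair q z)) = some 1 := by
          rw [Filter.eventually_all_finset]
          intro z hz
          refine evalApprox_complete ?_
          rw [hu, h.mem_range]
          rw [List.mem_toFinset, List.mem_ofFn] at hz
          obtain ⟨j, hj⟩ := hz
          exact ⟨y j, hj⟩
        filter_upwards [this] with k' hk'
        rwa [Filter.eventually_all_finset]
      have e3 := evalApprox_complete (X := jump^[k] X) (e := t)
        (x := encode (q, c', List.ofFn (μ ∘ Fin.append x y))) (y := β) (by
          rw [ht h (ψ i) _ hc2, Part.mem_some_iff, hβ]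
          exact ite_one_zero_eq_iff.2 hy)
      obtain ⟨k', h1, h2, h3⟩ := (e1.and (e2.and e3)).exists
      obtain ⟨w, h1, h2, h3⟩ := (h1.and (h2.and h3)).exists
      rw [ofFn_append] at h3
      exact ⟨k', ⟨w, i, n i, c', List.ofFn (μ ∘ y)⟩, h1, List.length_ofFn,
        fun z hz => h2 z (List.mem_toFinset.2 hz), h3⟩

/-- Each level costs one jump: the search for an instance runs relative to `jump^[k] X`, and the
next jump decides whether it halts. The formulas stay `X`-computable throughout; their members are
enumerated by the universal function of `X`, which all the jumps compute. -/
theorem exists_truthIndex (X : Set ℕ) (a d k : ℕ) :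
    ∀ b : Kind, ∃ t, TruthIndex L X a d k b t := by
  classical
  induction k with
  | zero => exact exists_truthIndex_zero X a d
  | succ k ih =>
    intro b
    obtain ⟨t, ht⟩ := ih b.dual
    obtain ⟨r, hr⟩ := exists_recognizes ht
    obtain ⟨t', ht'⟩ := exists_decides_dom (jump^[k] X) r
    -- For a `Π` formula halting means falsity, so the answer is flipped.
    have hneg : TotalIn (jump^[k + 1] X) fun v => if b = .sigma then v else 1 - v := by
      split_ifs
      · exact .of_computable Computable.id
      · exact .of_computable (Primrec.nat_sub.comp (Primrec.const 1) Primrec.id).to_comp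
    obtain ⟨t'', ht''⟩ := (exists_Phi_eq_iff (jump^[k + 1] X) _).2
      (Nat.RecursiveIn.comp hneg ((exists_Phi_eq_iff _ _).1 ⟨t', rfl⟩))
    refine ⟨t'', fun q M T μ h m ψ c hc x => ?_⟩
    rw [ht'']
    simp only [Function.iterate_succ_apply', ht', Part.bind_eq_bind, Part.bind_some,
      hr h ψ c hc x]
    by_cases hb : b = .sigma <;> by_cases hx : ψ.Realize T x <;> simp [hb, hx]

/-- Truth of a `Σ_{k+1}` formula can be recognized with the `k`-th jump of the oracle. -/
theorem exists_recognizes_sigma (X : Set ℕ) (a d k : ℕ) :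
    ∃ r, ∀ ⦃q : ℕ⦄ ⦃M : Type⦄ ⦃T : L.Structure M⦄ ⦃μ : M → ℕ⦄, Presents X a d q T μ →
      ∀ (ψ : Fml L .sigma (k + 1) 0) (c : ℕ), ψ.IsIndex X c →
        ((Phi (jump^[k] X) r (encode (q, c, ([] : List ℕ)))).Dom ↔ ψ.Holds T) := by
  obtain ⟨t, ht⟩ := exists_truthIndex (L := L) X a d k Kind.sigma.dual
  obtain ⟨r, hr⟩ := exists_recognizes ht
  refine ⟨r, fun q M T μ h ψ c hc => ?_⟩
  have := hr h ψ c hc Fin.elim0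
  rw [List.ofFn_zero, eq_self_iff_true, iff_true] at this
  exact this

end Satisfaction

/-! ## Collapsing a set of numbers onto an initial segment -/

theorem exists_count_eq {p : ℕ → Prop} [DecidablePred p] {m n : ℕ} (h : m < Nat.count p n) :
    ∃ k, p k ∧ Nat.count p k = m := by
  induction n with
  | zero => simp at h
  | succ n ih =>
    rw [Nat.count_succ] at h
    by_cases hm : m < Nat.count p n
    · exact ih hm
    · split_ifs at h with hp
      · exact ⟨n, hp, by omega⟩
      · omega

/-- Replacing a name by the number of smaller names makes the names an initial segment of `ℕ`, as
the universe of a copy has to be. -/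
theorem count_comp_injective {V : Type} {f : V → ℕ} (hf : Function.Injective f) {p : ℕ → Prop}
    [DecidablePred p] (hp : ∀ m, p m ↔ m ∈ Set.range f) :
    Function.Injective fun u => Nat.count p (f u) :=
  fun u v h => hf (Nat.count_injective ((hp _).2 ⟨u, rfl⟩) ((hp _).2 ⟨v, rfl⟩) h)

theorem isLowerSet_range_count {V : Type} {f : V → ℕ} {p : ℕ → Prop}
    [DecidablePred p] (hp : ∀ m, p m ↔ m ∈ Set.range f) :
    IsLowerSet (Set.range fun u => Nat.count p (f u)) := by
  rintro _ m hm ⟨u, rfl⟩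
  rcases hm.lt_or_eq with h | h
  · obtain ⟨k, hk, rfl⟩ := exists_count_eq h
    obtain ⟨v, rfl⟩ := (hp k).1 hk
    exact ⟨v, rfl⟩
  · exact ⟨u, h.symm⟩

theorem eq_univ_of_isLowerSet {s : Set ℕ} (hs : IsLowerSet s) (h : s.Infinite) : s = Set.univ := by
  rcases hs.eq_univ_or_Iio with h' | ⟨a, h'⟩
  · exact h'
  · exact absurd (h' ▸ Set.finite_Iio a) h

/-! ## The graph of a copy of its jump inversion -/

/-- It has been verified, in `w` steps with the initial segment `σ` of the oracle, that `m` is the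
`i`-th number that satisfies `U` according to the program `e`. -/
def Locates (u : ℕ) (σ : List ℕ) (w e m i : ℕ) : Prop :=
  (∀ j ∈ List.range m, (evalApprox σ w u (Nat.pair e (Nat.pair 1 (encode [j])))).isSome) ∧
    ((List.range m).filter fun j =>
      evalApprox σ w u (Nat.pair e (Nat.pair 1 (encode [j]))) = some 1).length = i ∧
    evalApprox σ w u (Nat.pair e (Nat.pair 1 (encode [m]))) = some 1

theorem primrecPred_locates {α : Type} [Primcodable α] (u : ℕ) {σ : α → List ℕ} {w e m i : α → ℕ}
    (hσ : Primrec σ) (hw : Primrec w) (he : Primrec e) (hm : Primrec m) (hi : Primrec i) :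
    PrimrecPred fun p => Locates u (σ p) (w p) (e p) (m p) (i p) := by
  have hev : Primrec fun z : ℕ × α =>
      evalApprox (σ z.2) (w z.2) u (Nat.pair (e z.2) (Nat.pair 1 (encode [z.1]))) :=
    primrec_evalApprox (hσ.comp Primrec.snd) (hw.comp Primrec.snd) (Primrec.const _)
      (Primrec₂.natPair.comp (he.comp Primrec.snd) (Primrec₂.natPair.comp (Primrec.const 1)
        (Primrec.encode.comp (Primrec.list_cons.comp Primrec.fst (Primrec.const [])))))
  have h1 : PrimrecRel fun (j : ℕ) (p : α) =>
      evalApprox (σ p) (w p) u (Nat.pair (e p) (Nat.pair 1 (encode [j]))) = some 1 :=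
    Primrec.eq.comp hev (Primrec.const _)
  have h2 : PrimrecRel fun (j : ℕ) (p : α) =>
      (evalApprox (σ p) (w p) u (Nat.pair (e p) (Nat.pair 1 (encode [j])))).isSome = true :=
    Primrec.eq.comp (Primrec.option_isSome.comp hev) (Primrec.const true)
  refine PrimrecPred.and ?_ (PrimrecPred.and ?_ ?_)
  · exact h2.forall_mem_list.comp (Primrec.list_range.comp hm) Primrec.id
  · exact Primrec.eq.comp (Primrec.list_length.comp
      (h1.listFilter.comp (Primrec.list_range.comp hm) Primrec.id)) hi
  · exact h1.comp hm Primrec.id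

section Locates

variable {X Y : Set ℕ} {u e : ℕ} {P : ℕ → Prop} [DecidablePred P]

/-- Demanding that every test below `m` has halted makes the filtered list exact; an undecided
number would otherwise pass for one outside `P` and spoil the count. -/
theorem Locates.sound (hu : ∀ e x, Phi Y u (Nat.pair e x) = Phi X e x)
    (hP : ∀ j, Phi X e (Nat.pair 1 (encode [j])) = Part.some (if P j then 1 else 0))
    {k w m i : ℕ} (h : Locates u (chiList Y k) w e m i) : P m ∧ Nat.count P m = i := by
  have hev : ∀ {j v}, evalApprox (chiList Y k) w u (Nat.pair e (Nat.pair 1 (encode [j]))) =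
      some v → v = if P j then 1 else 0 := fun {j v} h => by
    have := evalApprox_sound h
    rwa [hu, hP, Part.mem_some_iff] at this
  obtain ⟨h1, h2, h3⟩ := h
  refine ⟨by have := hev h3; by_contra hm; simp [hm] at this, ?_⟩
  rw [← h2, Nat.count, List.countP_eq_length_filter]
  congr 1
  refine List.filter_congr fun j hj => ?_
  obtain ⟨v, hv⟩ := Option.isSome_iff_exists.1 (h1 j hj)
  rw [hv, hev hv]
  by_cases hj : P j <;> simp [hj]

theorem Locates.complete (hu : ∀ e x, Phi Y u (Nat.pair e x) = Phi X e x)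
    (hP : ∀ j, Phi X e (Nat.pair 1 (encode [j])) = Part.some (if P j then 1 else 0))
    {m : ℕ} (hm : P m) :
    ∀ᶠ k in atTop, ∀ᶠ w in atTop, Locates u (chiList Y k) w e m (Nat.count P m) := by
  have hev : ∀ᶠ k in atTop, ∀ᶠ w in atTop, ∀ j ∈ Finset.range (m + 1),
      evalApprox (chiList Y k) w u (Nat.pair e (Nat.pair 1 (encode [j]))) =
        some (if P j then 1 else 0) := by
    have : ∀ᶠ k in atTop, ∀ j ∈ Finset.range (m + 1), ∀ᶠ w in atTop,
        evalApprox (chiList Y k) w u (Nat.pair e (Nat.pair 1 (encode [j]))) =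
          some (if P j then 1 else 0) := by
      rw [Filter.eventually_all_finset]
      intro j _
      exact evalApprox_complete (by rw [hu, hP]; exact Part.mem_some _)
    filter_upwards [this] with k hk
    rwa [Filter.eventually_all_finset]
  filter_upwards [hev] with k hk
  filter_upwards [hk] with w hw
  refine ⟨fun j hj => ?_, ?_, ?_⟩
  · rw [hw j (by simp at hj ⊢; omega)]
    rfl
  · rw [Nat.count, List.countP_eq_length_filter]
    congr 1
    refine List.filter_congr fun j hj => ?_
    rw [hw j (by simp at hj ⊢; omega)]
    by_cases hj : P j <;> simp [hj]
  · rw [hw m (by simp), if_pos hm]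

end Locates

/-- Two distinct vertices carry an infinite piece, so the copy is infinite and every number names an
element. Only then does the index of the copy answer questions about arbitrary numbers. -/
theorem range_eq_univ_of_not_isDiag {V : Type} {ν : InvUniverse V → ℕ}
    (hinj : Function.Injective ν) (hlow : IsLowerSet (Set.range ν)) {p : Sym2 V}
    (h : ¬ p.IsDiag) : Set.range ν = Set.univ := by
  refine eq_univ_of_isLowerSet hlow ?_
  refine (Set.infinite_range_of_injective (f := fun x : ℕ =>
    ν (Sum.inr (⟨p, h⟩, true, x))) fun x y hxy => by simpa using hinj hxy).mono ?_
  rintro _ ⟨x, rfl⟩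
  exact ⟨_, rfl⟩

/-- A tuple of positive length determines the piece it lies in. A nullary relation would hold as
soon as some piece satisfied it, which is why nullary symbols are excluded. -/
theorem relMap_jumpInversion_inl {L : FirstOrder.Language.{0, 0}} [L.IsRelational]
    [IsEmpty (L.Relations 0)] {A B : L.Structure ℕ} {V : Type} {G : SimpleGraph V} {k : ℕ}
    (R : L.Relations k)
    (p : {p : Sym2 V // ¬ p.IsDiag}) (c : Bool) (x : Fin k → ℕ) :
    (jumpInversion A B G).RelMap (Sum.inl R) (fun i => Sum.inr (p, c, x i)) ↔
      (piece A B G p.1 c).RelMap R x := by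
  constructor
  · rintro ⟨p', c', x', hx, hR⟩
    rcases Nat.eq_zero_or_pos k with rfl | hk
    · exact isEmptyElim R
    · have h0 := congrFun hx ⟨0, hk⟩
      simp only [Sum.inr.injEq, Prod.mk.injEq] at h0
      obtain ⟨rfl, rfl, -⟩ := h0
      have : x = x' := funext fun i => by
        have := congrFun hx i
        simpa using this
      rwa [this]
  · exact fun hR => ⟨p, c, x, rfl, hR⟩

section GraphOfCopy

theorem atomValue_congr {L₁ L₂ : FirstOrder.Language.{0, 0}} {M N : Type} {S : L₁.Structure M}
    {T : L₂.Structure N} {k l : ℕ} {R : L₁.Relations k} {R' : L₂.Relations l} {v : Fin k → M}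
    {w : Fin l → N} (h : S.RelMap R v ↔ T.RelMap R' w) : atomValue S R v = atomValue T R' w := by
  unfold atomValue
  by_cases hR : S.RelMap R v
  · rw [if_pos hR, if_pos (h.1 hR)]
  · rw [if_neg hR, if_neg fun h' => hR (h.2 h')]

theorem atomValue_of {L : FirstOrder.Language.{0, 0}} {M : Type} {S : L.Structure M} {k : ℕ}
    {R : L.Relations k} {v : Fin k → M} {P : Prop} [Decidable P] (h : S.RelMap R v ↔ P) :
    atomValue S R v = if P then 1 else 0 := by
  unfold atomValue
  by_cases hP : P
  · rw [if_pos hP, if_pos (h.2 hP)]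
  · rw [if_neg hP, if_neg fun h' => hP (h.1 h')]

variable {L : FirstOrder.Language.{0, 0}} [Encodable (Σ k, L.Relations k)]

theorem atomCode_graph {R : FirstOrder.Language.graph.Relations 2} (t : Fin 2 → ℕ) :
    atomCode R t = Nat.pair 0 (encode [t 0, t 1]) := by
  simp [atomCode, encode, List.ofFn_succ]

/-- Symbols of `L` have even numbers in the large language, and `U`, `E`, `F` have the numbers `1`,
`3`, `5`; these are the constants in the programs below. -/
theorem atomCode_inl {k : ℕ} (R : L.Relations k) (t : Fin k → ℕ) :
    atomCode (L := invLang L) (Sum.inl R) t =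
      Nat.pair (2 * encode (⟨k, R⟩ : Σ k, L.Relations k)) (encode (List.ofFn t)) := rfl

theorem atomCode_U' (t : Fin 1 → ℕ) :
    atomCode (L := invLang L) (Sum.inr MarkRel.U) t = Nat.pair 1 (encode (List.ofFn t)) := rfl

theorem atomCode_U (t : Fin 1 → ℕ) :
    atomCode (L := invLang L) (Sum.inr MarkRel.U) t = Nat.pair 1 (encode [t 0]) := by
  simp only [atomCode, List.ofFn_succ, List.ofFn_zero]
  rfl

theorem atomCode_E' (t : Fin 3 → ℕ) :
    atomCode (L := invLang L) (Sum.inr MarkRel.E) t = Nat.pair 3 (encode (List.ofFn t)) := rfl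

theorem atomCode_E (t : Fin 3 → ℕ) :
    atomCode (L := invLang L) (Sum.inr MarkRel.E) t = Nat.pair 3 (encode [t 0, t 1, t 2]) := by
  simp only [atomCode, List.ofFn_succ, List.ofFn_zero]
  rfl

theorem atomCode_F' (t : Fin 3 → ℕ) :
    atomCode (L := invLang L) (Sum.inr MarkRel.F) t = Nat.pair 5 (encode (List.ofFn t)) := rfl

theorem atomCode_F (t : Fin 3 → ℕ) :
    atomCode (L := invLang L) (Sum.inr MarkRel.F) t = Nat.pair 5 (encode [t 0, t 1, t 2]) := by
  simp only [atomCode, List.ofFn_succ, List.ofFn_zero]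
  rfl

/-- The ternary mark of the pieces `C_p` (for `true`) or `D_p` (for `false`). -/
def pieceMark (c : Bool) : MarkRel 3 := bif c then .E else .F

theorem atomCode_pieceMark (c : Bool) (t : Fin 3 → ℕ) :
    atomCode (L := invLang L) (Sum.inr (pieceMark c)) t =
      Nat.pair (bif c then 3 else 5) (encode [t 0, t 1, t 2]) := by
  cases c
  · exact atomCode_F t
  · exact atomCode_E t

theorem markHolds_pieceMark {V : Type} (c : Bool) (x : Fin 3 → InvUniverse V) :
    markHolds (pieceMark c) x ↔ ∃ (u v : V) (h : ¬ (s(u, v)).IsDiag) (a : ℕ),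
      x 0 = Sum.inl u ∧ x 1 = Sum.inl v ∧ x 2 = Sum.inr (⟨s(u, v), h⟩, c, a) := by
  cases c <;> rfl

variable [L.IsRelational] [IsEmpty (L.Relations 0)] {A B : L.Structure ℕ} {V : Type}
  {G : SimpleGraph V}

/-- Programs that present the pieces of a copy of a jump inversion, uniformly in the index of the
copy, the two vertices, and the mark. -/
theorem exists_presents_piece (X : Set ℕ) : ∃ a d, ∀ {A B : L.Structure ℕ} {V : Type}
    {G : SimpleGraph V} (e : ℕ) (ν : InvUniverse V → ℕ), Function.Injective ν →
    IsLowerSet (Set.range ν) → DecidesDiagram X e (jumpInversion A B G) ν →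
    ∀ (u v : V) (h : ¬ (s(u, v)).IsDiag) (c : Bool),
      Presents X a d (encode (e, ν (Sum.inl u), ν (Sum.inl v), (bif c then 3 else 5 : ℕ)))
        (piece A B G s(u, v) c) (fun x => ν (Sum.inr (⟨s(u, v), h⟩, c, x))) := by
  obtain ⟨un, hun⟩ := exists_universal X
  have hfst : Primrec fun z : ℕ => z.unpair.1 := Primrec.fst.comp Primrec.unpair
  have hsnd : Primrec fun z : ℕ => z.unpair.2 := Primrec.snd.comp Primrec.unpair
  have he := hfst.comp hfst
  have hu := hfst.comp (hsnd.comp hfst)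
  have hv := hfst.comp (hsnd.comp (hsnd.comp hfst))
  have hm := hsnd.comp (hsnd.comp (hsnd.comp hfst))
  -- Both programs call the index of the copy: `h1` prepares the same atom in the large language,
  -- where the number of the symbol doubles, and `h2` asks whether the given mark holds of the two
  -- vertices and the candidate element.
  have h1 : Primrec fun z : ℕ => Nat.pair z.unpair.1.unpair.1
      (Nat.pair (2 * z.unpair.2.unpair.1) z.unpair.2.unpair.2) :=
    Primrec₂.natPair.comp he (Primrec₂.natPair.comp (Primrec.nat_mul.comp (Primrec.const 2)
      (hfst.comp hsnd)) (hsnd.comp hsnd))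
  have h2 : Primrec fun z : ℕ => Nat.pair z.unpair.1.unpair.1
      (Nat.pair z.unpair.1.unpair.2.unpair.2.unpair.2
        (encode [z.unpair.1.unpair.2.unpair.1, z.unpair.1.unpair.2.unpair.2.unpair.1,
          z.unpair.2])) :=
    Primrec₂.natPair.comp he (Primrec₂.natPair.comp hm (Primrec.encode.comp
      (Primrec.list_cons.comp hu (Primrec.list_cons.comp hv
        (Primrec.list_cons.comp hsnd (Primrec.const []))))))
  obtain ⟨a, ha⟩ := exists_comp (X := X) (.of_computable h1.to_comp) un
  obtain ⟨d, hd⟩ := exists_comp (X := X) (.of_computable h2.to_comp) un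
  refine ⟨a, d, fun {A B V G} e ν hinj hlow hdec u v h c => ⟨?_, fun y => ?_, fun k R x => ?_⟩⟩
  · intro x y hxy
    simpa using hinj hxy
  · have huniv := range_eq_univ_of_not_isDiag hinj hlow h
    obtain ⟨z, rfl⟩ : y ∈ Set.range ν := huniv ▸ Set.mem_univ y
    have := hdec 3 (Sum.inr (pieceMark c)) ![Sum.inl u, Sum.inl v, z]
    rw [atomCode_pieceMark] at this
    simp only [hd, hun, encode_prod_val, encode_nat, Nat.unpair_pair]
    simp only [Function.comp_apply, Matrix.cons_val] at this
    rw [this, Part.mem_some_iff]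
    unfold atomValue
    have hmk : (jumpInversion A B G).RelMap (Sum.inr (pieceMark c)) ![Sum.inl u, Sum.inl v, z] ↔
        markHolds (pieceMark c) ![Sum.inl u, Sum.inl v, z] := Iff.rfl
    rw [hmk, markHolds_pieceMark]
    have : (∃ (u' v' : V) (h : ¬ (s(u', v')).IsDiag) (x : ℕ),
        (![Sum.inl u, Sum.inl v, z] : Fin 3 → InvUniverse V) 0 = Sum.inl u' ∧
        (![Sum.inl u, Sum.inl v, z] : Fin 3 → InvUniverse V) 1 = Sum.inl v' ∧
        (![Sum.inl u, Sum.inl v, z] : Fin 3 → InvUniverse V) 2 =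
          Sum.inr (⟨s(u', v'), h⟩, c, x)) ↔
        ν z ∈ Set.range fun x => ν (Sum.inr (⟨s(u, v), h⟩, c, x)) := by
      constructor
      · rintro ⟨u', v', h', x, hu', hv', hz⟩
        obtain rfl : u = u' := by simpa using hu'
        obtain rfl : v = v' := by simpa using hv'
        exact ⟨x, by rw [show z = _ from hz]⟩
      · rintro ⟨x, hx⟩
        exact ⟨u, v, h, x, rfl, rfl, (hinj hx).symm⟩
    rw [this]
    split <;> simp_all
  · have := hdec k (Sum.inl R) fun i => Sum.inr (⟨s(u, v), h⟩, c, x i)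
    rw [atomCode_inl] at this
    simp only [ha, hun, encode_prod_val, encode_nat, Nat.unpair_pair, atomCode]
    refine this.trans ?_
    have hrel : (jumpInversion A B G).RelMap (Sum.inl R)
        (fun i => Sum.inr (⟨s(u, v), h⟩, c, x i)) ↔ (piece A B G s(u, v) c).RelMap R x :=
      relMap_jumpInversion_inl R ⟨_, h⟩ c x
    exact congrArg Part.some (atomValue_congr hrel)

end GraphOfCopy

/-- Exactly one of the two pieces of a pair satisfies `φ`, and which one it is decides adjacency. -/
theorem holds_piece_iff {L : FirstOrder.Language.{0, 0}} {A B : L.Structure ℕ} {V : Type}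
    {G : SimpleGraph V} {n : ℕ} {b : Kind}
    {φ : Fml L b n 0} (hA : φ.Holds A) (hB : ¬ φ.Holds B) (u v : V) (c : Bool) :
    φ.Holds (piece A B G s(u, v) c) ↔ (G.Adj u v ↔ c = true) := by
  have : s(u, v) ∈ G.edgeSet ↔ G.Adj u v := SimpleGraph.mem_edgeSet G
  unfold piece
  split_ifs with h <;> rw [this] at h <;> simp [hA, hB, h]

section GraphOfCopy

variable {L : FirstOrder.Language.{0, 0}} [Encodable (Σ k, L.Relations k)]
variable [L.IsRelational] [IsEmpty (L.Relations 0)]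

/-- A vertex of the new copy is the rank of its name among all names of vertices. To decide
adjacency of two ranks, search for the two names and for the mark, `3` or `5`, of a piece satisfying
`φ`. Such a piece exists and is unique, so the search halts with the right answer. The number of
vertices is never used. -/
theorem exists_graph_of_copy {A B : L.Structure ℕ} (X : Set ℕ) {n : ℕ}
    {φ : Fml L .sigma (n + 1) 0} (hφ : φ.IsComputableIn X) (hA : φ.Holds A) (hB : ¬ φ.Holds B) :
    ∃ h : ℕ → ℕ, Computable h ∧ ∀ (V : Type) (G : SimpleGraph V) (e : ℕ),
      IsCopyIndex X e (jumpInversion A B G) → IsCopyIndex (jump^[n] X) (h e) G.structure := by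
  classical
  obtain ⟨cφ, hcφ⟩ := hφ
  obtain ⟨a, d, had⟩ := exists_presents_piece (L := L) X
  obtain ⟨r, hr⟩ := exists_recognizes_sigma (L := L) X a d n
  obtain ⟨u, hu⟩ := exists_universal_jump X n
  -- witnesses: a bound, the names of the two vertices, and the mark of the piece satisfying `φ`
  have hR : PrimrecPred fun p : List ℕ × (ℕ × ℕ × ℕ × ℕ) × ℕ × ℕ × List ℕ =>
      -- There is no piece on the diagonal; the answer there is `0`, which the mark `5` stands for.
      (p.2.2.2.2.getD 0 0 = p.2.2.2.2.getD 1 0 ∧ p.2.1.2.2.2 = 5) ∨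
      (¬ p.2.2.2.2.getD 0 0 = p.2.2.2.2.getD 1 0 ∧
        Locates u p.1 p.2.1.1 p.2.2.1 p.2.1.2.1 (p.2.2.2.2.getD 0 0) ∧
        Locates u p.1 p.2.1.1 p.2.2.1 p.2.1.2.2.1 (p.2.2.2.2.getD 1 0) ∧
        (p.2.1.2.2.2 = 3 ∨ p.2.1.2.2.2 = 5) ∧
        (evalApprox p.1 p.2.1.1 r (encode (encode (p.2.2.1, p.2.1.2), cφ, ([] : List ℕ)))).isSome =
          true) := by
    have hw : Primrec fun p : List ℕ × (ℕ × ℕ × ℕ × ℕ) × ℕ × ℕ × List ℕ => p.2.1 :=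
      Primrec.fst.comp Primrec.snd
    have he : Primrec fun p : List ℕ × (ℕ × ℕ × ℕ × ℕ) × ℕ × ℕ × List ℕ => p.2.2.1 :=
      Primrec.fst.comp (Primrec.snd.comp Primrec.snd)
    have hl : Primrec fun p : List ℕ × (ℕ × ℕ × ℕ × ℕ) × ℕ × ℕ × List ℕ => p.2.2.2.2 :=
      Primrec.snd.comp (Primrec.snd.comp (Primrec.snd.comp Primrec.snd))
    have hl0 := (Primrec.list_getD 0).comp hl (Primrec.const 0)
    have hl1 := (Primrec.list_getD 0).comp hl (Primrec.const 1)
    have hw0 := Primrec.fst.comp hw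
    have hw' := Primrec.snd.comp hw
    have hw1 := Primrec.fst.comp hw'
    have hw2 := Primrec.fst.comp (Primrec.snd.comp hw')
    have hw3 := Primrec.snd.comp (Primrec.snd.comp hw')
    have heq := Primrec.eq.comp hl0 hl1
    refine PrimrecPred.or (heq.and (Primrec.eq.comp hw3 (Primrec.const 5)))
      (heq.not.and (PrimrecPred.and ?_ (PrimrecPred.and ?_ (PrimrecPred.and ?_ ?_))))
    · exact primrecPred_locates u Primrec.fst hw0 he hw1 hl0
    · exact primrecPred_locates u Primrec.fst hw0 he hw2 hl1
    · exact (Primrec.eq.comp hw3 (Primrec.const 3)).or (Primrec.eq.comp hw3 (Primrec.const 5))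
    · exact Primrec.eq.comp (Primrec.option_isSome.comp (primrec_evalApprox Primrec.fst hw0
        (Primrec.const r) (Primrec.encode.comp ((Primrec.encode.comp (he.pair hw')).pair
          (Primrec.const _))))) (Primrec.const true)
  obtain ⟨s, hs⟩ := exists_search_total (jump^[n] X) hR (v := fun w => if w.2.2.2 = 3 then 1 else 0)
    (Primrec.ite (Primrec.eq.comp (Primrec.snd.comp (Primrec.snd.comp Primrec.snd))
      (Primrec.const 3)) (Primrec.const 1) (Primrec.const 0))
  obtain ⟨h, hh, hsmn⟩ := exists_smn s
  refine ⟨h, hh, fun V G e => ?_⟩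
  rintro ⟨ν, hinj, hlow, hdec⟩
  let P : ℕ → Prop := fun m => m ∈ Set.range fun u : V => ν (Sum.inl u)
  have hP : ∀ m, P m ↔ m ∈ Set.range fun u : V => ν (Sum.inl u) := fun _ => Iff.rfl
  have hinl : Function.Injective fun u : V => ν (Sum.inl u) := fun u v huv => by
    simpa using hinj huv
  refine ⟨fun u => Nat.count P (ν (Sum.inl u)), count_comp_injective hinl hP,
    isLowerSet_range_count hP, ?_⟩
  intro k R v
  obtain ⟨rfl⟩ : k = 2 := by cases R; rfl
  rw [atomCode_graph, hsmn]
  have hval : atomValue G.structure R v = if G.Adj (v 0) (v 1) then 1 else 0 := by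
    refine atomValue_of ?_
    cases R
    rfl
  rw [hval]
  -- Without two distinct vertices the copy may be finite, and `e` is then unconstrained outside its
  -- universe.
  have hU : v 0 ≠ v 1 → ∀ j, Phi X e (Nat.pair 1 (encode [j])) =
      Part.some (if P j then 1 else 0) := fun hne j => by
    obtain ⟨z, rfl⟩ : j ∈ Set.range ν :=
      range_eq_univ_of_not_isDiag hinj hlow (p := s(v 0, v 1)) hne ▸ Set.mem_univ j
    have := hdec 1 (Sum.inr .U) ![z]
    rw [atomCode_U] at this
    refine this.trans (congrArg Part.some (atomValue_of ?_))
    have hmk : (jumpInversion A B G).RelMap (Sum.inr MarkRel.U) ![z] ↔ ∃ u : V, z = Sum.inl u :=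
      Iff.rfl
    rw [hmk]
    exact ⟨fun ⟨u, hu⟩ => ⟨u, by rw [hu]⟩, fun ⟨u, hu⟩ => ⟨u, (hinj hu).symm⟩⟩
  have hpiece : ∀ hne : v 0 ≠ v 1, ∀ c, (Phi (jump^[n] X) r (encode (encode (e, ν (Sum.inl (v 0)),
      ν (Sum.inl (v 1)), (bif c then 3 else 5 : ℕ)), cφ, ([] : List ℕ)))).Dom ↔
        (G.Adj (v 0) (v 1) ↔ c = true) := fun hne c => by
    rw [hr (had e ν hinj hlow hdec (v 0) (v 1) hne c) φ cφ hcφ, holds_piece_iff hA hB]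
  refine hs (e, 0, [_, _]) _ ?_ ?_
  · rintro k' ⟨w, mi, mj, mk⟩ hw
    dsimp only [List.getD_cons_zero, List.getD_cons_succ, Function.comp_apply] at hw ⊢
    rcases hw with ⟨h1, rfl⟩ | ⟨h1, h2, h3, h4, h5⟩
    · have : v 0 = v 1 := count_comp_injective hinl hP h1
      simp [this]
    · have hne : v 0 ≠ v 1 := fun h => h1 (by rw [h]; rfl)
      obtain ⟨h2, h2'⟩ := h2.sound hu (hU hne)
      obtain ⟨h3, h3'⟩ := h3.sound hu (hU hne)
      obtain rfl := Nat.count_injective h2 ((hP _).2 ⟨_, rfl⟩) h2'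
      obtain rfl := Nat.count_injective h3 ((hP _).2 ⟨_, rfl⟩) h3'
      obtain ⟨y, hy⟩ := Option.isSome_iff_exists.1 h5
      have hdom := Part.dom_iff_mem.2 ⟨y, evalApprox_sound hy⟩
      rcases h4 with rfl | rfl
      · rw [if_pos rfl, if_pos (((hpiece hne true).1 hdom).2 rfl)]
      · rw [if_neg (by decide),
          if_neg fun h => Bool.false_ne_true (((hpiece hne false).1 hdom).1 h)]
  · by_cases hne : v 0 = v 1
    · exact ⟨0, (0, 0, 0, 5), Or.inl ⟨by simp [hne], rfl⟩⟩
    · have h1 := Locates.complete hu (hU hne) ((hP _).2 ⟨v 0, rfl⟩)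
      have h2 := Locates.complete hu (hU hne) ((hP _).2 ⟨v 1, rfl⟩)
      have hdom := (hpiece hne (decide (G.Adj (v 0) (v 1)))).2 (by simp)
      obtain ⟨y, hy⟩ := Part.dom_iff_mem.1 hdom
      obtain ⟨k', h1, h2, h3⟩ := (h1.and (h2.and (evalApprox_complete hy))).exists
      obtain ⟨w, h1, h2, h3⟩ := (h1.and (h2.and h3)).exists
      refine ⟨k', (w, ν (Sum.inl (v 0)), ν (Sum.inl (v 1)),
        (bif decide (G.Adj (v 0) (v 1)) then 3 else 5)), Or.inr ⟨?_, h1, h2, ?_, ?_⟩⟩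
      · exact fun h => hne (count_comp_injective hinl hP h)
      · cases decide (G.Adj (v 0) (v 1)) <;> simp
      · exact Option.isSome_iff_exists.2 ⟨y, h3⟩

end GraphOfCopy

/-! ## A copy of the jump inversion of a graph

The element `2 * u` stands for the vertex `u`, and `2 * ⟨i, j, c, a⟩ + 1` stands for the element
`a` of the piece attached to the vertices `i < j`; the piece is of type `C` if `c = 1` and of type
`D` if `c = 0`. -/

/-- The smaller vertex of the piece of an element. -/
def pieceFst (z : ℕ) : ℕ := (z / 2).unpair.1

/-- The larger vertex of the piece of an element. -/
def pieceSnd (z : ℕ) : ℕ := (z / 2).unpair.2.unpair.1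

/-- The type of the piece of an element. -/
def pieceType (z : ℕ) : ℕ := (z / 2).unpair.2.unpair.2.unpair.1

/-- The position of an element in its piece. -/
def pieceOffset (z : ℕ) : ℕ := (z / 2).unpair.2.unpair.2.unpair.2

theorem primrec_half : Primrec fun z : ℕ => z / 2 :=
  Primrec.nat_div.comp Primrec.id (Primrec.const 2)

theorem primrec_parity : Primrec fun z : ℕ => z % 2 :=
  Primrec.nat_mod.comp Primrec.id (Primrec.const 2)

theorem primrec_unpair_fst : Primrec fun z : ℕ => z.unpair.1 := Primrec.fst.comp Primrec.unpair

theorem primrec_unpair_snd : Primrec fun z : ℕ => z.unpair.2 := Primrec.snd.comp Primrec.unpair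

theorem primrec_pieceFst : Primrec pieceFst := primrec_unpair_fst.comp primrec_half

theorem primrec_pieceSnd : Primrec pieceSnd :=
  primrec_unpair_fst.comp (primrec_unpair_snd.comp primrec_half)

theorem primrec_pieceType : Primrec pieceType :=
  primrec_unpair_fst.comp (primrec_unpair_snd.comp (primrec_unpair_snd.comp primrec_half))

theorem primrec_pieceOffset : Primrec pieceOffset :=
  primrec_unpair_snd.comp (primrec_unpair_snd.comp (primrec_unpair_snd.comp primrec_half))

/-- The numbers that stand for an element, if there are `s` vertices. -/
def IsElementCode (s : ℕ∞) (z : ℕ) : Prop :=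
  (z % 2 = 0 ∧ ((z / 2 : ℕ) : ℕ∞) < s) ∨
    (¬ z % 2 = 0 ∧ pieceFst z < pieceSnd z ∧ (pieceSnd z : ℕ∞) < s ∧ pieceType z < 2)

theorem primrecPred_natCast_lt (s : ℕ∞) : PrimrecPred fun m : ℕ => (m : ℕ∞) < s := by
  induction s using ENat.recTopCoe with
  | top => exact (Primrec.eq.comp Primrec.id Primrec.id).of_eq fun m => by simp
  | coe k => exact (Primrec.nat_lt.comp Primrec.id (Primrec.const k)).of_eq fun m => by simp

theorem primrecPred_isElementCode (s : ℕ∞) : PrimrecPred (IsElementCode s) := by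
  have hlt := primrecPred_natCast_lt s
  have h0 := Primrec.eq.comp primrec_parity (Primrec.const 0)
  exact (h0.and (hlt.comp primrec_half)).or (h0.not.and
    ((Primrec.nat_lt.comp primrec_pieceFst primrec_pieceSnd).and
      ((hlt.comp primrec_pieceSnd).and (Primrec.nat_lt.comp primrec_pieceType (Primrec.const 2)))))

open Classical in
theorem primrec_count {p : ℕ → Prop} (hp : PrimrecPred p) : Primrec fun n => Nat.count p n :=
  (Primrec.list_length.comp ((Primrec.listFilter hp).comp Primrec.list_range)).of_eq fun n => by
    rw [Nat.count, List.countP_eq_length_filter]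

/-- The listed elements lie in one piece. -/
def SamePiece (l : List ℕ) : Prop :=
  ∀ z ∈ l, ¬ z % 2 = 0 ∧ pieceFst z = pieceFst (l.getD 0 0) ∧
    pieceSnd z = pieceSnd (l.getD 0 0) ∧ pieceType z = pieceType (l.getD 0 0)

theorem primrecPred_samePiece : PrimrecPred SamePiece := by
  have hh : Primrec fun l : List ℕ => l.getD 0 0 :=
    (Primrec.list_getD 0).comp Primrec.id (Primrec.const 0)
  have : PrimrecRel fun (z : ℕ) (l : List ℕ) => ¬ z % 2 = 0 ∧
      pieceFst z = pieceFst (l.getD 0 0) ∧ pieceSnd z = pieceSnd (l.getD 0 0) ∧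
      pieceType z = pieceType (l.getD 0 0) := by
    refine PrimrecPred.and ?_ (PrimrecPred.and ?_ (PrimrecPred.and ?_ ?_))
    · exact (Primrec.eq.comp (primrec_parity.comp Primrec.fst) (Primrec.const 0)).not
    · exact Primrec.eq.comp (primrec_pieceFst.comp Primrec.fst)
        (primrec_pieceFst.comp (hh.comp Primrec.snd))
    · exact Primrec.eq.comp (primrec_pieceSnd.comp Primrec.fst)
        (primrec_pieceSnd.comp (hh.comp Primrec.snd))
    · exact Primrec.eq.comp (primrec_pieceType.comp Primrec.fst)
        (primrec_pieceType.comp (hh.comp Primrec.snd))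
  exact this.forall_mem_list.comp Primrec.id Primrec.id

/-- The relation `U`, `E` or `F` with the given number holds of the listed elements. -/
def MarkCode (rc : ℕ) (l : List ℕ) : Prop :=
  (rc = 1 ∧ l.getD 0 0 % 2 = 0) ∨
    (l.getD 0 0 % 2 = 0 ∧ l.getD 1 0 % 2 = 0 ∧ ¬ l.getD 2 0 % 2 = 0 ∧
      pieceFst (l.getD 2 0) = min (l.getD 0 0 / 2) (l.getD 1 0 / 2) ∧
      pieceSnd (l.getD 2 0) = max (l.getD 0 0 / 2) (l.getD 1 0 / 2) ∧
      ((rc = 3 ∧ pieceType (l.getD 2 0) = 1) ∨ (rc = 5 ∧ pieceType (l.getD 2 0) = 0)))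

theorem primrecRel_markCode : PrimrecRel MarkCode := by
  have hl : ∀ i, Primrec fun p : ℕ × List ℕ => p.2.getD i 0 := fun i =>
    (Primrec.list_getD 0).comp Primrec.snd (Primrec.const i)
  have hev : ∀ i, PrimrecPred fun p : ℕ × List ℕ => p.2.getD i 0 % 2 = 0 := fun i =>
    Primrec.eq.comp (primrec_parity.comp (hl i)) (Primrec.const 0)
  have hhf : ∀ i, Primrec fun p : ℕ × List ℕ => p.2.getD i 0 / 2 := fun i =>
    primrec_half.comp (hl i)
  have hrc : ∀ i, PrimrecPred fun p : ℕ × List ℕ => p.1 = i := fun i =>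
    Primrec.eq.comp Primrec.fst (Primrec.const i)
  have hty : ∀ i, PrimrecPred fun p : ℕ × List ℕ => pieceType (p.2.getD 2 0) = i := fun i =>
    Primrec.eq.comp (primrec_pieceType.comp (hl 2)) (Primrec.const i)
  refine PrimrecPred.or ((hrc 1).and (hev 0)) ((hev 0).and ((hev 1).and ((hev 2).not.and
    (PrimrecPred.and ?_ (PrimrecPred.and ?_
      (((hrc 3).and (hty 1)).or ((hrc 5).and (hty 0))))))))
  · exact Primrec.eq.comp (primrec_pieceFst.comp (hl 2)) (Primrec.nat_min.comp (hhf 0) (hhf 1))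
  · exact Primrec.eq.comp (primrec_pieceSnd.comp (hl 2)) (Primrec.nat_max.comp (hhf 0) (hhf 1))

/-! ### Correctness of the numbering of elements. -/

section Naming

variable {V : Type} (νG : V → ℕ) (ι : {p : Sym2 V // ¬ p.IsDiag} → Bool → ℕ ≃ ℕ)

/-- The number that stands for an element of the jump inversion, if the vertices are numbered by
`νG`, and the pieces are numbered by `ι`. -/
def elementCode : InvUniverse V → ℕ
  | Sum.inl u => 2 * νG u
  | Sum.inr (p, c, a) =>
    2 * Nat.pair (p.1.map νG).inf (Nat.pair (p.1.map νG).sup (Nat.pair c.toNat (ι p c a))) + 1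

variable {νG} {ι}

theorem elementCode_inl_half (u : V) : elementCode νG ι (Sum.inl u) / 2 = νG u := by
  simp [elementCode]

theorem elementCode_inl_mod (u : V) : elementCode νG ι (Sum.inl u) % 2 = 0 := by
  simp [elementCode]

section Inr

variable (p : {p : Sym2 V // ¬ p.IsDiag}) (c : Bool) (a : ℕ)

theorem elementCode_inr_mod : ¬ elementCode νG ι (Sum.inr (p, c, a)) % 2 = 0 := by
  simp only [elementCode]
  omega

theorem elementCode_inr_half : elementCode νG ι (Sum.inr (p, c, a)) / 2 =
    Nat.pair (p.1.map νG).inf (Nat.pair (p.1.map νG).sup (Nat.pair c.toNat (ι p c a))) := by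
  simp only [elementCode]
  omega

theorem pieceFst_elementCode :
    pieceFst (elementCode νG ι (Sum.inr (p, c, a))) = (p.1.map νG).inf := by
  rw [pieceFst, elementCode_inr_half]
  simp

theorem pieceSnd_elementCode :
    pieceSnd (elementCode νG ι (Sum.inr (p, c, a))) = (p.1.map νG).sup := by
  rw [pieceSnd, elementCode_inr_half]
  simp

theorem pieceType_elementCode :
    pieceType (elementCode νG ι (Sum.inr (p, c, a))) = c.toNat := by
  rw [pieceType, elementCode_inr_half]
  simp

theorem pieceOffset_elementCode :
    pieceOffset (elementCode νG ι (Sum.inr (p, c, a))) = ι p c a := by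
  rw [pieceOffset, elementCode_inr_half]
  simp

end Inr

/-- An unordered pair of numbers is determined by its minimum and maximum, and the vertices are
numbered injectively. -/
theorem eq_of_piece_eq (hν : Function.Injective νG) {p q : {p : Sym2 V // ¬ p.IsDiag}}
    {c d : Bool} (h1 : (p.1.map νG).inf = (q.1.map νG).inf)
    (h2 : (p.1.map νG).sup = (q.1.map νG).sup) (h3 : c.toNat = d.toNat) : p = q ∧ c = d := by
  refine ⟨Subtype.ext (Sym2.map.injective hν (Sym2.inf_eq_inf_and_sup_eq_sup.1 ⟨h1, h2⟩)), ?_⟩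
  cases c <;> cases d <;> simp_all

theorem elementCode_injective (hν : Function.Injective νG) :
    Function.Injective (elementCode νG ι) := by
  rintro (u | ⟨p, c, a⟩) (v | ⟨q, d, b⟩) h
  · have := congrArg (· / 2) h
    simp only [elementCode_inl_half] at this
    rw [hν this]
  · exact absurd (h ▸ elementCode_inl_mod u) (elementCode_inr_mod q d b)
  · exact absurd (h ▸ elementCode_inl_mod v) (elementCode_inr_mod p c a)
  · have h1 := congrArg pieceFst h
    have h2 := congrArg pieceSnd h
    have h3 := congrArg pieceType h
    have h4 := congrArg pieceOffset h
    rw [pieceFst_elementCode, pieceFst_elementCode] at h1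
    rw [pieceSnd_elementCode, pieceSnd_elementCode] at h2
    rw [pieceType_elementCode, pieceType_elementCode] at h3
    rw [pieceOffset_elementCode, pieceOffset_elementCode] at h4
    obtain ⟨rfl, rfl⟩ := eq_of_piece_eq hν h1 h2 h3
    rw [(ι p c).injective h4]

/-- The numbers of vertices are those below `s`, so the codes of elements form a decidable set. This
is where the program depends on the number of vertices. -/
theorem isElementCode_iff (hν : Function.Injective νG) {s : ℕ∞}
    (hs : ∀ m : ℕ, m ∈ Set.range νG ↔ (m : ℕ∞) < s) (z : ℕ) :
    IsElementCode s z ↔ z ∈ Set.range (elementCode νG ι) := by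
  constructor
  · rintro (⟨h0, h⟩ | ⟨h0, h1, h2, h3⟩)
    · obtain ⟨u, hu⟩ := (hs _).2 h
      exact ⟨Sum.inl u, by rw [elementCode, hu]; omega⟩
    · obtain ⟨v, hv⟩ := (hs _).2 h2
      obtain ⟨u, hu⟩ := (hs _).2 ((Nat.cast_lt.2 h1).trans h2)
      have huv : ¬ (s(u, v)).IsDiag := fun h => by
        rw [Sym2.mk_isDiag_iff] at h
        subst h
        omega
      obtain ⟨c, hc⟩ : ∃ c : Bool, c.toNat = pieceType z := by
        interval_cases h : pieceType z
        · exact ⟨false, rfl⟩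
        · exact ⟨true, rfl⟩
      refine ⟨Sum.inr (⟨s(u, v), huv⟩, c, (ι ⟨s(u, v), huv⟩ c).symm (pieceOffset z)), ?_⟩
      rw [elementCode, Equiv.apply_symm_apply, hc, Sym2.map_mk, Sym2.inf_mk, Sym2.sup_mk, hu, hv,
        min_eq_left h1.le, max_eq_right h1.le]
      have : Nat.pair (pieceFst z) (Nat.pair (pieceSnd z) (Nat.pair (pieceType z)
        (pieceOffset z))) = z / 2 := by
        simp [pieceFst, pieceSnd, pieceType, pieceOffset]
      rw [this]
      omega
  · rintro ⟨u | ⟨⟨p, hp⟩, c, a⟩, rfl⟩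
    · exact Or.inl ⟨elementCode_inl_mod u, by
        rw [elementCode_inl_half]; exact (hs _).1 ⟨u, rfl⟩⟩
    · refine Or.inr ⟨elementCode_inr_mod _ c a, ?_⟩
      rw [pieceFst_elementCode, pieceSnd_elementCode, pieceType_elementCode]
      induction p with
      | h u v =>
        have hne : νG u ≠ νG v := fun h => hp (hν h)
        refine ⟨?_, ?_, by cases c <;> decide⟩
        · simpa using hne.symm
        · rw [Sym2.map_mk, Sym2.sup_mk]
          rcases max_choice (νG u) (νG v) with h | h <;> rw [h] <;> exact (hs _).1 ⟨_, rfl⟩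

theorem samePiece_elementCode (hν : Function.Injective νG) {k : ℕ} (hk : 0 < k)
    (x : Fin k → InvUniverse V) :
    SamePiece (List.ofFn (elementCode νG ι ∘ x)) ↔
      ∃ (p : {p : Sym2 V // ¬ p.IsDiag}) (c : Bool) (a : Fin k → ℕ),
        x = fun i => Sum.inr (p, c, a i) := by
  have h0 : (List.ofFn (elementCode νG ι ∘ x)).getD 0 0 = elementCode νG ι (x ⟨0, hk⟩) := by
    simp [List.getD, hk]
  rw [SamePiece, h0]
  simp only [List.forall_mem_ofFn_iff, Function.comp_apply]
  constructor
  · intro h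
    have hinr : ∀ i, ∃ t, x i = Sum.inr t := fun i => by
      cases hx : x i with
      | inl u =>
        have := (h i).1
        rw [hx] at this
        exact absurd (elementCode_inl_mod u) this
      | inr t => exact ⟨t, rfl⟩
    choose t ht using hinr
    refine ⟨(t ⟨0, hk⟩).1, (t ⟨0, hk⟩).2.1, fun i => (t i).2.2, funext fun i => ?_⟩
    obtain ⟨-, h1, h2, h3⟩ := h i
    rw [ht i, ht ⟨0, hk⟩] at h1 h2 h3
    rw [pieceFst_elementCode, pieceFst_elementCode] at h1
    rw [pieceSnd_elementCode, pieceSnd_elementCode] at h2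
    rw [pieceType_elementCode, pieceType_elementCode] at h3
    obtain ⟨h4, h5⟩ := eq_of_piece_eq hν h1 h2 h3
    rw [ht i, ← h4, ← h5]
  · rintro ⟨p, c, a, rfl⟩ i
    refine ⟨elementCode_inr_mod p c _, ?_, ?_, ?_⟩
    · rw [pieceFst_elementCode, pieceFst_elementCode]
    · rw [pieceSnd_elementCode, pieceSnd_elementCode]
    · rw [pieceType_elementCode, pieceType_elementCode]

theorem markCode_U (x : Fin 1 → InvUniverse V) :
    MarkCode 1 (List.ofFn (elementCode νG ι ∘ x)) ↔ markHolds .U x := by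
  have h0 : (List.ofFn (elementCode νG ι ∘ x)).getD 0 0 = elementCode νG ι (x 0) := by
    simp [List.getD]
  rw [MarkCode, h0]
  simp only [OfNat.one_ne_ofNat, false_and, or_self, and_false, or_false, true_and, markHolds]
  cases hx : x 0 with
  | inl u => simp [elementCode_inl_mod]
  | inr t =>
    obtain ⟨p, c, a⟩ := t
    simp [elementCode_inr_mod]

theorem markCode_pieceMark (hν : Function.Injective νG) (c : Bool) (x : Fin 3 → InvUniverse V) :
    MarkCode (bif c then 3 else 5) (List.ofFn (elementCode νG ι ∘ x)) ↔
      markHolds (pieceMark c) x := by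
  have h0 : (List.ofFn (elementCode νG ι ∘ x)).getD 0 0 = elementCode νG ι (x 0) := by
    simp [List.getD]
  have h1 : (List.ofFn (elementCode νG ι ∘ x)).getD 1 0 = elementCode νG ι (x 1) := by
    simp [List.getD]
  have h2 : (List.ofFn (elementCode νG ι ∘ x)).getD 2 0 = elementCode νG ι (x 2) := by
    simp [List.getD]
  rw [markHolds_pieceMark, MarkCode, h0, h1, h2]
  have hne : (bif c then 3 else 5 : ℕ) ≠ 1 := by cases c <;> decide
  simp only [hne, false_and, false_or]
  constructor
  · rintro ⟨h0, h1, h2, h3, h4, h5⟩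
    cases hx0 : x 0 with
    | inr t => rw [hx0] at h0; exact absurd h0 (elementCode_inr_mod _ _ _)
    | inl u =>
    cases hx1 : x 1 with
    | inr t => rw [hx1] at h1; exact absurd h1 (elementCode_inr_mod _ _ _)
    | inl v =>
    cases hx2 : x 2 with
    | inl w => rw [hx2] at h2; exact absurd (elementCode_inl_mod w) h2
    | inr t =>
    obtain ⟨⟨p, hp⟩, d, a⟩ := t
    rw [hx0, hx1, hx2, pieceFst_elementCode, elementCode_inl_half, elementCode_inl_half] at h3
    rw [hx0, hx1, hx2, pieceSnd_elementCode, elementCode_inl_half, elementCode_inl_half] at h4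
    rw [hx2, pieceType_elementCode] at h5
    have hpuv : p = s(u, v) := Sym2.map.injective hν
      (Sym2.inf_eq_inf_and_sup_eq_sup.1 ⟨h3, h4⟩)
    obtain rfl : d = c := by cases c <;> cases d <;> simp_all
    subst hpuv
    exact ⟨u, v, hp, a, rfl, rfl, rfl⟩
  · rintro ⟨u, v, h, a, hx0, hx1, hx2⟩
    rw [hx0, hx1, hx2, pieceFst_elementCode, pieceSnd_elementCode, pieceType_elementCode,
      elementCode_inl_half, elementCode_inl_half]
    refine ⟨elementCode_inl_mod u, elementCode_inl_mod v, elementCode_inr_mod _ _ _, rfl, rfl, ?_⟩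
    cases c <;> simp

end Naming

/-- A complete set answers membership questions about values of functions computable in the
corresponding jump. -/
theorem exists_reduction {k : ℕ} {S : Set ℕ} (hS : IsCompleteSigmaSucc k S) :
    ∃ f : ℕ → ℕ, Computable f ∧ ∀ e i j c : ℕ, f (encode (e, i, j, c)) ∈ S ↔
      c ∈ Phi (zeroJump k) e (Nat.pair 0 (encode [i, j])) := by
  have hR : PrimrecPred fun p : List ℕ × ℕ × ℕ × ℕ × ℕ × ℕ =>
      evalApprox p.1 p.2.1 p.2.2.1 (Nat.pair 0 (encode [p.2.2.2.1, p.2.2.2.2.1])) =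
        some p.2.2.2.2.2 := by
    have hi : Primrec fun p : List ℕ × ℕ × ℕ × ℕ × ℕ × ℕ => p.2.2 :=
      Primrec.snd.comp Primrec.snd
    have hi2 := Primrec.snd.comp hi
    have hi3 := Primrec.snd.comp hi2
    exact Primrec.eq.comp (primrec_evalApprox Primrec.fst (Primrec.fst.comp Primrec.snd)
      (Primrec.fst.comp hi) (Primrec₂.natPair.comp (Primrec.const 0) (Primrec.encode.comp
        (Primrec.list_cons.comp (Primrec.fst.comp hi2) (Primrec.list_cons.comp
          (Primrec.fst.comp hi3) (Primrec.const []))))))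
      (Primrec.option_some.comp (Primrec.snd.comp hi3))
  obtain ⟨r, hr⟩ := exists_search_pred (zeroJump k) hR (v := fun _ => 0) (Primrec.const 0)
  -- That a computation has the output `c` is a halting statement for every `c`, so no complement of
  -- `S` is needed to treat the two pieces alike.
  obtain ⟨f, hf, hf'⟩ := hS.2 {x | (Phi (zeroJump k) r x).Dom} ⟨r, fun x => Iff.rfl⟩
  refine ⟨f, hf, fun e i j c => (hf' _).symm.trans ⟨fun h => ?_, fun h => ?_⟩⟩
  · obtain ⟨k', w, h, -⟩ := (hr (e, i, j, c)).1 _ (Part.get_mem h)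
    exact evalApprox_sound h
  · obtain ⟨k', hk⟩ := (evalApprox_complete h).exists
    obtain ⟨w, hw⟩ := hk.exists
    exact (hr (e, i, j, c)).2 ⟨k', w, hw⟩

theorem mem_range_iff_lt_card {V : Type} {ν : V → ℕ} (hinj : Function.Injective ν)
    (hlow : IsLowerSet (Set.range ν)) {s : ℕ∞} (hs : ENat.card V = s) (m : ℕ) :
    m ∈ Set.range ν ↔ (m : ℕ∞) < s := by
  have hc : (Set.range ν).encard = s := by
    rw [← Set.image_univ, hinj.encard_image, Set.encard_univ, hs]
  rcases hlow.eq_univ_or_Iio with h | ⟨a, h⟩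
  · rw [h] at hc ⊢
    rw [← hc]
    simp
  · rw [h] at hc ⊢
    rw [← hc]
    simp [Set.encard_eq_coe_toFinset_card]

/-! ### Isomorphisms of relational structures as bijections. -/

section Isomorphic

variable {L : FirstOrder.Language.{0, 0}} {M N : Type} {S : L.Structure M} {T : L.Structure N}

theorem Isomorphic.exists_equiv (h : Isomorphic S T) :
    ∃ g : M ≃ N, ∀ {k : ℕ} (R : L.Relations k) (x : Fin k → M),
      T.RelMap R (g ∘ x) ↔ S.RelMap R x :=
  h.elim fun f => ⟨f.toEquiv, fun R x => f.map_rel' R x⟩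

theorem isomorphic_of_equiv [L.IsRelational] (g : M ≃ N)
    (hg : ∀ {k : ℕ} (R : L.Relations k) (x : Fin k → M),
      T.RelMap R (g ∘ x) ↔ S.RelMap R x) : Isomorphic S T :=
  ⟨{ toEquiv := g, map_fun' := fun f => isEmptyElim f, map_rel' := fun R x => hg R x }⟩

theorem Isomorphic.symm (h : Isomorphic S T) : Isomorphic T S :=
  h.elim fun f => ⟨@FirstOrder.Language.Equiv.symm L M N S T f⟩

end Isomorphic

/-! ### The computable copy of the jump inversion. -/

section CopyOfGraph

variable {L : FirstOrder.Language.{0, 0}} [Encodable (Σ k, L.Relations k)]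
variable [L.IsRelational] [IsEmpty (L.Relations 0)]

open Classical in
/-- The witness `p.2.1` consists of a bound on the number of steps, the codes of elements, the index
of a piece, and a truth value. It verifies that the atomic statement `p.2.2.2` has this truth value
in the copy of the jump inversion obtained from the copy with index `p.2.2.1` of the graph. -/
def CopyWitness (s : ℕ∞) (ef eC : ℕ) (p : List ℕ × (ℕ × List ℕ × ℕ × ℕ) × ℕ × ℕ × List ℕ) : Prop :=
  ((∀ z ∈ p.2.1.2.1, IsElementCode s z) ∧
    p.2.1.2.1.map (Nat.count (IsElementCode s)) = p.2.2.2.2) ∧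
  ((¬ p.2.2.2.1 % 2 = 0 ∧ MarkCode p.2.2.2.1 p.2.1.2.1 ∧ p.2.1.2.2.2 = 1) ∨
    (¬ p.2.2.2.1 % 2 = 0 ∧ ¬ MarkCode p.2.2.2.1 p.2.1.2.1 ∧ p.2.1.2.2.2 = 0) ∨
    (p.2.2.2.1 % 2 = 0 ∧ ¬ SamePiece p.2.1.2.1 ∧ p.2.1.2.2.2 = 0) ∨
    (p.2.2.2.1 % 2 = 0 ∧ SamePiece p.2.1.2.1 ∧
      evalApprox p.1 p.2.1.1 ef (encode (p.2.2.1, pieceFst (p.2.1.2.1.getD 0 0),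
        pieceSnd (p.2.1.2.1.getD 0 0), pieceType (p.2.1.2.1.getD 0 0))) = some p.2.1.2.2.1 ∧
      evalApprox p.1 p.2.1.1 eC (Nat.pair p.2.1.2.2.1 (Nat.pair (p.2.2.2.1 / 2)
        (encode (p.2.1.2.1.map pieceOffset)))) = some p.2.1.2.2.2))

open Classical in
theorem primrecPred_copyWitness (s : ℕ∞) (ef eC : ℕ) : PrimrecPred (CopyWitness s ef eC) := by
  have hw : Primrec fun p : List ℕ × (ℕ × List ℕ × ℕ × ℕ) × ℕ × ℕ × List ℕ => p.2.1 :=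
    Primrec.fst.comp Primrec.snd
  have hi : Primrec fun p : List ℕ × (ℕ × List ℕ × ℕ × ℕ) × ℕ × ℕ × List ℕ => p.2.2 :=
    Primrec.snd.comp Primrec.snd
  have hw0 := Primrec.fst.comp hw
  have hzs := Primrec.fst.comp (Primrec.snd.comp hw)
  have hg := Primrec.fst.comp (Primrec.snd.comp (Primrec.snd.comp hw))
  have hy := Primrec.snd.comp (Primrec.snd.comp (Primrec.snd.comp hw))
  have he := Primrec.fst.comp hi
  have hrc := Primrec.fst.comp (Primrec.snd.comp hi)
  have hl := Primrec.snd.comp (Primrec.snd.comp hi)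
  have hz0 := (Primrec.list_getD 0).comp hzs (Primrec.const 0)
  have hpar := Primrec.eq.comp (primrec_parity.comp hrc) (Primrec.const 0)
  have hmk := primrecRel_markCode.comp hrc hzs
  have hsm := primrecPred_samePiece.comp hzs
  have hcode := primrecPred_isElementCode s
  refine PrimrecPred.and (PrimrecPred.and (hcode.forall_mem_list.comp hzs) ?_)
    ((hpar.not.and (hmk.and (Primrec.eq.comp hy (Primrec.const 1)))).or
      ((hpar.not.and (hmk.not.and (Primrec.eq.comp hy (Primrec.const 0)))).or
        ((hpar.and (hsm.not.and (Primrec.eq.comp hy (Primrec.const 0)))).or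
          (hpar.and (hsm.and (PrimrecPred.and ?_ ?_))))))
  · exact Primrec.eq.comp (Primrec.list_map hzs ((primrec_count hcode).comp Primrec.snd)) hl
  · exact Primrec.eq.comp (primrec_evalApprox Primrec.fst hw0 (Primrec.const _)
      (Primrec.encode.comp (he.pair ((primrec_pieceFst.comp hz0).pair
        ((primrec_pieceSnd.comp hz0).pair (primrec_pieceType.comp hz0))))))
      (Primrec.option_some.comp hg)
  · exact Primrec.eq.comp (primrec_evalApprox Primrec.fst hw0 (Primrec.const _)
      (Primrec₂.natPair.comp hg (Primrec₂.natPair.comp (primrec_half.comp hrc)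
        (Primrec.encode.comp (Primrec.list_map hzs (primrec_pieceOffset.comp Primrec.snd))))))
      (Primrec.option_some.comp hy)

/-- On the piece of type `c` attached to the vertices `i < j` the program places `C (f (e, i, j,
c))`. It never learns whether `i` and `j` are adjacent; that information is passed through `S` into
the isomorphism type. -/
theorem exists_copy_of_graph {k : ℕ} {S : Set ℕ} (hS : IsCompleteSigmaSucc k S)
    {A B : L.Structure ℕ} {C : ℕ → L.Structure ℕ} (hC : IsComputableSequence C)
    (hCA : ∀ i, i ∈ S → Isomorphic (C i) A) (hCB : ∀ i, i ∉ S → Isomorphic (C i) B) (s : ℕ∞) :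
    ∃ h : ℕ → ℕ, Computable h ∧ ∀ (V : Type) (G : SimpleGraph V), ENat.card V = s → ∀ e : ℕ,
      IsCopyIndex (zeroJump k) e G.structure → IsCopyIndex ∅ (h e) (jumpInversion A B G) := by
  classical
  obtain ⟨f, hf, hfS⟩ := exists_reduction hS
  obtain ⟨ef, hef⟩ := (exists_Phi_eq_iff ∅ _).2 (TotalIn.of_computable (X := ∅) hf)
  obtain ⟨eC, heC⟩ := hC
  obtain ⟨r, hr⟩ := exists_search_total ∅ (primrecPred_copyWitness s ef eC) (v := fun w => w.2.2.2)
    (Primrec.snd.comp (Primrec.snd.comp Primrec.snd))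
  obtain ⟨h, hh, hsmn⟩ := exists_smn r
  refine ⟨h, hh, fun V G hcard e => ?_⟩
  rintro ⟨νG, hinj, hlow, hdec⟩
  have hs := mem_range_iff_lt_card hinj hlow hcard
  -- the structure on a piece of the copy
  let idx : {p : Sym2 V // ¬ p.IsDiag} → Bool → ℕ := fun p c =>
    f (encode (e, (p.1.map νG).inf, (p.1.map νG).sup, c.toNat))
  have hadj : ∀ u v : V, Phi (zeroJump k) e (Nat.pair 0 (encode [νG u, νG v])) =
      Part.some (if G.Adj u v then 1 else 0) := fun u v => by
    have := hdec 2 Language.adj ![u, v]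
    rw [atomCode_graph] at this
    exact this.trans (congrArg Part.some (atomValue_of Iff.rfl))
  -- The index of the graph is asked only about the smaller vertex followed by the larger one;
  -- symmetry of adjacency covers the other order.
  have hidx : ∀ p c, idx p c ∈ S ↔ (p.1 ∈ G.edgeSet ↔ c = true) := by
    rintro ⟨p, hp⟩ c
    induction p with
    | h u v =>
      have hmem : s(u, v) ∈ G.edgeSet ↔ G.Adj u v := SimpleGraph.mem_edgeSet G
      rw [hfS, hmem, Sym2.map_mk, Sym2.inf_mk, Sym2.sup_mk]
      rcases le_total (νG u) (νG v) with hle | hle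
      · rw [inf_eq_left.2 hle, sup_eq_right.2 hle, hadj, Part.mem_some_iff]
        cases c <;> by_cases hG : G.Adj u v <;> simp [hG]
      · rw [inf_eq_right.2 hle, sup_eq_left.2 hle, hadj, Part.mem_some_iff, G.adj_comm]
        cases c <;> by_cases hG : G.Adj u v <;> simp [hG]
  have hiso : ∀ p c, Isomorphic (piece A B G p.1 c) (C (idx p c)) := fun p c => by
    unfold piece
    split_ifs with hpc
    · exact (hCA _ ((hidx p c).2 hpc)).symm
    · exact (hCB _ fun hmem => hpc ((hidx p c).1 hmem)).symm
  -- These isomorphisms need not be computable: they enter only into the naming of the elements, and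
  -- the program works with the structures `C i` alone.
  choose ι hι using fun p c => show ∃ g : ℕ ≃ ℕ, ∀ {m : ℕ} (R : L.Relations m) (x : Fin m → ℕ),
      (C (idx p c)).RelMap R (g ∘ x) ↔ (piece A B G p.1 c).RelMap R x from
    (hiso p c).exists_equiv
  have hcode := fun z => isElementCode_iff (ι := ι) hinj hs z
  have hinj' := elementCode_injective (ι := ι) hinj
  refine ⟨fun x => Nat.count (IsElementCode s) (elementCode νG ι x),
    count_comp_injective hinj' hcode, isLowerSet_range_count hcode, ?_⟩
  intro m R x
  -- The elements of the copy are ranks of codes. Counting is injective on codes, so the list of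
  -- codes in a witness is forced.
  have hzs : ∀ zs : List ℕ, (∀ z ∈ zs, IsElementCode s z) →
      zs.map (Nat.count (IsElementCode s)) =
        List.ofFn ((fun x => Nat.count (IsElementCode s) (elementCode νG ι x)) ∘ x) →
      zs = List.ofFn (elementCode νG ι ∘ x) := fun zs h1 h2 => by
    have hlen : zs.length = m := by simpa using congrArg List.length h2
    refine List.ext_getElem (by simpa using hlen) fun i hi hi' => ?_
    have hi2 : i < m := hlen ▸ hi
    have := congrArg (fun l => l[i]?) h2
    simp only [List.getElem?_map, List.getElem?_eq_getElem hi, List.getElem?_ofFn, hi2, dite_true,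
      Option.map_some, Option.some_inj, Function.comp_apply] at this
    have := Nat.count_injective (h1 _ (List.getElem_mem hi)) ((hcode _).2 ⟨_, rfl⟩) this
    simpa using this
  have hmem : ∀ z ∈ List.ofFn (elementCode νG ι ∘ x), IsElementCode s z := by
    simp only [List.forall_mem_ofFn_iff, Function.comp_apply]
    exact fun i => (hcode _).2 ⟨_, rfl⟩
  have hmap : (List.ofFn (elementCode νG ι ∘ x)).map (Nat.count (IsElementCode s)) =
      List.ofFn ((fun x => Nat.count (IsElementCode s) (elementCode νG ι x)) ∘ x) := by
    rw [List.map_ofFn]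
    rfl
  rw [hsmn]
  generalize hl : List.ofFn ((fun x => Nat.count (IsElementCode s) (elementCode νG ι x)) ∘ x) = l
    at hzs hmap
  cases R with
  | inl R =>
    have hm : 0 < m := Nat.pos_of_ne_zero fun h0 => by subst h0; exact isEmptyElim R
    have hrc : (2 * encode (⟨m, R⟩ : Σ k, L.Relations k)) % 2 = 0 := by omega
    rw [atomCode_inl, hl]
    have hsame := samePiece_elementCode (ι := ι) hinj hm x
    by_cases hx : SamePiece (List.ofFn (elementCode νG ι ∘ x))
    · obtain ⟨p, c, a, rfl⟩ := hsame.1 hx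
      have h0 : (List.ofFn (elementCode νG ι ∘ fun i => Sum.inr (p, c, a i))).getD 0 0 =
          elementCode νG ι (Sum.inr (p, c, a ⟨0, hm⟩)) := by
        simp [List.getD, hm]
      have hoff : (List.ofFn (elementCode νG ι ∘ fun i => Sum.inr (p, c, a i))).map pieceOffset =
          List.ofFn (ι p c ∘ a) := by
        rw [List.map_ofFn]
        congr 1
        funext i
        exact pieceOffset_elementCode p c (a i)
      have hval : atomValue (jumpInversion A B G) (Sum.inl R) (fun i => Sum.inr (p, c, a i)) =
          atomValue (C (idx p c)) R (ι p c ∘ a) := by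
        refine atomValue_congr (Iff.trans ?_ (hι p c R a).symm)
        exact relMap_jumpInversion_inl R p c a
      have heC' := heC (idx p c) m R (ι p c ∘ a)
      rw [hval]
      refine hr (e, 2 * encode (⟨m, R⟩ : Σ k, L.Relations k), _) _ ?_ ?_
      · rintro k' ⟨w, zs, g, y⟩ ⟨⟨h1, h2⟩, h3⟩
        obtain rfl := hzs zs h1 h2
        rcases h3 with ⟨h3, -⟩ | ⟨h3, -⟩ | ⟨-, h3, -⟩ | ⟨-, -, h3, h4⟩
        · exact absurd (hrc) h3
        · exact absurd (hrc) h3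
        · exact absurd hx h3
        · dsimp only at h3 h4 ⊢
          rw [h0, pieceFst_elementCode, pieceSnd_elementCode, pieceType_elementCode] at h3
          have h3 := evalApprox_sound h3
          rw [hef, Part.mem_some_iff] at h3
          subst h3
          rw [hoff] at h4
          have h4 := evalApprox_sound h4
          simp only [Nat.mul_div_cancel_left _ (Nat.succ_pos 1)] at h4
          exact Part.mem_unique h4 (Part.eq_some_iff.1 heC')
      · have h3 := evalApprox_complete (X := ∅) (e := ef)
          (x := encode (e, (p.1.map νG).inf, (p.1.map νG).sup, c.toNat)) (y := idx p c)
          (by rw [hef]; exact Part.mem_some _)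
        have h4 := evalApprox_complete (Part.eq_some_iff.1 heC')
        obtain ⟨k', h3, h4⟩ := (h3.and h4).exists
        obtain ⟨w, h3, h4⟩ := (h3.and h4).exists
        refine ⟨k', (w, List.ofFn (elementCode νG ι ∘ fun i => Sum.inr (p, c, a i)), idx p c,
          atomValue (C (idx p c)) R (ι p c ∘ a)), ⟨hmem, hmap⟩,
            Or.inr (Or.inr (Or.inr ⟨hrc, hx, ?_, ?_⟩))⟩
        · dsimp only
          rw [h0, pieceFst_elementCode, pieceSnd_elementCode, pieceType_elementCode]
          exact h3
        · dsimp only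
          rw [hoff]
          simp only [Nat.mul_div_cancel_left _ (Nat.succ_pos 1)]
          exact h4
    · have hval : atomValue (jumpInversion A B G) (Sum.inl R) x = 0 := by
        refine (atomValue_of (P := False) ?_).trans (if_neg not_false)
        refine iff_of_false ?_ not_false
        rintro ⟨p, c, a, rfl, -⟩
        exact hx (hsame.2 ⟨p, c, a, rfl⟩)
      rw [hval]
      refine hr (e, 2 * encode (⟨m, R⟩ : Σ k, L.Relations k), _) _ ?_ ?_
      · rintro k' ⟨w, zs, g, y⟩ ⟨⟨h1, h2⟩, h3⟩
        obtain rfl := hzs zs h1 h2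
        rcases h3 with ⟨h3, -⟩ | ⟨h3, -⟩ | ⟨-, -, h3⟩ | ⟨-, h3, -⟩
        · exact absurd (hrc) h3
        · exact absurd (hrc) h3
        · exact h3
        · exact absurd h3 hx
      · exact ⟨0, (0, List.ofFn (elementCode νG ι ∘ x), 0, 0), ⟨hmem, hmap⟩,
          Or.inr (Or.inr (Or.inl ⟨hrc, hx, rfl⟩))⟩
  | inr R =>
    have key : ∀ rc : ℕ, ¬ rc % 2 = 0 →
        (MarkCode rc (List.ofFn (elementCode νG ι ∘ x)) ↔ markHolds R x) →
        Phi ∅ r (Nat.pair e (Nat.pair rc (encode l))) =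
          Part.some (atomValue (jumpInversion A B G) (Sum.inr R) x) := fun rc hrc hmk => by
      have hval : atomValue (jumpInversion A B G) (Sum.inr R) x =
          if MarkCode rc (List.ofFn (elementCode νG ι ∘ x)) then 1 else 0 :=
        atomValue_of hmk.symm
      rw [hval]
      refine hr (e, rc, _) _ ?_ ?_
      · rintro k' ⟨w, zs, g, y⟩ ⟨⟨h1, h2⟩, h3⟩
        obtain rfl := hzs zs h1 h2
        rcases h3 with ⟨-, h3, h4⟩ | ⟨-, h3, h4⟩ | ⟨h3, -⟩ | ⟨h3, -⟩
        · rw [if_pos h3]; exact h4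
        · rw [if_neg h3]; exact h4
        · exact absurd h3 hrc
        · exact absurd h3 hrc
      · by_cases hM : MarkCode rc (List.ofFn (elementCode νG ι ∘ x))
        · exact ⟨0, (0, List.ofFn (elementCode νG ι ∘ x), 0, 1), ⟨hmem, hmap⟩,
            Or.inl ⟨hrc, hM, rfl⟩⟩
        · exact ⟨0, (0, List.ofFn (elementCode νG ι ∘ x), 0, 0), ⟨hmem, hmap⟩,
            Or.inr (Or.inl ⟨hrc, hM, rfl⟩)⟩
    cases R with
    | U => rw [atomCode_U', hl]; exact key 1 (by decide) (markCode_U x)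
    | E => rw [atomCode_E', hl]; exact key 3 (by decide) (markCode_pieceMark hinj true x)
    | F => rw [atomCode_F', hl]; exact key 5 (by decide) (markCode_pieceMark hinj false x)

end CopyOfGraph

end UJI

namespace UJI

open FirstOrder

/-! ## Queries definable by infinitary formulas -/

/-! ### Substitution, negation and isomorphism invariance of formulas. -/

section Formulas

variable {L : FirstOrder.Language.{0, 0}}

/-- Substitution of variables. -/
def QF.rename {m m' : ℕ} (f : Fin m → Fin m') : QF L m → QF L m'
  | falsum => falsum
  | eq i j => eq (f i) (f j)
  | rel R v => rel R (f ∘ v)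
  | neg θ => neg (rename f θ)
  | and θ η => and (rename f θ) (rename f η)
  | or θ η => or (rename f θ) (rename f η)

theorem QF.realize_rename {M : Type} (S : L.Structure M) {m m' : ℕ} (f : Fin m → Fin m')
    (θ : QF L m) (x : Fin m' → M) : (θ.rename f).Realize S x ↔ θ.Realize S (x ∘ f) := by
  induction θ with
  | falsum => exact Iff.rfl
  | eq i j => exact Iff.rfl
  | rel R v => exact Iff.rfl
  | neg θ ih => exact not_congr ih
  | and θ η ih ih' => exact and_congr ih ih'
  | or θ η ih ih' => exact or_congr ih ih'

namespace Fml

/-- Substitution of variables. -/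
def rename : {b : Kind} → {n m : ℕ} → Fml L b n m → {m' : ℕ} → (Fin m → Fin m') → Fml L b n m'
  | _, _, _, .qf θ, _, f => .qf (θ.rename f)
  | _, _, _, .block I k ψ, m', f => .block I k fun i =>
      (ψ i).rename (Fin.append (Fin.castAdd (k i) ∘ f) (Fin.natAdd m'))

/-- The negation of a formula, in the normal form of the opposite kind. -/
def neg : {b : Kind} → {n m : ℕ} → Fml L b n m → Fml L b.dual n m
  | _, _, _, .qf θ => .qf θ.neg
  | _, _, _, .block I k ψ => .block I k fun i => (ψ i).neg

/-- A filler: `block` requires a member for every number, also outside the index set. -/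
theorem nonempty : ∀ (n : ℕ) (b : Kind) (m : ℕ), Nonempty (Fml L b n m)
  | 0, _, _ => ⟨.qf .falsum⟩
  | n + 1, b, m => ⟨.block ∅ 0 fun _ => (nonempty n b.dual m).some⟩

variable {M : Type} (S : L.Structure M)

theorem append_comp_append {m m' k : ℕ} (f : Fin m → Fin m') (x : Fin m' → M) (y : Fin k → M) :
    Fin.append x y ∘ Fin.append (Fin.castAdd k ∘ f) (Fin.natAdd m') = Fin.append (x ∘ f) y := by
  funext i
  induction i using Fin.addCases <;> simp

theorem realize_rename {b : Kind} {n m : ℕ} (φ : Fml L b n m) :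
    ∀ {m' : ℕ} (f : Fin m → Fin m') (x : Fin m' → M),
      (φ.rename f).Realize S x ↔ φ.Realize S (x ∘ f) := by
  induction φ with
  | qf θ => exact fun f x => θ.realize_rename S f x
  | @block b n m I k ψ ih =>
    intro m' f x
    cases b <;> simp only [rename, Realize, ih, append_comp_append]

theorem realize_neg {b : Kind} {n m : ℕ} (φ : Fml L b n m) :
    ∀ x : Fin m → M, φ.neg.Realize S x ↔ ¬ φ.Realize S x := by
  induction φ with
  | qf θ => exact fun x => Iff.rfl
  | @block b n m I k ψ ih =>
    intro x
    cases b <;> simp only [Realize, not_forall, not_exists, not_and, exists_prop]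
    · exact forall₃_congr fun i _ y => ih i _
    · exact exists_congr fun i => and_congr_right fun _ => exists_congr fun y => ih i _

end Fml

theorem Isomorphic.realize_iff {M N : Type} {S : L.Structure M} {T : L.Structure N} (g : M ≃ N)
    (hg : ∀ {k : ℕ} (R : L.Relations k) (x : Fin k → M), T.RelMap R (g ∘ x) ↔ S.RelMap R x)
    {b : Kind} {n m : ℕ} (φ : Fml L b n m) (x : Fin m → M) :
    φ.Realize T (g ∘ x) ↔ φ.Realize S x := by
  induction φ with
  | qf θ =>
    induction θ with
    | falsum => exact Iff.rfl
    | eq i j => exact g.injective.eq_iff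
    | rel R v => exact hg R (x ∘ v)
    | neg θ ih => exact not_congr ih
    | and θ η ih ih' => exact and_congr ih ih'
    | or θ η ih ih' => exact or_congr ih ih'
  | @block b n m I k ψ ih =>
    have h : ∀ i (y : Fin (k i) → M), (ψ i).Realize T (Fin.append (g ∘ x) (g ∘ y)) ↔
        (ψ i).Realize S (Fin.append x y) := fun i y => by
      rw [← ih]
      congr!
      funext j
      induction j using Fin.addCases <;> simp
    have hs : ∀ i, Function.Surjective fun y : Fin (k i) → M => g ∘ y := fun i =>
      g.surjective.comp_left
    cases b <;> simp only [Fml.Realize, (hs _).exists, (hs _).forall, h]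

theorem Isomorphic.holds_iff {M N : Type} {S : L.Structure M} {T : L.Structure N}
    (h : Isomorphic S T) {b : Kind} {n : ℕ} (φ : Fml L b n 0) : φ.Holds S ↔ φ.Holds T := by
  obtain ⟨g, hg⟩ := h.exists_equiv
  unfold Fml.Holds
  rw [← Isomorphic.realize_iff g hg φ Fin.elim0]
  congr!

end Formulas

/-- A query on the structures of a language: a relation on each of them, with arguments indexed by
`ι`. -/
abbrev Query (L : FirstOrder.Language.{0, 0}) (ι : Type) : Type 1 :=
  ∀ M : Type, L.Structure M → (ι → M) → Prop

/-- On the structures in the class `K`, the query `Q` is defined by a `Σ_k` formula or by a `Π_k`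
formula. -/
def Definable {L : FirstOrder.Language.{0, 0}} (K : ∀ M : Type, L.Structure M → Prop) (b : Kind)
    (k : ℕ) {ι : Type} (Q : Query L ι) : Prop :=
  ∃ (m : ℕ) (e : Fin m ≃ ι) (φ : Fml L b k m), ∀ (M : Type) (S : L.Structure M), K M S →
    ∀ x : ι → M, Q M S x ↔ φ.Realize S (x ∘ e)

namespace Definable

variable {L : FirstOrder.Language.{0, 0}} {K : ∀ M : Type, L.Structure M → Prop} {b : Kind}
  {k : ℕ} {ι κ : Type} {Q Q' : Query L ι}

theorem finite (h : Definable K b k Q) : Finite ι :=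
  let ⟨_, e, _⟩ := h
  Finite.of_equiv _ e

theorem congr (h : Definable K b k Q)
    (hQ : ∀ (M : Type) (S : L.Structure M), K M S → ∀ x, Q' M S x ↔ Q M S x) :
    Definable K b k Q' :=
  let ⟨m, e, φ, hφ⟩ := h
  ⟨m, e, φ, fun M S hS x => (hQ M S hS x).trans (hφ M S hS x)⟩

theorem mono_class {K' : ∀ M : Type, L.Structure M → Prop} (h : Definable K b k Q)
    (hK : ∀ (M : Type) (S : L.Structure M), K' M S → K M S) : Definable K' b k Q :=
  let ⟨m, e, φ, hφ⟩ := h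
  ⟨m, e, φ, fun M S hS => hφ M S (hK M S hS)⟩

/-- The map `f` is arbitrary, so this covers dummy variables and the identification of variables. -/
theorem rename [Finite κ] (h : Definable K b k Q) (f : ι → κ) :
    Definable K b k fun M S (x : κ → M) => Q M S (x ∘ f) := by
  obtain ⟨m, e, φ, hφ⟩ := h
  obtain ⟨m', ⟨e'⟩⟩ := Finite.exists_equiv_fin κ
  refine ⟨m', e'.symm, φ.rename (e' ∘ f ∘ e), fun M S hS x => ?_⟩
  rw [Fml.realize_rename]
  refine (hφ M S hS (x ∘ f)).trans ?_
  congr!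
  funext i
  simp

theorem exists_fml (h : Definable K b k Q) {m : ℕ} (e : Fin m ≃ ι) :
    ∃ φ : Fml L b k m, ∀ (M : Type) (S : L.Structure M), K M S →
      ∀ x : ι → M, Q M S x ↔ φ.Realize S (x ∘ e) := by
  obtain ⟨m', e', φ, hφ⟩ := h
  refine ⟨φ.rename (e.symm ∘ e'), fun M S hS x => ?_⟩
  rw [Fml.realize_rename, hφ M S hS]
  congr!
  funext i
  simp

theorem neg (h : Definable K b k Q) : Definable K b.dual k fun M S x => ¬ Q M S x :=
  let ⟨m, e, φ, hφ⟩ := h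
  ⟨m, e, φ.neg, fun M S hS x => (not_congr (hφ M S hS x)).trans (φ.realize_neg S _).symm⟩

theorem of_neg (h : Definable K b k fun M S x => ¬ Q M S x) : Definable K b.dual k Q :=
  h.neg.congr fun _ _ _ _ => not_not.symm

/-- The countable disjunctions of existential quantifications. -/
theorem sigma_intro [Finite ι] {J : Type} [Countable J] {κ : J → Type} [∀ j, Finite (κ j)]
    {R : ∀ j, Query L (ι ⊕ κ j)} (h : ∀ j, Definable K .pi k (R j)) :
    Definable K .sigma (k + 1)
      fun M S x => ∃ j, ∃ y : κ j → M, R j M S (Sum.elim x y) := by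
  obtain ⟨m, ⟨e⟩⟩ := Finite.exists_equiv_fin ι
  obtain ⟨code, hcode⟩ := exists_injective_nat J
  choose l e' using fun j => Finite.exists_equiv_fin (κ j)
  have e' := fun j => (e' j).some
  choose φ hφ using fun j =>
    (h j).exists_fml (finSumFinEquiv.symm.trans (Equiv.sumCongr e.symm (e' j).symm))
  have hφ' : ∀ j (M : Type) (S : L.Structure M), K M S → ∀ x (y : κ j → M),
      R j M S (Sum.elim x y) ↔
        (φ j).Realize S (Fin.append (x ∘ e.symm) (y ∘ (e' j).symm)) := fun j M S hS x y => by
    rw [hφ j M S hS]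
    congr!
    funext i
    induction i using Fin.addCases <;> simp
  have hF : ∃ (k' : ℕ → ℕ) (ψ : ∀ i, Fml L .pi k (m + k' i)), ∀ j (M : Type) (S : L.Structure M),
      K M S → ∀ x, (∃ y : κ j → M, R j M S (Sum.elim x y)) ↔
        ∃ y : Fin (k' (code j)) → M, (ψ (code j)).Realize S (Fin.append (x ∘ e.symm) y) := by
    -- The index type `J` is embedded into `ℕ` by `code`; numbers outside its range get an arbitrary
    -- formula, which the block ignores.
    have : ∀ i, ∃ (l' : ℕ) (ψ : Fml L .pi k (m + l')), ∀ j, code j = i →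
        ∀ (M : Type) (S : L.Structure M), K M S → ∀ x,
          (∃ y : κ j → M, R j M S (Sum.elim x y)) ↔
            ∃ y : Fin l' → M, ψ.Realize S (Fin.append (x ∘ e.symm) y) := fun i => by
      by_cases hi : ∃ j, code j = i
      · obtain ⟨j, rfl⟩ := hi
        refine ⟨l j, φ j, fun j' hj' M S hS x => ?_⟩
        obtain rfl := hcode hj'
        constructor
        · exact fun ⟨y, h⟩ => ⟨_, (hφ' _ M S hS x y).1 h⟩
        · refine fun ⟨y, h⟩ => ⟨y ∘ e' _, (hφ' _ M S hS x _).2 ?_⟩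
          simpa only [Function.comp_assoc, Equiv.self_comp_symm, Function.comp_id] using h
      · obtain ⟨ψ⟩ := Fml.nonempty (L := L) k .pi (m + 0)
        exact ⟨0, ψ, fun j hj => absurd ⟨j, hj⟩ hi⟩
    choose k' ψ hψ using this
    exact ⟨k', ψ, fun j => hψ _ j rfl⟩
  obtain ⟨k', ψ, hψ⟩ := hF
  refine ⟨m, e.symm, .block (Set.range code) k' ψ, fun M S hS x => ?_⟩
  simp only [Fml.Realize, Set.exists_range_iff, hψ _ M S hS]
  exact Iff.rfl

/-- The converse of `sigma_intro`. Opening blocks in this way allows nested ones to be merged. -/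
theorem sigma_cases (h : Definable K .sigma (k + 1) Q) :
    ∃ (J : Set ℕ) (l : ℕ → ℕ) (R : ∀ i, Query L (ι ⊕ Fin (l i))),
      (∀ i, Definable K .pi k (R i)) ∧ ∀ (M : Type) (S : L.Structure M), K M S → ∀ x,
        Q M S x ↔ ∃ (j : J) (y : Fin (l j) → M), R j M S (Sum.elim x y) := by
  obtain ⟨m, e, φ, hφ⟩ := h
  cases φ with
  | block I l ψ =>
    refine ⟨I, l, fun i M S x => (ψ i).Realize S
      (x ∘ finSumFinEquiv.symm.trans (Equiv.sumCongr e (Equiv.refl _))), fun i =>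
        ⟨_, _, ψ i, fun M S _ x => Iff.rfl⟩, fun M S hS x => ?_⟩
    rw [hφ M S hS]
    simp only [Fml.Realize, Subtype.exists, ← exists_prop]
    refine exists_congr fun i => exists_congr fun _ => exists_congr fun y => ?_
    congr!
    funext i
    induction i using Fin.addCases <;> simp

theorem falsum [Finite ι] : Definable K b 0 fun _ _ (_ : ι → _) => False :=
  let ⟨m, ⟨e⟩⟩ := Finite.exists_equiv_fin ι
  ⟨m, e.symm, .qf .falsum, fun _ _ _ _ => Iff.rfl⟩

theorem eq [Finite ι] (i j : ι) : Definable K b 0 fun _ _ x => x i = x j := by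
  obtain ⟨m, ⟨e⟩⟩ := Finite.exists_equiv_fin ι
  refine ⟨m, e.symm, .qf (.eq (e i) (e j)), fun _ _ _ _ => ?_⟩
  simp [Fml.Realize, QF.Realize]

theorem rel [Finite ι] {r : ℕ} (R : L.Relations r) (v : Fin r → ι) :
    Definable K b 0 fun _ S x => S.RelMap R (x ∘ v) := by
  obtain ⟨m, ⟨e⟩⟩ := Finite.exists_equiv_fin ι
  refine ⟨m, e.symm, .qf (.rel R (e ∘ v)), fun _ _ _ _ => ?_⟩
  simp [Fml.Realize, QF.Realize, Function.comp_assoc, ← Function.comp_assoc e.symm]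

theorem qf_neg (h : Definable K b 0 Q) {b' : Kind} : Definable K b' 0 fun M S x => ¬ Q M S x := by
  obtain ⟨m, e, φ, hφ⟩ := h
  cases φ with
  | qf θ => exact ⟨m, e, .qf θ.neg, fun M S hS x => not_congr (hφ M S hS x)⟩

theorem qf_and (h : Definable K b 0 Q) (h' : Definable K b 0 Q') :
    Definable K b 0 fun M S x => Q M S x ∧ Q' M S x := by
  obtain ⟨m, e, φ, hφ⟩ := h
  obtain ⟨ψ, hψ⟩ := h'.exists_fml e
  cases φ with
  | qf θ =>
    cases ψ with
    | qf η => exact ⟨m, e, .qf (.and θ η), fun M S hS x =>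
        and_congr (hφ M S hS x) (hψ M S hS x)⟩

/-- A disjunction with one member and no quantified variables. -/
theorem pi_to_sigma (h : Definable K .pi k Q) : Definable K .sigma (k + 1) Q := by
  have := h.finite
  refine (sigma_intro (J := Unit) (κ := fun _ => Empty) fun _ => h.rename Sum.inl).congr
    fun M S _ x => ?_
  simp only [Sum.elim_comp_inl, exists_const]

theorem sigma_to_pi (h : Definable K .sigma k Q) : Definable K .pi (k + 1) Q :=
  (pi_to_sigma h.neg).of_neg

theorem qf_kind (h : Definable K b 0 Q) {b' : Kind} : Definable K b' 0 Q :=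
  (h.qf_neg (b' := b')).qf_neg.congr fun _ _ _ _ => not_not.symm

/-- Only the members have to be lifted, and a `Π` member is the negation of a `Σ` query of smaller
level, to which the recursion applies. -/
theorem sigma_lift : ∀ {k : ℕ} {ι : Type} {Q : Query L ι}, Definable K .sigma k Q →
    Definable K .sigma (k + 1) Q
  | 0, _, _, h => pi_to_sigma h.qf_kind
  | k + 1, ι, Q, h => by
    have := h.finite
    obtain ⟨J, l, R, hR, hQ⟩ := h.sigma_cases
    refine (sigma_intro (J := J) (κ := fun i => Fin (l i)) fun i =>
      (sigma_lift (hR i).neg).of_neg).congr hQ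

theorem pi_lift (h : Definable K .pi k Q) : Definable K .pi (k + 1) Q :=
  (sigma_lift h.neg).of_neg

theorem lift (h : Definable K b k Q) {b' : Kind} : Definable K b' (k + 1) Q := by
  cases b <;> cases b'
  exacts [h.sigma_lift, h.sigma_to_pi, h.pi_to_sigma, h.pi_lift]

theorem mono (h : Definable K b k Q) {l : ℕ} (hl : k ≤ l) : Definable K b l Q := by
  induction hl with
  | refl => exact h
  | step _ ih => exact ih.lift

theorem of_qf (h : Definable K b 0 Q) {b' : Kind} {l : ℕ} : Definable K b' l Q :=
  h.qf_kind.mono l.zero_le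

/-- The `Σ` formulas of positive level are closed under countable disjunctions and existential
quantification. -/
theorem exists_exists [Finite ι] {J : Type} [Countable J] {κ : J → Type} [∀ j, Finite (κ j)]
    {R : ∀ j, Query L (ι ⊕ κ j)} (h : ∀ j, Definable K .sigma (k + 1) (R j)) :
    Definable K .sigma (k + 1) fun M S x => ∃ j, ∃ y : κ j → M, R j M S (Sum.elim x y) := by
  choose I l P hP hQ using fun j => (h j).sigma_cases
  -- Two nested blocks merge: the disjunction runs over pairs of indices, and the two tuples of
  -- variables are concatenated.
  refine (sigma_intro (J := Σ j, I j) (κ := fun j => κ j.1 ⊕ Fin (l j.1 j.2)) fun j =>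
    (hP j.1 j.2).rename (Equiv.sumAssoc _ _ _)).congr fun M S hS x => ?_
  simp only [hQ _ M S hS, Sigma.exists]
  refine exists_congr fun j => ⟨?_, ?_⟩
  · rintro ⟨y, i, z, h⟩
    refine ⟨i, Sum.elim y z, ?_⟩
    convert h using 1
    funext t
    rcases t with (t | t) | t <;> rfl
  · rintro ⟨i, y, h⟩
    refine ⟨y ∘ Sum.inl, i, y ∘ Sum.inr, ?_⟩
    convert h using 1
    funext t
    rcases t with (t | t) | t <;> rfl

theorem forall_forall [Finite ι] {J : Type} [Countable J] {κ : J → Type} [∀ j, Finite (κ j)]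
    {R : ∀ j, Query L (ι ⊕ κ j)} (h : ∀ j, Definable K .pi (k + 1) (R j)) :
    Definable K .pi (k + 1) fun M S x => ∀ j, ∀ y : κ j → M, R j M S (Sum.elim x y) :=
  (exists_exists fun j => (h j).neg).neg.congr fun M S _ x => by push Not; rfl

theorem countable_exists [Finite ι] {J : Type} [Countable J] {R : J → Query L ι}
    (h : ∀ j, Definable K .sigma (k + 1) (R j)) :
    Definable K .sigma (k + 1) fun M S x => ∃ j, R j M S x :=
  (exists_exists (κ := fun _ => Empty) fun j => (h j).rename Sum.inl).congr fun M S _ x => by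
    simp only [Sum.elim_comp_inl, exists_const]

theorem countable_forall [Finite ι] {J : Type} [Countable J] {R : J → Query L ι}
    (h : ∀ j, Definable K .pi (k + 1) (R j)) :
    Definable K .pi (k + 1) fun M S x => ∀ j, R j M S x :=
  (countable_exists fun j => (h j).neg).neg.congr fun M S _ x => by push Not; rfl

theorem forall_tuple [Finite ι] [Finite κ] {R : Query L (ι ⊕ κ)}
    (h : Definable K .pi (k + 1) R) :
    Definable K .pi (k + 1) fun M S x => ∀ y : κ → M, R M S (Sum.elim x y) :=
  (forall_forall (J := Unit) fun _ => h).congr fun M S _ x => by simp only [forall_const]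

theorem pi_and (h : Definable K .pi k Q) (h' : Definable K .pi k Q') :
    Definable K .pi k fun M S x => Q M S x ∧ Q' M S x := by
  have := h.finite
  cases k with
  | zero => exact h.qf_and h'
  | succ k =>
    refine (countable_forall (J := Bool) (R := fun c => bif c then Q else Q') fun c => ?_).congr
      fun M S _ x => by simp [and_comm]
    cases c
    exacts [h', h]

/-- Conjunction distributes over the two disjunctions, once the quantified variables of the members
are made disjoint. -/
theorem sigma_and (h : Definable K .sigma k Q) (h' : Definable K .sigma k Q') :
    Definable K .sigma k fun M S x => Q M S x ∧ Q' M S x := by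
  have := h.finite
  cases k with
  | zero => exact h.qf_and h'
  | succ k =>
    obtain ⟨I, l, P, hP, hQ⟩ := h.sigma_cases
    obtain ⟨I', l', P', hP', hQ'⟩ := h'.sigma_cases
    refine (sigma_intro (J := I × I') (κ := fun j => Fin (l j.1) ⊕ Fin (l' j.2)) fun j =>
      ((hP j.1).rename (Sum.map id Sum.inl)).pi_and
        ((hP' j.2).rename (Sum.map id Sum.inr))).congr fun M S hS x => ?_
    rw [hQ M S hS, hQ' M S hS]
    constructor
    · rintro ⟨⟨i, y, h⟩, i', y', h'⟩
      refine ⟨(i, i'), Sum.elim y y', ?_, ?_⟩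
      · simpa only [Sum.elim_comp_map, Function.comp_id, Sum.elim_comp_inl] using h
      · simpa only [Sum.elim_comp_map, Function.comp_id, Sum.elim_comp_inr] using h'
    · rintro ⟨⟨i, i'⟩, y, h, h'⟩
      rw [Sum.elim_comp_map, Function.comp_id] at h h'
      exact ⟨⟨i, _, h⟩, i', _, h'⟩

theorem and (h : Definable K b k Q) (h' : Definable K b k Q') :
    Definable K b k fun M S x => Q M S x ∧ Q' M S x := by
  cases b
  exacts [h.sigma_and h', h.pi_and h']

theorem or (h : Definable K b k Q) (h' : Definable K b k Q') :
    Definable K b k fun M S x => Q M S x ∨ Q' M S x := by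
  have : Definable K b.dual.dual k fun M S x => ¬ (¬ Q M S x ∧ ¬ Q' M S x) :=
    (h.neg.and h'.neg).neg
  cases b <;> exact this.congr fun M S _ x => by tauto

theorem imp (h : Definable K b.dual k Q) (h' : Definable K b k Q') :
    Definable K b k fun M S x => Q M S x → Q' M S x := by
  have : Definable K b.dual.dual k fun M S x => ¬ Q M S x := h.neg
  have : Definable K b k fun M S x => ¬ Q M S x := by cases b <;> exact this
  exact (this.or h').congr fun M S _ x => by tauto

theorem const [Finite ι] (P : Prop) : Definable K b k fun _ _ (_ : ι → _) => P := by
  by_cases hP : P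
  · exact ((falsum (b := .sigma)).qf_neg (b' := .sigma)).of_qf.congr fun _ _ _ _ => by simp [hP]
  · exact (falsum (b := b)).of_qf.congr fun _ _ _ _ => by simp [hP]

/-- The second query only needs to be defined where the first one holds. -/
theorem and_of {P : ∀ M : Type, L.Structure M → Prop}
    (h : Definable K b k fun M S (_ : ι → M) => P M S)
    (h' : Definable (fun M S => K M S ∧ P M S) b k Q) :
    Definable K b k fun M S x => P M S ∧ Q M S x := by
  obtain ⟨m, e, φ, hφ⟩ := h'
  refine (h.and ⟨m, e, φ, fun M S _ x => Iff.rfl⟩).congr fun M S hS x =>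
    and_congr_right fun hP => hφ M S ⟨hS, hP⟩ x

end Definable

/-! ## Interpretations -/

theorem Definable.neg_dual {L : FirstOrder.Language.{0, 0}} {K : ∀ M : Type, L.Structure M → Prop}
    {b : Kind} {k : ℕ} {ι : Type} {Q : Query L ι} (h : Definable K b.dual k Q) :
    Definable K b k fun M S x => ¬ Q M S x := by
  cases b <;> exact h.neg

theorem Definable.fin_forall {L : FirstOrder.Language.{0, 0}}
    {K : ∀ M : Type, L.Structure M → Prop} {b : Kind} {k : ℕ} {ι : Type} [Finite ι] :
    ∀ {l : ℕ} {R : Fin l → Query L ι}, (∀ i, Definable K b k (R i)) →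
      Definable K b k fun M S x => ∀ i, R i M S x
  | 0, _, _ => (Definable.const True).congr fun _ _ _ _ => by simp
  | _ + 1, _, h => ((h 0).and (fin_forall fun i => h i.succ)).congr fun _ _ _ _ =>
      Fin.forall_fin_succ

section Interpretation

variable {L L₁ : FirstOrder.Language.{0, 0}} {K : ∀ M : Type, L.Structure M → Prop} {b : Kind}
  {k : ℕ} {P : Type} {D : ∀ M : Type, L.Structure M → (P → M) → M → Prop}

/-- A relation on the subsets `D` of the structures, with parameters, is definable by `Σ_k` or
`Π_k` formulas on the structures in the class `K`. -/
def DefinableOn (K : ∀ M : Type, L.Structure M → Prop)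
    (D : ∀ M : Type, L.Structure M → (P → M) → M → Prop) (b : Kind) (k : ℕ) {m : ℕ}
    (Q : ∀ (M : Type) (S : L.Structure M) (u : P → M), (Fin m → {a // D M S u a}) → Prop) : Prop :=
  ∃ Q' : Query L (P ⊕ Fin m), Definable K b k Q' ∧ ∀ (M : Type) (S : L.Structure M), K M S →
    ∀ (u : P → M) (w : Fin m → {a // D M S u a}), Q M S u w ↔ Q' M S (Sum.elim u fun i => w i)

namespace DefinableOn

variable {m : ℕ}
  {Q Q' : ∀ (M : Type) (S : L.Structure M) (u : P → M), (Fin m → {a // D M S u a}) → Prop}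

theorem congr (h : DefinableOn K D b k Q)
    (hQ : ∀ (M : Type) (S : L.Structure M), K M S → ∀ u w, Q' M S u w ↔ Q M S u w) :
    DefinableOn K D b k Q' :=
  let ⟨R, hR, hQR⟩ := h
  ⟨R, hR, fun M S hS u w => (hQ M S hS u w).trans (hQR M S hS u w)⟩

theorem neg_dual (h : DefinableOn K D b.dual k Q) :
    DefinableOn K D b k fun M S u w => ¬ Q M S u w :=
  let ⟨_, hR, hQR⟩ := h
  ⟨_, hR.neg_dual, fun M S hS u w => not_congr (hQR M S hS u w)⟩

theorem and (h : DefinableOn K D b k Q) (h' : DefinableOn K D b k Q') :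
    DefinableOn K D b k fun M S u w => Q M S u w ∧ Q' M S u w :=
  let ⟨_, hR, hQR⟩ := h
  let ⟨_, hR', hQR'⟩ := h'
  ⟨_, hR.and hR', fun M S hS u w => and_congr (hQR M S hS u w) (hQR' M S hS u w)⟩

theorem or (h : DefinableOn K D b k Q) (h' : DefinableOn K D b k Q') :
    DefinableOn K D b k fun M S u w => Q M S u w ∨ Q' M S u w :=
  let ⟨_, hR, hQR⟩ := h
  let ⟨_, hR', hQR'⟩ := h'
  ⟨_, hR.or hR', fun M S hS u w => or_congr (hQR M S hS u w) (hQR' M S hS u w)⟩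

theorem lift (h : DefinableOn K D b k Q) {b' : Kind} : DefinableOn K D b' (k + 1) Q :=
  let ⟨_, hR, hQR⟩ := h
  ⟨_, hR.lift, hQR⟩

variable [Finite P]

theorem rename {m' : ℕ} (h : DefinableOn K D b k Q) (f : Fin m → Fin m') :
    DefinableOn K D b k fun M S u (w : Fin m' → {a // D M S u a}) => Q M S u (w ∘ f) :=
  let ⟨_, hR, hQR⟩ := h
  ⟨_, hR.rename (Sum.map id f), fun M S hS u w => by
    rw [Sum.elim_comp_map]
    exact hQR M S hS u (w ∘ f)⟩

/-- Quantifiers over the interpreted structure become quantifiers relativized to `D`. As `D` is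
quantifier-free, the relativization does not raise the level. -/
theorem sigma_block (hD : Definable K .sigma 0 fun M S (x : P ⊕ Unit → M) =>
      D M S (x ∘ Sum.inl) (x (Sum.inr ())))
    (I : Set ℕ) {l : ℕ → ℕ}
    {R : ∀ i, ∀ (M : Type) (S : L.Structure M) (u : P → M),
      (Fin (m + l i) → {a // D M S u a}) → Prop}
    (h : ∀ i, DefinableOn K D .sigma (k + 1) (R i)) :
    DefinableOn K D .sigma (k + 1) fun M S u w =>
      ∃ i ∈ I, ∃ y : Fin (l i) → {a // D M S u a}, R i M S u (Fin.append w y) := by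
  choose R' hR hR' using h
  refine ⟨_, Definable.exists_exists (J := I) (κ := fun i => Fin (l i)) fun i =>
    (Definable.fin_forall fun t : Fin (l i) => hD.of_qf.rename
      (Sum.elim (Sum.inl ∘ Sum.inl) fun _ => Sum.inr t)).and
      ((hR i).rename (Sum.elim (Sum.inl ∘ Sum.inl) (Fin.append (Sum.inl ∘ Sum.inr) Sum.inr))),
    fun M S hS u w => ?_⟩
  simp only [Subtype.exists, ← exists_prop]
  refine exists_congr fun i => exists_congr fun _ => ?_
  have key : ∀ y : Fin (l i) → {a // D M S u a}, R i M S u (Fin.append w y) ↔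
      R' i M S (Sum.elim (Sum.elim u fun i => (w i : M)) (fun t => (y t : M)) ∘
        Sum.elim (Sum.inl ∘ Sum.inl) (Fin.append (Sum.inl ∘ Sum.inr) Sum.inr)) := fun y => by
    rw [hR' i M S hS]
    congr!
    funext t
    rcases t with t | t
    · rfl
    · induction t using Fin.addCases <;> simp
  constructor
  · rintro ⟨y, h⟩
    exact ⟨fun t => y t, fun t => (y t).2, (key y).1 h⟩
  · rintro ⟨y, hy, h⟩
    exact ⟨fun t => ⟨y t, hy t⟩, (key fun t => ⟨y t, hy t⟩).2 h⟩

theorem pi_block (hD : Definable K .sigma 0 fun M S (x : P ⊕ Unit → M) =>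
      D M S (x ∘ Sum.inl) (x (Sum.inr ())))
    (I : Set ℕ) {l : ℕ → ℕ}
    {R : ∀ i, ∀ (M : Type) (S : L.Structure M) (u : P → M),
      (Fin (m + l i) → {a // D M S u a}) → Prop}
    (h : ∀ i, DefinableOn K D .pi (k + 1) (R i)) :
    DefinableOn K D .pi (k + 1) fun M S u w =>
      ∀ i ∈ I, ∀ y : Fin (l i) → {a // D M S u a}, R i M S u (Fin.append w y) :=
  (neg_dual (b := .pi) (sigma_block hD I fun i => neg_dual (b := .sigma) (h i))).congr
    fun M S _ u w => by push Not; rfl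

variable {T : ∀ (M : Type) (S : L.Structure M) (u : P → M), L₁.Structure {a // D M S u a}}

/-- Negation exchanges the two kinds, so the atomic relations have to be definable in both;
quantifier-free formulas then are as well. -/
theorem qf (hT : ∀ {r : ℕ} (R : L₁.Relations r) (b : Kind),
      DefinableOn K D b (k + 1) fun M S u w => (T M S u).RelMap R w)
    (θ : QF L₁ m) (b : Kind) :
    DefinableOn K D b (k + 1) fun M S u w => θ.Realize (T M S u) w := by
  induction θ generalizing b with
  | falsum => exact ⟨_, Definable.const False, fun M S hS u w => Iff.rfl⟩
  | eq i j => exact ⟨_, (Definable.eq (b := b) (Sum.inr i) (Sum.inr j)).of_qf,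
      fun M S hS u w => Subtype.ext_iff⟩
  | rel R v => exact (hT R b).rename v
  | neg θ ih => exact (ih _).neg_dual
  | and θ η ih ih' => exact (ih b).and (ih' b)
  | or θ η ih ih' => exact (ih b).or (ih' b)

/-- Formulas about an interpreted structure are translated into formulas about the given one. -/
theorem fml (hD : Definable K .sigma 0 fun M S (x : P ⊕ Unit → M) =>
      D M S (x ∘ Sum.inl) (x (Sum.inr ())))
    (hT : ∀ {r : ℕ} (R : L₁.Relations r) (b : Kind),
      DefinableOn K D b (k + 1) fun M S u w => (T M S u).RelMap R w)
    {l : ℕ} (φ : Fml L₁ b (l + 1) m) :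
    DefinableOn K D b (k + l + 1) fun M S u w => φ.Realize (T M S u) w := by
  induction l generalizing b m with
  | zero =>
    cases φ with
    | block I n ψ =>
      -- The members are quantifier-free, hence definable at level `k + 1` with the same kind as the
      -- block, which therefore absorbs them. This is why level `l + 1` becomes `k + l + 1` and not
      -- `k + l + 2`.
      have h : ∀ i, DefinableOn K D b (k + 1) fun M S u w => (ψ i).Realize (T M S u) w := by
        intro i
        cases ψ i with
        | qf θ => exact qf hT θ b
      cases b
      exacts [sigma_block hD I h, pi_block hD I h]
  | succ l ih =>
    cases φ with
    | block I n ψ =>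
      -- The members have the opposite kind one level below; after lifting them to the kind and
      -- level of the block, the block closes at no further cost.
      have h : ∀ i, DefinableOn K D b (k + l + 1 + 1) fun M S u w =>
        (ψ i).Realize (T M S u) w := fun i => (ih (ψ i)).lift
      cases b
      exacts [sigma_block hD I h, pi_block hD I h]

/-- The translation of sentences. -/
theorem holds (hD : Definable K .sigma 0 fun M S (x : P ⊕ Unit → M) =>
      D M S (x ∘ Sum.inl) (x (Sum.inr ())))
    (hT : ∀ {r : ℕ} (R : L₁.Relations r) (b : Kind),
      DefinableOn K D b (k + 1) fun M S u w => (T M S u).RelMap R w)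
    {l : ℕ} (φ : Fml L₁ b (l + 1) 0) :
    Definable K b (k + l + 1) fun M S (u : P → M) => φ.Holds (T M S u) := by
  obtain ⟨Q, hQ, hQ'⟩ := fml hD hT φ
  refine (hQ.rename (Sum.elim id Fin.elim0)).congr fun M S hS u => ?_
  refine (hQ' M S hS u Fin.elim0).trans ?_
  congr!
  funext i
  rcases i with i | i
  · rfl
  · exact i.elim0

end DefinableOn

end Interpretation

/-! ## Axioms for jump inversions -/

section Axioms

variable {L : FirstOrder.Language.{0, 0}} {M : Type}

/-- The elements that satisfy `U`. -/
def MarkedU (S : (invLang L).Structure M) (a : M) : Prop :=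
  S.RelMap (Sum.inr MarkRel.U) ![a]

/-- `E(u, v, x)` (for `true`) or `F(u, v, x)` (for `false`). -/
def Marked (S : (invLang L).Structure M) (c : Bool) (u v x : M) : Prop :=
  S.RelMap (Sum.inr (pieceMark c)) ![u, v, x]

/-- The `L`-structure on the set of all `x` with `E(u, v, x)` or with `F(u, v, x)`. -/
@[reducible]
def pieceOf [L.IsRelational] (S : (invLang L).Structure M) (c : Bool) (u : Fin 2 → M) :
    L.Structure {x // Marked S c (u 0) (u 1) x} where
  funMap f _ := isEmptyElim f
  RelMap R w := S.RelMap (Sum.inl R) fun i => w i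

/-- The graph on the set of all `u` with `U(u)`, in which `u` and `v` are adjacent if the structure
given by `E(u, v, ·)` satisfies `φ`. -/
@[reducible]
def graphOf [L.IsRelational] {b : Kind} {n : ℕ} (φ : Fml L b n 0) (S : (invLang L).Structure M) :
    FirstOrder.Language.graph.Structure {a // MarkedU S a} where
  funMap f _ := isEmptyElim f
  RelMap {k} R w :=
    match k, R, w with
    | _, .adj, w => w 0 ≠ w 1 ∧ φ.Holds (pieceOf S true fun i => w i)

/-- The axioms of jump inversions built from `A` and `B`. -/
structure IsInversion [L.IsRelational] (A B : L.Structure ℕ) (S : (invLang L).Structure M) :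
    Prop where
  marked : ∀ (c : Bool) (u v x : M), Marked S c u v x →
    MarkedU S u ∧ MarkedU S v ∧ u ≠ v ∧ ¬ MarkedU S x ∧ Marked S c v u x
  unique : ∀ (c c' : Bool) (u v u' v' x : M), Marked S c u v x → Marked S c' u' v' x →
    c = c' ∧ (u = u' ∧ v = v' ∨ u = v' ∧ v = u')
  exists_marked : ∀ x : M, ¬ MarkedU S x → ∃ (c : Bool) (y : Fin 2 → M), Marked S c (y 0) (y 1) x
  rel : ∀ (R : Σ k, L.Relations k) (x : Fin R.1 → M), S.RelMap (Sum.inl R.2) x →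
    ∃ (c : Bool) (y : Fin 2 → M), ∀ i, Marked S c (y 0) (y 1) (x i)
  piece : ∀ u : Fin 2 → M, MarkedU S (u 0) → MarkedU S (u 1) → u 0 ≠ u 1 →
    ∃ d : Bool, ∀ c : Bool, Isomorphic (pieceOf S c u) (if d = c then A else B)

variable {K : ∀ M : Type, (invLang L).Structure M → Prop} {b : Kind} {k : ℕ} {ι : Type} [Finite ι]

theorem definable_markedU (i : ι) :
    Definable K b k fun M S (x : ι → M) => MarkedU S (x i) :=
  (Definable.rel (b := b) (Sum.inr MarkRel.U) ![i]).of_qf.congr fun M S _ x => by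
    unfold MarkedU
    congr!
    funext t
    fin_cases t
    rfl

theorem definable_marked (c : Bool) (i j l : ι) :
    Definable K b k fun M S (x : ι → M) => Marked S c (x i) (x j) (x l) :=
  (Definable.rel (b := b) (Sum.inr (pieceMark c)) ![i, j, l]).of_qf.congr fun M S _ x => by
    unfold Marked
    congr!
    funext t
    fin_cases t <;> rfl

theorem definable_ne (i j : ι) : Definable K b k fun M _ (x : ι → M) => x i ≠ x j :=
  ((Definable.eq (b := b) i j).qf_neg (b' := b)).of_qf

theorem definable_inl {r : ℕ} (R : L.Relations r) (v : Fin r → ι) :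
    Definable K b k fun M S (x : ι → M) => S.RelMap (Sum.inl R) (x ∘ v) :=
  (Definable.rel (L := invLang L) (b := b) (Sum.inl R) v).of_qf

variable [L.IsRelational]

open Classical in
-- Since `φ` separates `A` from `B`, the `d` of the axiom `piece` is the truth value of `φ` in the
-- `E`-piece, and this fixes the isomorphism type of both pieces.
theorem IsInversion.holds_pieceOf {A B : L.Structure ℕ} {S : (invLang L).Structure M}
    (h : IsInversion A B S) {b : Kind} {n : ℕ} {φ : Fml L b n 0} (hA : φ.Holds A)
    (hB : ¬ φ.Holds B) {u : Fin 2 → M} (h0 : MarkedU S (u 0)) (h1 : MarkedU S (u 1))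
    (hne : u 0 ≠ u 1) (c : Bool) :
    Isomorphic (pieceOf S c u) (if φ.Holds (pieceOf S true u) ↔ c = true then A else B) ∧
      (φ.Holds (pieceOf S c u) ↔ (φ.Holds (pieceOf S true u) ↔ c = true)) := by
  obtain ⟨d, hd⟩ := h.piece u h0 h1 hne
  have hφ : ∀ c, φ.Holds (pieceOf S c u) ↔ d = c := fun c => by
    rw [(hd c).holds_iff]
    split_ifs with hc <;> simp [hA, hB, hc]
  have hdc : (d = true ↔ c = true) ↔ d = c := by cases c <;> cases d <;> simp
  rw [hφ, hφ]
  simp only [hdc]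
  exact ⟨by convert hd c, trivial⟩

/-- A piece is interpreted with its two vertices as parameters. Its domain and relations are
quantifier-free, so the level of `χ` is preserved. -/
theorem definable_holds_pieceOf (χ : Fml L b (k + 1) 0) (c : Bool) :
    Definable K b (k + 1) fun M S (u : Fin 2 → M) => χ.Holds (pieceOf S c u) := by
  have := DefinableOn.holds (K := K) (k := 0) (P := Fin 2)
    (D := fun M S u a => Marked S c (u 0) (u 1) a) (T := fun M S u => pieceOf S c u)
    (definable_marked c (Sum.inl 0) (Sum.inl 1) (Sum.inr ()))
    (fun R b => ⟨fun M S x => S.RelMap (Sum.inl R) (x ∘ Sum.inr),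
      definable_inl R Sum.inr, fun M S _ u w => Iff.rfl⟩) χ
  rwa [zero_add] at this

/-- The axioms of jump inversions are expressed by a `Π` formula. -/
theorem definable_isInversion [Countable (Σ k, L.Relations k)] {A B : L.Structure ℕ} {n : ℕ}
    (hA : HasScottSentence .pi (n + 2) A) (hB : HasScottSentence .pi (n + 2) B) :
    Definable (fun M (_ : (invLang L).Structure M) => Countable M) .pi (n + 2)
      fun M S (_ : Empty → M) => IsInversion A B S := by
  let K : ∀ M, (invLang L).Structure M → Prop := fun M _ => Countable M
  have h1 : Definable K .pi (n + 2) fun M S (_ : Empty → M) =>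
      ∀ c, ∀ y : Fin 3 → M, Marked S c (y 0) (y 1) (y 2) → MarkedU S (y 0) ∧ MarkedU S (y 1) ∧
        y 0 ≠ y 1 ∧ ¬ MarkedU S (y 2) ∧ Marked S c (y 1) (y 0) (y 2) :=
    Definable.forall_forall fun c => (definable_marked c (Sum.inr 0) (Sum.inr 1) (Sum.inr 2)).imp
      ((definable_markedU (Sum.inr 0)).and ((definable_markedU (Sum.inr 1)).and
        ((definable_ne (Sum.inr 0) (Sum.inr 1)).and ((definable_markedU (Sum.inr 2)).neg_dual.and
          (definable_marked c (Sum.inr 1) (Sum.inr 0) (Sum.inr 2))))))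
  have h2 : Definable K .pi (n + 2) fun M S (_ : Empty → M) =>
      ∀ c : Bool × Bool, ∀ y : Fin 5 → M, Marked S c.1 (y 0) (y 1) (y 4) →
        Marked S c.2 (y 2) (y 3) (y 4) →
          c.1 = c.2 ∧ (y 0 = y 2 ∧ y 1 = y 3 ∨ y 0 = y 3 ∧ y 1 = y 2) :=
    Definable.forall_forall (J := Bool × Bool) (κ := fun _ => Fin 5) fun c =>
      (definable_marked c.1 (Sum.inr 0) (Sum.inr 1) (Sum.inr 4)).imp
        ((definable_marked c.2 (Sum.inr 2) (Sum.inr 3) (Sum.inr 4)).imp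
          ((Definable.const (c.1 = c.2)).and
            (((Definable.eq (b := .pi) (Sum.inr 0) (Sum.inr 2)).and
              (Definable.eq (Sum.inr 1) (Sum.inr 3))).or
              ((Definable.eq (b := .pi) (Sum.inr 0) (Sum.inr 3)).and
                (Definable.eq (Sum.inr 1) (Sum.inr 2)))).of_qf))
  -- A universal quantifier over a `Σ_1` statement; `h4` has the same form, with a countable
  -- conjunction over the symbols of `L`.
  have h3 : Definable K .pi (n + 2) fun M S (_ : Empty → M) =>
      ∀ x : Fin 1 → M, ¬ MarkedU S (x 0) →
        ∃ (c : Bool) (y : Fin 2 → M), Marked S c (y 0) (y 1) (x 0) :=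
    Definable.forall_tuple (((definable_markedU (b := .pi) (Sum.inr 0)).neg_dual (b := .sigma)).imp
      (((Definable.exists_exists (k := 0) fun c => definable_marked c (Sum.inr 0) (Sum.inr 1)
        (Sum.inl (Sum.inr 0))).mono (Nat.succ_le_succ n.zero_le)).lift))
  have h4 : Definable K .pi (n + 2) fun M S (_ : Empty → M) =>
      ∀ (R : Σ k, L.Relations k) (x : Fin R.1 → M), S.RelMap (Sum.inl R.2) x →
        ∃ (c : Bool) (y : Fin 2 → M), ∀ i, Marked S c (y 0) (y 1) (x i) :=
    Definable.forall_forall (J := Σ k, L.Relations k) (κ := fun R => Fin R.1) fun R =>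
      (definable_inl R.2 Sum.inr).imp
        (((Definable.exists_exists (k := 0) (J := Bool) (κ := fun _ => Fin 2) fun c =>
          Definable.fin_forall fun i =>
          definable_marked c (Sum.inr 0) (Sum.inr 1) (Sum.inl (Sum.inr i))).mono
            (Nat.succ_le_succ n.zero_le)).lift)
  have h5 : Definable K .pi (n + 2) fun M S (_ : Empty → M) =>
      ∀ u : Fin 2 → M, MarkedU S (u 0) → MarkedU S (u 1) → u 0 ≠ u 1 →
        ∃ d : Bool, ∀ c : Bool, Isomorphic (pieceOf S c u) (if d = c then A else B) := by
    -- The only axiom that needs the full level `n + 2`. Scott sentences speak about countable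
    -- structures only, whence the restriction of the class.
    have hiso : ∀ d c : Bool, Definable K .pi (n + 2) fun M S (u : Fin 2 → M) =>
        Isomorphic (pieceOf S c u) (if d = c then A else B) := fun d c => by
      obtain ⟨χ, hχ⟩ : HasScottSentence .pi (n + 2) (if d = c then A else B) := by
        split_ifs
        exacts [hA, hB]
      refine (definable_holds_pieceOf χ c).congr fun M S hM u => ?_
      have : Countable M := hM
      exact (hχ _ _).symm
    -- The choice of `d` is a disjunction of two `Π` statements, not a quantifier over elements, so
    -- it remains `Π`.
    have hd : Definable K .pi (n + 2) fun M S (u : Fin 2 → M) =>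
        ∃ d : Bool, ∀ c : Bool, Isomorphic (pieceOf S c u) (if d = c then A else B) :=
      ((Definable.countable_forall (hiso false)).or (Definable.countable_forall (hiso true))).congr
        fun M S _ u => by rw [Bool.exists_bool]
    exact Definable.forall_tuple ((definable_markedU (Sum.inr 0)).imp
      ((definable_markedU (Sum.inr 1)).imp ((definable_ne (Sum.inr 0) (Sum.inr 1)).imp
        (hd.rename Sum.inr))))
  refine (h1.and (h2.and (h3.and (h4.and h5)))).congr fun M S _ _ => ⟨fun h => ?_, ?_⟩
  · exact ⟨fun c y => h.marked c _ _ _, fun c y => h.unique _ _ _ _ _ _ _,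
      fun x => h.exists_marked _, h.rel, h.piece⟩
  · rintro ⟨h1, h2, h3, h4, h5⟩
    exact ⟨fun c u v x => h1 c ![u, v, x], fun c c' u v u' v' x => h2 (c, c') ![u, v, u', v', x],
      fun x => h3 ![x], h4, h5⟩

/-- Formulas about the graph of a jump inversion are translated into formulas about the jump
inversion. -/
theorem definable_holds_graphOf {A B : L.Structure ℕ} {n : ℕ} {φ : Fml L .sigma (n + 1) 0}
    (hA : φ.Holds A) (hB : ¬ φ.Holds B) (ψ : Fml FirstOrder.Language.graph b (k + 1) 0) :
    Definable (fun M (S : (invLang L).Structure M) => IsInversion A B S) b (n + k + 1)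
      fun M S (_ : Empty → M) => ψ.Holds (graphOf φ S) := by
  refine DefinableOn.holds (D := fun M S _ a => MarkedU S a) (T := fun M S _ => graphOf φ S)
    (definable_markedU (Sum.inr ())) (fun R b => ?_) ψ
  cases R with
  | adj =>
    cases b with
    | sigma =>
      refine ⟨_, (definable_ne (Sum.inr 0) (Sum.inr 1)).and
        ((definable_holds_pieceOf φ true).rename Sum.inr), fun M S hS u w => ?_⟩
      exact and_congr_left' Subtype.coe_ne_coe.symm
    | pi =>
      -- The `F`-piece provides the `Π` definition: `φ` fails there exactly when it holds in the
      -- `E`-piece.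
      refine ⟨_, (definable_ne (Sum.inr 0) (Sum.inr 1)).and
        (((definable_holds_pieceOf φ false).rename Sum.inr).neg), fun M S hS u w => ?_⟩
      refine (and_congr_left' Subtype.coe_ne_coe.symm).trans (and_congr_right fun hne => ?_)
      have := (hS.holds_pieceOf hA hB (u := fun i => w i) (w 0).2 (w 1).2 hne false).2
      refine Iff.trans ?_ (not_congr this.symm)
      simp

end Axioms

/-! ## The models of the axioms -/

instance : markLang.IsRelational := fun _ => inferInstanceAs (IsEmpty Empty)

section Models

variable {L : FirstOrder.Language.{0, 0}} [L.IsRelational] {A B : L.Structure ℕ} {V : Type}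
  {G : SimpleGraph V}

theorem markedU_jumpInversion {a : InvUniverse V} :
    MarkedU (jumpInversion A B G) a ↔ ∃ u : V, a = Sum.inl u := Iff.rfl

theorem marked_jumpInversion {c : Bool} {a b x : InvUniverse V} :
    Marked (jumpInversion A B G) c a b x ↔ ∃ (u v : V) (h : ¬ (s(u, v)).IsDiag) (i : ℕ),
      a = Sum.inl u ∧ b = Sum.inl v ∧ x = Sum.inr (⟨s(u, v), h⟩, c, i) :=
  markHolds_pieceMark c _

variable [IsEmpty (L.Relations 0)]

theorem isomorphic_pieceOf_jumpInversion {u v : V} (h : ¬ (s(u, v)).IsDiag) (c : Bool)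
    {a : Fin 2 → InvUniverse V} (h0 : a 0 = Sum.inl u) (h1 : a 1 = Sum.inl v) :
    Isomorphic (pieceOf (jumpInversion A B G) c a) (piece A B G s(u, v) c) := by
  let f : ℕ → {x // Marked (jumpInversion A B G) c (a 0) (a 1) x} := fun i =>
    ⟨Sum.inr (⟨s(u, v), h⟩, c, i), marked_jumpInversion.2 ⟨u, v, h, i, h0, h1, rfl⟩⟩
  have hf : Function.Bijective f := by
    refine ⟨fun i j hij => by simpa [f] using hij, ?_⟩
    rintro ⟨x, hx⟩
    obtain ⟨u', v', h', i, h0', h1', rfl⟩ := marked_jumpInversion.1 hx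
    obtain rfl : u = u' := Sum.inl_injective (h0.symm.trans h0')
    obtain rfl : v = v' := Sum.inl_injective (h1.symm.trans h1')
    exact ⟨i, rfl⟩
  refine (isomorphic_of_equiv (Equiv.ofBijective f hf) fun R x => ?_).symm
  exact relMap_jumpInversion_inl R ⟨s(u, v), h⟩ c x

theorem isInversion_jumpInversion : IsInversion A B (jumpInversion A B G) where
  marked c a b x hx := by
    obtain ⟨u, v, h, i, rfl, rfl, rfl⟩ := marked_jumpInversion.1 hx
    refine ⟨⟨u, rfl⟩, ⟨v, rfl⟩, fun huv => h (Sum.inl_injective huv), ?_,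
      marked_jumpInversion.2 ⟨v, u, fun h' => h h'.symm, i, rfl, rfl, by simp [Sym2.eq_swap]⟩⟩
    rintro ⟨w, hw⟩
    exact Sum.inr_ne_inl hw
  unique c c' a b a' b' x hx hx' := by
    obtain ⟨u, v, h, i, rfl, rfl, rfl⟩ := marked_jumpInversion.1 hx
    obtain ⟨u', v', h', i', rfl, rfl, hi⟩ := marked_jumpInversion.1 hx'
    simp only [Sum.inr.injEq, Prod.mk.injEq, Subtype.mk.injEq, Sym2.eq_iff] at hi
    simpa using ⟨hi.2.1, hi.1⟩
  exists_marked x hx := by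
    rcases x with u | ⟨⟨p, hp⟩, c, i⟩
    · exact absurd ⟨u, rfl⟩ hx
    · induction p with
      | h u v => exact ⟨c, ![Sum.inl u, Sum.inl v],
          marked_jumpInversion.2 ⟨u, v, hp, i, rfl, rfl, rfl⟩⟩
  rel := by
    rintro R x ⟨⟨p, hp⟩, c, a, rfl, -⟩
    induction p with
    | h u v => exact ⟨c, ![Sum.inl u, Sum.inl v], fun i =>
        marked_jumpInversion.2 ⟨u, v, hp, a i, rfl, rfl, rfl⟩⟩
  piece a h0 h1 hne := by
    classical
    obtain ⟨u, hu⟩ := markedU_jumpInversion.1 h0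
    obtain ⟨v, hv⟩ := markedU_jumpInversion.1 h1
    have h : ¬ (s(u, v)).IsDiag := fun h => hne (by rw [hu, hv, Sym2.mk_isDiag_iff.1 h])
    refine ⟨decide (s(u, v) ∈ G.edgeSet), fun c => ?_⟩
    have := isomorphic_pieceOf_jumpInversion (A := A) (B := B) (G := G) h c hu hv
    convert this using 2
    by_cases hG : s(u, v) ∈ G.edgeSet <;> cases c <;> simp [hG]

theorem isomorphic_graphOf_jumpInversion {b : Kind} {n : ℕ} {φ : Fml L b n 0} (hA : φ.Holds A)
    (hB : ¬ φ.Holds B) : Isomorphic (graphOf φ (jumpInversion A B G)) G.structure := by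
  let f : V → {a // MarkedU (jumpInversion A B G) a} := fun u => ⟨Sum.inl u, u, rfl⟩
  have hf : Function.Bijective f := by
    refine ⟨fun u v huv => Sum.inl_injective (congrArg Subtype.val huv), ?_⟩
    rintro ⟨x, u, hx⟩
    exact ⟨u, Subtype.ext hx.symm⟩
  refine (isomorphic_of_equiv (Equiv.ofBijective f hf) fun R x => ?_).symm
  cases R with
  | adj =>
    change (f (x 0) ≠ f (x 1) ∧ _) ↔ G.Adj (x 0) (x 1)
    rw [hf.1.ne_iff]
    constructor
    · rintro ⟨hne, h⟩
      rw [(isomorphic_pieceOf_jumpInversion (u := x 0) (v := x 1) hne true rfl rfl).holds_iff,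
        holds_piece_iff hA hB] at h
      exact h.2 rfl
    · refine fun h => ⟨h.ne, ?_⟩
      rw [(isomorphic_pieceOf_jumpInversion (u := x 0) (v := x 1) h.ne true rfl rfl).holds_iff,
        holds_piece_iff hA hB]
      exact iff_of_true h rfl

/-- A model of the axioms is determined by its graph. -/
theorem IsInversion.isomorphic {M : Type} {S : (invLang L).Structure M} (h : IsInversion A B S)
    {b : Kind} {n : ℕ} {φ : Fml L b n 0} (hA : φ.Holds A) (hB : ¬ φ.Holds B)
    (hG : Isomorphic (graphOf φ S) G.structure) : Isomorphic S (jumpInversion A B G) := by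
  classical
  obtain ⟨g, hg⟩ := hG.exists_equiv
  have hadj : ∀ u : Fin 2 → {a // MarkedU S a}, G.Adj (g (u 0)) (g (u 1)) ↔
      u 0 ≠ u 1 ∧ φ.Holds (pieceOf S true fun i => u i) := fun u => hg Language.adj u
  -- a choice of an ordered pair for every unordered pair
  have hpair : ∀ p : {p : Sym2 V // ¬ p.IsDiag}, ∃ u : Fin 2 → {a // MarkedU S a},
      p.1 = s(g (u 0), g (u 1)) ∧ u 0 ≠ u 1 := by
    rintro ⟨p, hp⟩
    induction p with
    | h v w =>
      refine ⟨![g.symm v, g.symm w], by simp, fun h => hp ?_⟩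
      exact g.symm.injective h
  choose u hu hne using hpair
  have hpiece : ∀ p c, Isomorphic (UJI.piece A B G p.1 c) (pieceOf S c fun i => (u p i : M)) :=
    fun p c => by
      have := (h.holds_pieceOf hA hB (u := fun i => (u p i : M)) (u p 0).2 (u p 1).2
        (Subtype.coe_ne_coe.2 (hne p)) c).1.symm
      convert this using 2
      rw [hu p, SimpleGraph.mem_edgeSet, hadj]
      simp [hne p]
  choose ι hι using fun p c => show ∃ e : ℕ ≃ {x // Marked S c (u p 0) (u p 1) x},
      ∀ {k : ℕ} (R : L.Relations k) (x : Fin k → ℕ),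
        S.RelMap (Sum.inl R) (fun i => (e (x i) : M)) ↔ (UJI.piece A B G p.1 c).RelMap R x from
    (hpiece p c).exists_equiv
  have hmk : ∀ p c i, Marked S c (u p 0) (u p 1) (ι p c i) := fun p c i => (ι p c i).2
  -- an element of one piece determines the piece
  have huniq : ∀ {p c} {i : ℕ} {c' : Bool} {v w : {a // MarkedU S a}},
      Marked S c' v w (ι p c i) → c = c' ∧ p.1 = s(g v, g w) := fun {p c i c' v w} hx => by
    obtain ⟨rfl, hvw⟩ := h.unique _ _ _ _ _ _ _ (hmk p c i) hx
    refine ⟨rfl, ?_⟩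
    rw [hu p, Sym2.eq_iff]
    simpa only [Subtype.coe_inj, g.injective.eq_iff] using hvw
  have hex : ∀ {c : Bool} {v w : {a // MarkedU S a}} {x : M}, Marked S c v w x →
      ∃ hd : ¬ (s(g v, g w)).IsDiag, ∃ i, x = ι ⟨s(g v, g w), hd⟩ c i := fun {c v w x} hx => by
    have hd : ¬ (s(g v, g w)).IsDiag := fun hd => (h.marked _ _ _ _ hx).2.2.1
      (congrArg Subtype.val (g.injective hd))
    refine ⟨hd, ?_⟩
    have hx' : Marked S c (u ⟨_, hd⟩ 0) (u ⟨_, hd⟩ 1) x := by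
      have := hu ⟨_, hd⟩
      simp only [Sym2.eq_iff, g.injective.eq_iff] at this
      -- The ordered pair chosen for `{v, w}` may be `(w, v)`; the symmetry of the marks takes care
      -- of this case.
      rcases this with ⟨h0, h1⟩ | ⟨h0, h1⟩
      · rwa [← h0, ← h1]
      · rw [← h0, ← h1]
        exact (h.marked _ _ _ _ hx).2.2.2.2
    exact ⟨(ι ⟨_, hd⟩ c).symm ⟨x, hx'⟩, by simp⟩
  -- The isomorphism is glued from `g⁻¹` on the vertices and the `ι` on the pieces: the pieces are
  -- disjoint by `unique` and exhaust the remaining elements by `exists_marked`.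
  let f : InvUniverse V → M := Sum.elim (fun v => (g.symm v : M)) fun y => (ι y.1 y.2.1 y.2.2 : M)
  have hnot : ∀ y, ¬ MarkedU S (f (Sum.inr y)) := fun y =>
    (h.marked _ _ _ _ (hmk y.1 y.2.1 y.2.2)).2.2.2.1
  have hf : Function.Bijective f := by
    constructor
    · rintro (v | ⟨p, c, i⟩) (w | ⟨q, d, j⟩) hvw
      · exact congrArg _ (g.symm.injective (Subtype.ext hvw))
      · exact absurd (hvw ▸ show MarkedU S (f (Sum.inl v)) from (g.symm v).2) (hnot _)
      · exact absurd (hvw ▸ show MarkedU S (f (Sum.inl w)) from (g.symm w).2) (hnot _)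
      · have hvw : (ι p c i : M) = ι q d j := hvw
        obtain ⟨rfl, hpq⟩ := huniq (hvw ▸ hmk q d j : Marked S d (u q 0) (u q 1) (ι p c i))
        obtain rfl : p = q := Subtype.ext (hpq.trans (hu q).symm)
        rw [(ι p c).injective (Subtype.ext hvw)]
    · intro x
      by_cases hx : MarkedU S x
      · exact ⟨Sum.inl (g ⟨x, hx⟩), by simp [f]⟩
      · obtain ⟨c, y, hy⟩ := h.exists_marked x hx
        have hm := h.marked _ _ _ _ hy
        obtain ⟨hd, i, hi⟩ := hex (v := ⟨_, hm.1⟩) (w := ⟨_, hm.2.1⟩) hy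
        exact ⟨Sum.inr (_, c, i), hi.symm⟩
  have hU : ∀ x, MarkedU S (f x) ↔ MarkedU (jumpInversion A B G) x := fun x => by
    rcases x with v | y
    · exact iff_of_true (g.symm v).2 ⟨v, rfl⟩
    · exact iff_of_false (hnot y) fun ⟨v, hv⟩ => Sum.inr_ne_inl hv
  have hM : ∀ c x y z, Marked S c (f x) (f y) (f z) ↔ Marked (jumpInversion A B G) c x y z :=
    fun c x y z => by
      rw [marked_jumpInversion]
      constructor
      · intro hxyz
        have hm := h.marked _ _ _ _ hxyz
        obtain ⟨v, rfl⟩ := (hU x).1 hm.1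
        obtain ⟨w, rfl⟩ := (hU y).1 hm.2.1
        rcases z with z | ⟨⟨p, hp⟩, d, i⟩
        · exact absurd (g.symm z).2 hm.2.2.2.1
        · obtain ⟨rfl, hp'⟩ := huniq (v := g.symm v) (w := g.symm w) hxyz
          simp only [Equiv.apply_symm_apply] at hp'
          subst hp'
          exact ⟨v, w, hp, i, rfl, rfl, rfl⟩
      · rintro ⟨v, w, hd, i, rfl, rfl, rfl⟩
        have := hmk ⟨_, hd⟩ c i
        have hp := hu ⟨_, hd⟩
        simp only [Sym2.eq_iff, ← Equiv.symm_apply_eq] at hp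
        change Marked S c (g.symm v) (g.symm w) (ι ⟨_, hd⟩ c i)
        generalize (ι ⟨_, hd⟩ c i : M) = z at this ⊢
        rcases hp with ⟨h0, h1⟩ | ⟨h0, h1⟩
        · rwa [h0, h1]
        · rw [h0, h1]
          exact (h.marked _ _ _ _ this).2.2.2.2
  refine Isomorphic.symm (isomorphic_of_equiv (Equiv.ofBijective f hf) fun {k} R x => ?_)
  cases R with
  | inl R =>
    constructor
    · intro hR
      -- The axiom `rel` puts the whole tuple inside one piece, where `ι` is an isomorphism;
      -- positive arity supplies an entry from which the two vertices are known to be distinct.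
      obtain ⟨c, y, hy⟩ := h.rel ⟨_, R⟩ _ hR
      have hk : 0 < k := Nat.pos_of_ne_zero fun h0 => by subst h0; exact isEmptyElim R
      have hm := h.marked _ _ _ _ (hy ⟨0, hk⟩)
      have hx : ∀ i, ∃ a, x i = Sum.inr (⟨s(g ⟨_, hm.1⟩, g ⟨_, hm.2.1⟩), fun hd => hm.2.2.1
          (congrArg Subtype.val (g.injective hd))⟩, c, a) := fun i => by
        obtain ⟨hd, a, ha⟩ := hex (v := ⟨_, hm.1⟩) (w := ⟨_, hm.2.1⟩) (hy i)
        exact ⟨a, hf.1 ha⟩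
      choose a ha using hx
      refine ⟨_, c, a, funext ha, (hι _ c R a).1 ?_⟩
      convert hR using 1
      exact funext fun i => (congrArg f (ha i)).symm
    · rintro ⟨p, c, a, rfl, hR⟩
      exact (hι p c R a).2 hR
  | inr R =>
    have h1 : ∀ x : Fin 1 → InvUniverse V, f ∘ x = ![f (x 0)] ∧ x = ![x 0] := fun x =>
      ⟨by funext i; fin_cases i; rfl, by funext i; fin_cases i; rfl⟩
    have h3 : ∀ x : Fin 3 → InvUniverse V,
        f ∘ x = ![f (x 0), f (x 1), f (x 2)] ∧ x = ![x 0, x 1, x 2] := fun x =>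
      ⟨by funext i; fin_cases i <;> rfl, by funext i; fin_cases i <;> rfl⟩
    rw [Equiv.coe_ofBijective]
    cases R with
    | U =>
      rw [(h1 x).1, (h1 x).2]
      exact hU (x 0)
    | E =>
      rw [(h3 x).1, (h3 x).2]
      exact hM true _ _ _
    | F =>
      rw [(h3 x).1, (h3 x).2]
      exact hM false _ _ _

end Models

/-! ## Translation of sentences and Scott sentences -/

theorem Definable.exists_sentence {L : FirstOrder.Language.{0, 0}}
    {K : ∀ M : Type, L.Structure M → Prop} {b : Kind} {k : ℕ} {P : ∀ M : Type, L.Structure M → Prop}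
    (h : Definable K b k fun M S (_ : Empty → M) => P M S) :
    ∃ φ : Fml L b k 0, ∀ (M : Type) (S : L.Structure M), K M S → (P M S ↔ φ.Holds S) := by
  obtain ⟨φ, hφ⟩ := h.exists_fml (Equiv.equivOfIsEmpty (Fin 0) Empty)
  refine ⟨φ, fun M S hS => (hφ M S hS Empty.elim).trans ?_⟩
  unfold Fml.Holds
  congr!

theorem hasScottSentence_of_definable {L : FirstOrder.Language.{0, 0}} {b : Kind} {k : ℕ}
    {P : ∀ M : Type, L.Structure M → Prop}
    (h : Definable (fun M (_ : L.Structure M) => Countable M) b k fun M S (_ : Empty → M) => P M S)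
    {N : Type} [Countable N] {T : L.Structure N} (hT : P N T)
    (hP : ∀ (M : Type) (S : L.Structure M), P M S → Isomorphic S T) : HasScottSentence b k T := by
  obtain ⟨φ, hφ⟩ := h.exists_sentence
  refine ⟨φ, fun M hM S => ⟨fun hS => hP M S ((hφ M S hM).2 hS), fun hS => ?_⟩⟩
  rw [hS.holds_iff]
  exact (hφ N T ‹_›).1 hT

section Translation

variable {L : FirstOrder.Language.{0, 0}} [L.IsRelational] [IsEmpty (L.Relations 0)]
  {A B : L.Structure ℕ} {n : ℕ} {φ : Fml L .sigma (n + 1) 0}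

/-- Without variables and nullary symbols there are no atoms except falsity, so the truth value does
not depend on the graph. This settles `ℓ = 0`, where level `n` is too low for the definition of
adjacency. -/
theorem QF.realize_graph_iff {M N : Type} (S : FirstOrder.Language.graph.Structure M)
    (T : FirstOrder.Language.graph.Structure N) (θ : QF FirstOrder.Language.graph 0) :
    θ.Realize S Fin.elim0 ↔ θ.Realize T Fin.elim0 := by
  induction θ with
  | falsum => exact Iff.rfl
  | eq i j => exact i.elim0
  | rel R v => cases R; exact (v 0).elim0
  | neg θ ih => exact not_congr ih
  | and θ η ih ih' => exact and_congr ih ih'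
  | or θ η ih ih' => exact or_congr ih ih'

theorem exists_translation (hA : φ.Holds A) (hB : ¬ φ.Holds B) (l : ℕ)
    (ψ : Fml FirstOrder.Language.graph .sigma l 0) :
    ∃ ψ' : Fml (invLang L) .sigma (n + l) 0, ∀ (V : Type) (G : SimpleGraph V),
      ψ.Holds G.structure ↔ ψ'.Holds (jumpInversion A B G) := by
  cases l with
  | zero =>
    cases ψ with
    | qf θ =>
      -- The constant truth value is read off in the empty graph.
      obtain ⟨ψ', hψ'⟩ := (Definable.const (L := invLang L) (K := fun _ _ => True) (b := .sigma)
        (k := n) (ι := Empty)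
        (θ.Realize (⊥ : SimpleGraph Empty).structure Fin.elim0)).exists_sentence
      exact ⟨ψ', fun V G => (θ.realize_graph_iff _ _).trans (hψ' _ (jumpInversion A B G) trivial)⟩
  | succ l =>
    obtain ⟨ψ', hψ'⟩ := (definable_holds_graphOf hA hB ψ).exists_sentence
    exact ⟨ψ', fun V G => ((isomorphic_graphOf_jumpInversion hA hB).holds_iff ψ).symm.trans
      (hψ' _ _ isInversion_jumpInversion)⟩

/-- The Scott sentence is the conjunction of the axioms and the translated Scott sentence of the
graph. The hypothesis `hax` says that `Π_{n+2}` queries are available at the target kind and level,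
which lets both kinds share this proof. -/
theorem hasScottSentence_jumpInversion [Countable (Σ k, L.Relations k)] (hA : φ.Holds A)
    (hB : ¬ φ.Holds B) (hAS : HasScottSentence .pi (n + 2) A)
    (hBS : HasScottSentence .pi (n + 2) B) {V : Type} [Countable V] {G : SimpleGraph V} {b : Kind}
    {l : ℕ} (hax : ∀ P : ∀ M : Type, (invLang L).Structure M → Prop,
      Definable (fun M (_ : (invLang L).Structure M) => Countable M) .pi (n + 2)
          (fun M S (_ : Empty → M) => P M S) →
        Definable (fun M (_ : (invLang L).Structure M) => Countable M) b (n + l + 1)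
          fun M S (_ : Empty → M) => P M S)
    (hG : HasScottSentence b (l + 1) G.structure) :
    HasScottSentence b (n + l + 1) (jumpInversion A B G) := by
  obtain ⟨ψ, hψ⟩ := hG
  -- The translation is correct only on models of the axioms, hence `and_of`.
  have := (hax _ (definable_isInversion hAS hBS)).and_of
    (((definable_holds_graphOf hA hB ψ).mono_class fun _ _ h => h.2).congr
      (Q' := fun M S _ => Isomorphic (graphOf φ S) G.structure) fun M S h _ =>
        have : Countable M := h.1
        (hψ _ _).symm)
  exact hasScottSentence_of_definable this
    ⟨isInversion_jumpInversion, isomorphic_graphOf_jumpInversion hA hB⟩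
    fun M S h => h.1.isomorphic hA hB h.2

end Translation

end UJI

theorem mainTheorem4 (n : ℕ)
    -- a computable relational language without nullary symbols
    (L : FirstOrder.Language.{0, 0}) [L.IsRelational] [Encodable (Σ k, L.Relations k)]
    (hL : IsComputableLanguage L) (hL0 : IsEmpty (L.Relations 0))
    -- the set `S`, and the structures `A`, `B` and `C i`
    (S : Set ℕ) (hS : IsCompleteSigmaSucc (2 * n) S)
    (A B : L.Structure ℕ) (C : ℕ → L.Structure ℕ)
    (hA : IsComputableStructure A) (hB : IsComputableStructure B) (hC : IsComputableSequence C)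
    (hCA : ∀ i, i ∈ S → Isomorphic (C i) A) (hCB : ∀ i, i ∉ S → Isomorphic (C i) B)
    -- the sentence that separates `A` from `B`
    (φ : Fml L .sigma (n + 1) 0) (hφ : φ.IsComputableIn (zeroJump n))
    (hφA : φ.Holds A) (hφB : ¬ φ.Holds B)
    (hAS : HasScottSentence .pi (n + 2) A) (hBS : HasScottSentence .pi (n + 2) B) :
    -- (1), uniformly in the copy
    (∀ s : ℕ∞, ∃ h : ℕ → ℕ, Computable h ∧
      ∀ (V : Type) (G : SimpleGraph V), ENat.card V = s → ∀ e : ℕ,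
        IsCopyIndex (zeroJump (2 * n)) e G.structure →
          IsCopyIndex ∅ (h e) (jumpInversion A B G)) ∧
    -- (2), uniformly in the copy
    (∀ s : ℕ∞, ∃ h : ℕ → ℕ, Computable h ∧
      ∀ (V : Type) (G : SimpleGraph V), ENat.card V = s → ∀ e : ℕ,
        IsCopyIndex (zeroJump n) e (jumpInversion A B G) →
          IsCopyIndex (zeroJump (2 * n)) (h e) G.structure) ∧
    -- (3)
    (∀ (l : ℕ) (ψ : Fml FirstOrder.Language.graph .sigma l 0),
      ∃ ψ' : Fml (invLang L) .sigma (n + l) 0, ∀ (V : Type) (G : SimpleGraph V),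
        ψ.Holds G.structure ↔ ψ'.Holds (jumpInversion A B G)) ∧
    -- (4)
    (∀ (V : Type) [Countable V] (G : SimpleGraph V) (l : ℕ), 2 ≤ l →
      HasScottSentence .pi l G.structure →
        HasScottSentence .pi (n + l) (jumpInversion A B G)) ∧
    -- (5)
    (∀ (V : Type) [Countable V] (G : SimpleGraph V) (l : ℕ), 3 ≤ l →
      HasScottSentence .sigma l G.structure →
        HasScottSentence .sigma (n + l) (jumpInversion A B G)) := by
  have h2n : zeroJump (2 * n) = jump^[n] (zeroJump n) := by rw [two_mul, zeroJump_add]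
  refine ⟨exists_copy_of_graph hS hC hCA hCB, fun _ => ?_, exists_translation hφA hφB, ?_, ?_⟩
  -- In this direction one function serves all cardinalities.
  · obtain ⟨h, hh, hcopy⟩ := exists_graph_of_copy (zeroJump n) hφ hφA hφB
    exact ⟨h, hh, fun V G _ e he => h2n ▸ hcopy V G e he⟩
  · intro V _ G l hl hG
    obtain ⟨l, rfl⟩ := Nat.exists_eq_add_of_le' (one_le_two.trans hl)
    exact hasScottSentence_jumpInversion hφA hφB hAS hBS (fun _ h => h.mono (by omega)) hG
  · intro V _ G l hl hG
    obtain ⟨l, rfl⟩ := Nat.exists_eq_add_of_le' ((show 1 ≤ 3 by decide).trans hl)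
    -- The `Π_{n+2}` axioms become `Σ` at level `n + 3`, which is why `ℓ ≥ 3` is required.
    exact hasScottSentence_jumpInversion hφA hφB hAS hBS
      (fun _ h => (h.lift (b' := .sigma)).mono (by omega)) hG
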